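/- **Setting.** Let $(X,\mathcal A)$ be a measurable space and $H$ a separable RKHS on $X$ whose kernel $k$ is bounded and $\mathcal A\otimes\mathcal A$-measurable. For a probability measure $\nu$ on $X$ let $I_\nu:H\to L_2(\nu)$, $f\mapsto[f]_\nu$, and let $T_\nu=I_\nu I_\nu^*$, $C_\nu=I_\nu^*I_\nu$. Let $(\mu_i)_{i\in I}$, with $I=\{1,\dots,N\}$ or $I=\mathbb N$, be the decreasing sequence of positive eigenvalues (with multiplicity) in a spectral decomposition $T_\nu=\sum_{i\in I}\mu_i\langle\cdot,[e_i]_\nu\rangle[e_i]_\nu$, $C_\nu=\sum_{i\in I}\mu_i\langle\cdot,\mu_i^{1/2}e_i\rangle_H\,\mu_i^{1/2}e_i$, where $e_i\in H$, $([e_i]_\nu)_i$ is orthonormal in $L_2(\nu)$ and $(\mu_i^{1/2}e_i)_i$ is orthonormal in $H$. For $\gamma\ge0$ put $[H]^\gamma_\nu=\{\sum_i a_i\mu_i^{\gamma/2}[e_i]_\nu:(a_i)\in\ell_2(I)\}$ with $\|\sum_i a_i\mu_i^{\gamma/2}[e_i]_\nu\|_{[H]^\gamma_\nu}=\|(a_i)\|_{\ell_2(I)}$;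 the norm is $\infty$ outside this space. Let $0<p_{lb}\le p\le\alpha\le1$, $0\le\gamma\le1$, $\gamma<\beta\le2$, and let $A,C,c,B,B_\infty,L,\sigma>0$ be constants. Let $\mathfrak X$ be the set of probability measures $\nu$ on $X$ such that $(X,\mathcal A)$ is $\nu$-complete, $[H]^\alpha_\nu$ embeds into $L_\infty(\nu)$ with norm at most $A$, and $\mu_i\le C\,i^{-1/p}$ for all $i\in I$. Let $\mathfrak X^{lb}$ be the set of those $\nu\in\mathfrak X$ with $c\,i^{-1/p_{lb}}\le\mu_i$ for all $i\in I$. For a set $\mathfrak Y$ of probability measures on $X$ let $\mathfrak M(\mathfrak Y)$ be the set of probability measures $P$ on $X\times\mathbb R$ with marginal $\nu=P_X\in\mathfrak Y$, $\int y^2\,dP<\infty$, whose conditional mean $f_P^*(x)=\int y\,P(dy|x)$ satisfies $\|f_P^*\|^2_{L_\infty(\nu)}\le B_\infty$ and $\|f_P^*\|^2_{[H]^\beta_\nu}\le B$, and with $\int|y-f_P^*(x)|^m\,P(dy|x)\le\frac12 m!\,\sigma^2L^{m-2}$ for $\nu$-almost all $x$ and all integers $m\ge2$. Put $\mathfrak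 M=\mathfrak M(\mathfrak X)$ and $\mathfrak M^{lb}=\mathfrak M(\mathfrak X^{lb})$. A measurable learning method with respect to a set $\mathfrak N$ of such $P$ (and $\gamma$), for sample size $n$, is a map $D\mapsto f_D$ from $(X\times\mathbb R)^n$ to the measurable functions $X\to\mathbb R$ such that, for all $P\in\mathfrak N$ with marginal $\nu$, $D\mapsto\|[f_D]_\nu-f_P^*\|_{[H]^\gamma_\nu}\in[0,\infty]$ is measurable for the universal completion of the product $\sigma$-algebra, to which $P^n$ is extended. **Theorem.** Assume that $\mathfrak X^{lb}$ contains a measure $\nu$ for which $T_\nu$ has infinitely many positive eigenvalues ($I=\mathbb N$). 1. (Minimax lower rate.) With $a_n=n^{-\frac{\max\{\alpha,\beta\}-\gamma}{\max\{\alpha,\beta\}+p_{lb}-\gamma(1-p_{lb}/p)}}$, $$\lim_{\tau\to0^+}\ \liminf_{n\to\infty}\ \inf_{D\mapsto f_D}\ \sup_{P\in\mathfrak M^{lb}}P^n\bigl(D:\ \|[f_D]_\nu-f_P^*\|^2_{[H]^\gamma_\nu}>\tau a_n\bigr)=1,$$ where $\nu=P_X$ and the infimum is over all measurable learning methods with respect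 to $\mathfrak M^{lb}$ and $\gamma$. 2. (Optimality of the LS-SVM.) If $p_{lb}=p$ and $\alpha<\beta$, then $a_n=n^{-(\beta-\gamma)/(\beta+p)}$, and this rate is attained by the LS-SVM $f_{D,\lambda}=\operatorname{argmin}_{f\in H}\{\lambda\|f\|_H^2+\frac1n\sum_{i=1}^n(y_i-f(x_i))^2\}$: for every sequence $\lambda_n>0$ with $\lambda_n\asymp n^{-1/(\beta+p)}$, the map $D\mapsto f_{D,\lambda_n}$ is, for each $n\ge1$, a measurable learning method with respect to $\mathfrak M\supseteq\mathfrak M^{lb}$ and $\gamma$, and $$\lim_{\tau\to\infty}\ \limsup_{n\to\infty}\ \sup_{P\in\mathfrak M}P^n\bigl(D:\ \|[f_{D,\lambda_n}]_\nu-f_P^*\|^2_{[H]^\gamma_\nu}>\tau\,n^{-(\beta-\gamma)/(\beta+p)}\bigr)=0.$$ -/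

import Mathlib

open Filter Topology MeasureTheory Asymptotics
open scoped ENNReal InnerProductSpace

namespace KernelRegression

/-! ### Spectral decompositions of Hilbert-Schmidt operators -/

theorem exists_antitone_enumeration {J : Type*} (lam : J → ℝ)
    (hpos : ∀ j, 0 < lam j) (hfin : ∀ t : ℝ, 0 < t → {j | t ≤ lam j}.Finite) :
    ∃ (I : Set ℕ) (_ : IsLowerSet I) (e : I ≃ J), Antitone (lam ∘ e) := by
  classical
  have hc : Countable J := by
    have hU : (Set.univ : Set J) = ⋃ n : ℕ, {j | 1 / ((n : ℝ) + 1) ≤ lam j} := by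
      refine (Set.eq_univ_of_forall fun j => ?_).symm
      obtain ⟨n, hn⟩ := exists_nat_one_div_lt (hpos j)
      exact Set.mem_iUnion.2 ⟨n, hn.le⟩
    rw [← Set.countable_univ_iff, hU]
    exact Set.countable_iUnion fun n => (hfin _ (by positivity)).countable
  obtain ⟨enc, henc⟩ := exists_injective_nat J
  let key : J → ℝ ×ₗ ℕ := fun j => toLex (-lam j, enc j)
  have hkey : Function.Injective key := fun a b h => henc (by
    have := congrArg (fun x => (ofLex x).2) h
    simpa [key] using this)
  let _ : LinearOrder J := LinearOrder.lift' key hkey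
  have hmono : ∀ a b : J, a ≤ b → lam b ≤ lam a := by
    intro a b h
    have h' : key a ≤ key b := h
    rw [Prod.Lex.le_iff] at h'
    rcases h' with h' | h'
    · simp [key] at h'; exact h'.le
    · simp [key] at h'; exact h'.1.ge
  have hIio : ∀ a : J, (Set.Iio a).Finite := fun a =>
    (hfin _ (hpos a)).subset fun b hb => hmono b a (le_of_lt hb)
  let r : J → ℕ := fun a => (Set.Iio a).ncard
  have hr : StrictMono r := fun a b hab =>
    Set.ncard_lt_ncard (Set.Iio_ssubset_Iio hab) (hIio b)
  have hlow : IsLowerSet (Set.range r) := by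
    have key2 : ∀ n a, r a = n → ∀ m ≤ n, ∃ b, r b = m := by
      intro n
      induction n with
      | zero => intro a ha m hm; exact ⟨a, by omega⟩
      | succ n ih =>
        intro a ha m hm
        rcases Nat.lt_or_ge m (n + 1) with hlt | hge
        · have hne : (Set.Iio a).Nonempty := by
            rw [← Set.ncard_pos (hIio a)]
            change 0 < r a
            omega
          obtain ⟨b, hb, hmax⟩ := (hIio a).exists_maximal hne
          have hins : Set.Iio a = insert b (Set.Iio b) := by
            ext c
            simp only [Set.mem_Iio, Set.mem_insert_iff]
            constructor
            · intro hc
              rcases lt_trichotomy c b with h | h | h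
              · exact Or.inr h
              · exact Or.inl h
              · exact absurd (hmax hc h.le) (not_le.2 h)
            · rintro (rfl | h)
              · exact hb
              · exact h.trans hb
          have hrb : r b = n := by
            have : r a = r b + 1 := by
              change (Set.Iio a).ncard = _
              rw [hins, Set.ncard_insert_of_notMem (by simp) (hIio b)]
            omega
          exact ih b hrb m (by omega)
        · exact ⟨a, by omega⟩
    rintro _ m hm ⟨a, rfl⟩
    exact key2 _ a rfl m hm
  refine ⟨Set.range r, hlow, (Equiv.ofInjective r hr.injective).symm, ?_⟩
  intro x y hxy
  obtain ⟨_, a, rfl⟩ := x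
  obtain ⟨_, b, rfl⟩ := y
  have hab : a ≤ b := hr.le_iff_le.1 hxy
  have e1 : (Equiv.ofInjective r hr.injective).symm ⟨r a, a, rfl⟩ = a :=
    Equiv.ofInjective_symm_apply hr.injective a
  have e2 : (Equiv.ofInjective r hr.injective).symm ⟨r b, b, rfl⟩ = b :=
    Equiv.ofInjective_symm_apply hr.injective b
  simp only [Function.comp, e1, e2]
  exact hmono a b hab

theorem isCompactOperator_of_hilbertSchmidt {H : Type*} {E : Type*}
    [NormedAddCommGroup H] [InnerProductSpace ℝ H] [CompleteSpace H]
    [NormedAddCommGroup E] [InnerProductSpace ℝ E] [CompleteSpace E] (J : H →L[ℝ] E) (K : ℝ)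
    (hK : ∀ (w : Set H), Orthonormal ℝ ((↑) : w → H) →
      ∀ s : Finset w, ∑ i ∈ s, ‖J i‖ ^ 2 ≤ K) : IsCompactOperator J := by
  classical
  obtain ⟨w, b, hb⟩ := exists_hilbertBasis ℝ H
  have hon : Orthonormal ℝ ((↑) : w → H) := hb ▸ b.orthonormal
  have hsum : Summable fun i : w => ‖J (i : H)‖ ^ 2 :=
    summable_of_sum_le (fun _ => by positivity) (hK w hon)
  let A : Finset w → H →L[ℝ] E := fun F => ∑ i ∈ F, (innerSL ℝ (i : H)).smulRight (J i)
  have hA : ∀ F h, A F h = ∑ i ∈ F, ⟪(i : H), h⟫_ℝ • J i := by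
    intro F h
    simp [A]
  have hAc : ∀ F, IsCompactOperator (A F) := by
    intro F
    induction F using Finset.induction_on with
    | empty => simpa [A] using (isCompactOperator_zero : IsCompactOperator (0 : H → E))
    | insert a s ha ih =>
      have : A (insert a s) = (innerSL ℝ (a : H)).smulRight (J a) + A s := by
        simp [A, Finset.sum_insert ha]
      rw [this]
      refine IsCompactOperator.add ?_ ih
      exact (isCompactOperator_of_locallyCompactSpace_dom (innerSL ℝ (a : H))).clm_comp
        (ContinuousLinearMap.toSpanSingleton ℝ (J a))
  refine isCompactOperator_of_tendsto (l := atTop) (F := A) ?_ (Eventually.of_forall hAc)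
  rw [Metric.tendsto_nhds]
  intro ε hε
  obtain ⟨F, hF⟩ := summable_iff_vanishing_norm.1 hsum ((ε / 2) ^ 2) (by positivity)
  filter_upwards [eventually_ge_atTop F] with G hG
  rw [dist_eq_norm]
  refine lt_of_le_of_lt (ContinuousLinearMap.opNorm_le_bound _ (by positivity : 0 ≤ ε / 2) ?_)
    (half_lt_self hε)
  intro h
  have hlim : Tendsto (fun G' : Finset w => A G h - A G' h) atTop (𝓝 (A G h - J h)) := by
    have h1 : HasSum (fun i : w => ⟪(i : H), h⟫_ℝ • J i) (J h) := by
      have := (b.hasSum_repr h).mapL J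
      simpa [b.repr_apply_apply, hb] using this
    refine tendsto_const_nhds.sub ?_
    simp only [hA]
    simpa only [HasSum, SummationFilter.unconditional_filter] using h1
  refine le_of_tendsto hlim.norm ?_
  filter_upwards [eventually_ge_atTop G] with G' hG'
  have hdiff : A G h - A G' h = -∑ i ∈ G' \ G, ⟪(i : H), h⟫_ℝ • J i := by
    rw [hA, hA, ← Finset.sum_sdiff hG']; abel
  rw [hdiff, norm_neg]
  have hs : ∑ i ∈ G' \ G, ‖J (i : H)‖ ^ 2 ≤ (ε / 2) ^ 2 := by
    have := hF (G' \ G) (Finset.disjoint_of_subset_right hG Finset.sdiff_disjoint)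
    exact (le_abs_self _).trans this.le
  have hbes : ∑ i ∈ G' \ G, ‖⟪(i : H), h⟫_ℝ‖ ^ 2 ≤ ‖h‖ ^ 2 := hon.sum_inner_products_le h
  calc ‖∑ i ∈ G' \ G, ⟪(i : H), h⟫_ℝ • J i‖
      ≤ ∑ i ∈ G' \ G, ‖⟪(i : H), h⟫_ℝ‖ * ‖J (i : H)‖ := by
        refine (norm_sum_le _ _).trans (Finset.sum_le_sum fun i _ => ?_)
        rw [norm_smul]
    _ ≤ √(∑ i ∈ G' \ G, ‖⟪(i : H), h⟫_ℝ‖ ^ 2) * √(∑ i ∈ G' \ G, ‖J (i : H)‖ ^ 2) :=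
        Real.sum_mul_le_sqrt_mul_sqrt _ _ _
    _ ≤ ‖h‖ * (ε / 2) := by
        refine mul_le_mul (Real.sqrt_le_iff.2 ⟨norm_nonneg _, hbes⟩)
          (Real.sqrt_le_iff.2 ⟨by positivity, hs⟩) (by positivity) (norm_nonneg _)
    _ = ε / 2 * ‖h‖ := mul_comm _ _

/-- A spectral decomposition attached to an operator `J : H → E` between real Hilbert spaces:
an index set that is `{0, …, N - 1}` or `ℕ`, a decreasing summable sequence `eig i > 0`, and
`fn i ∈ H` such that `(√(eig i) • fn i)` is orthonormal in `H`, `(J (fn i))` is orthonormal in `E`,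
`J* J = ∑ eig i ⟨·, √(eig i) fn i⟩ √(eig i) fn i` and `J J* = ∑ eig i ⟨·, J (fn i)⟩ J (fn i)`.
The entry with index `i` here is the one with index `i + 1` when counting starts at one. -/
structure SpectralSystem {H : Type*} {E : Type*}
    [NormedAddCommGroup H] [InnerProductSpace ℝ H] [CompleteSpace H]
    [NormedAddCommGroup E] [InnerProductSpace ℝ E] [CompleteSpace E] (J : H →L[ℝ] E) where
  idx : Set ℕ
  isLowerSet_idx : IsLowerSet idx
  eig : idx → ℝ
  eig_pos : ∀ i, 0 < eig i
  eig_antitone : Antitone eig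
  eig_summable : Summable eig
  fn : idx → H
  orthonormal_dom : Orthonormal ℝ fun i => √(eig i) • fn i
  orthonormal_cod : Orthonormal ℝ fun i => J (fn i)
  spectral_dom : ∀ h : H, HasSum
    (fun i => (eig i * ⟪√(eig i) • fn i, h⟫_ℝ) • √(eig i) • fn i) ((J.adjoint ∘L J) h)
  spectral_cod : ∀ f : E, HasSum
    (fun i => (eig i * ⟪J (fn i), f⟫_ℝ) • J (fn i)) ((J ∘L J.adjoint) f)

theorem SpectralSystem.nonempty_of_hilbertSchmidt {H : Type*} {E : Type*}
    [NormedAddCommGroup H] [InnerProductSpace ℝ H] [CompleteSpace H]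
    [NormedAddCommGroup E] [InnerProductSpace ℝ E] [CompleteSpace E] (J : H →L[ℝ] E) (K : ℝ)
    (hK : ∀ (w : Set H), Orthonormal ℝ ((↑) : w → H) →
      ∀ s : Finset w, ∑ i ∈ s, ‖J i‖ ^ 2 ≤ K) : Nonempty (SpectralSystem J) := by
  classical
  have hJc : IsCompactOperator J := isCompactOperator_of_hilbertSchmidt J K hK
  set C : H →L[ℝ] H := J.adjoint ∘L J with hC
  have hCc : IsCompactOperator C := hJc.clm_comp J.adjoint
  have hCin : ∀ x y, ⟪C x, y⟫_ℝ = ⟪J x, J y⟫_ℝ := fun x y => by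
    simp [hC, ContinuousLinearMap.adjoint_inner_left]
  have hCsym : C.toLinearMap.IsSymmetric := fun x y => by
    change ⟪C x, y⟫_ℝ = ⟪x, C y⟫_ℝ
    rw [hCin, real_inner_comm (C y), hCin, real_inner_comm]
  let V : ℝ → Submodule ℝ H := fun t => Module.End.eigenspace C.toLinearMap t
  have hVmem : ∀ t x, x ∈ V t ↔ C x = t • x := fun t x => by
    simp only [V]
    exact Module.End.mem_eigenspace_iff
  have hVcl : ∀ t, IsClosed (V t : Set H) := fun t => by
    have : (V t : Set H) = {x | C x = t • x} := Set.ext fun x => hVmem t x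
    rw [this]
    exact isClosed_eq C.continuous (continuous_const_smul t)
  have : ∀ t, CompleteSpace (V t) := fun t => (hVcl t).completeSpace_coe
  choose w b hb using fun t => exists_hilbertBasis ℝ (V t)
  let ι := Σ t : {t : ℝ // t ≠ 0}, w t
  let lam : ι → ℝ := fun j => j.1
  let u : ι → H := fun j => ((j.2 : V j.1) : H)
  have huV : ∀ j, C (u j) = lam j • u j := fun j => (hVmem _ _).1 (j.2 : V j.1).2
  have hu : Orthonormal ℝ u := by
    have hfam : OrthogonalFamily ℝ (fun t : {t : ℝ // t ≠ 0} => V t)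
        fun t => (V t).subtypeₗᵢ :=
      hCsym.orthogonalFamily_eigenspaces.comp Subtype.val_injective
    have := hfam.orthonormal_sigma_orthonormal (v_family := fun t (i : w t) => (i : V t))
      fun t => by
        have := (b t).orthonormal
        rwa [hb t] at this
    exact this
  have hlamsq : ∀ j, ‖J (u j)‖ ^ 2 = lam j := fun j => by
    rw [← real_inner_self_eq_norm_sq, ← hCin, huV, real_inner_smul_left,
      real_inner_self_eq_norm_sq, hu.1 j]
    simp
  have hpos : ∀ j, 0 < lam j := fun j =>
    lt_of_le_of_ne (by rw [← hlamsq]; positivity) (Ne.symm j.1.2)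
  have hsumle : ∀ s : Finset ι, ∑ j ∈ s, lam j ≤ K := by
    intro s
    have hr := hu.toSubtypeRange
    let g : ι ↪ Set.range u := ⟨fun j => ⟨u j, j, rfl⟩, fun a c h =>
      hu.linearIndependent.injective (congrArg Subtype.val h)⟩
    have := hK _ hr (s.map g)
    rw [Finset.sum_map] at this
    refine le_trans (le_of_eq (Finset.sum_congr rfl fun j _ => ?_)) this
    exact (hlamsq j).symm
  have hsum : Summable lam := summable_of_sum_le (fun j => (hpos j).le) hsumle
  have hfin : ∀ t : ℝ, 0 < t → {j | t ≤ lam j}.Finite := by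
    intro t ht
    have := (hsum.tendsto_cofinite_zero).eventually (gt_mem_nhds ht)
    rw [Filter.eventually_cofinite] at this
    simpa using this
  have hJzero : ∀ g : H, (∀ j, ⟪u j, g⟫_ℝ = 0) → J g = 0 := by
    intro g hg
    have hVperp : ∀ t, t ≠ 0 → ∀ x ∈ V t, ⟪x, g⟫_ℝ = 0 := by
      intro t ht x hx
      have h1 : HasSum (fun i => (b t).repr ⟨x, hx⟩ i • ((b t i : V t) : H)) x := by
        simpa using ((b t).hasSum_repr ⟨x, hx⟩).mapL (V t).subtypeL
      have h2 := h1.mapL (innerSL ℝ g)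
      have h3 : ∀ i, innerSL ℝ g ((b t).repr ⟨x, hx⟩ i • ((b t i : V t) : H)) = 0 := by
        intro i
        have h4 : ⟪((b t i : V t) : H), g⟫_ℝ = 0 := by
          rw [hb t]
          exact hg ⟨⟨t, ht⟩, i⟩
        rw [map_smul, innerSL_apply_apply, real_inner_comm, h4, smul_zero]
      simp only [h3] at h2
      have h5 := h2.unique hasSum_zero
      rw [innerSL_apply_apply] at h5
      rw [real_inner_comm, h5]
    have hCg : C g ∈ (⨆ t, Module.End.eigenspace C.toLinearMap t)ᗮ := by
      rw [← Submodule.iInf_orthogonal, Submodule.mem_iInf]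
      intro t
      rw [Submodule.mem_orthogonal]
      intro x hx
      have hx' : C x = t • x := (hVmem t x).1 hx
      have h6 : ⟪x, C g⟫_ℝ = t * ⟪x, g⟫_ℝ := by
        have : ⟪x, C g⟫_ℝ = ⟪C x, g⟫_ℝ := (hCsym x g).symm
        rw [this, hx', real_inner_smul_left]
      rw [h6]
      rcases eq_or_ne t 0 with rfl | ht
      · simp
      · rw [hVperp t ht x hx, mul_zero]
    rw [ContinuousLinearMap.orthogonalComplement_iSup_eigenspaces_eq_bot hCc hCsym,
      Submodule.mem_bot] at hCg
    have : ‖J g‖ ^ 2 = 0 := by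
      rw [← real_inner_self_eq_norm_sq, ← hCin, hCg, inner_zero_left]
    simpa using this
  have hJexp : ∀ h : H, HasSum (fun j => ⟪u j, h⟫_ℝ • J (u j)) (J h) := by
    intro h
    have hs : Summable fun j => ⟪u j, h⟫_ℝ • u j := by
      have hfam := hu.orthogonalFamily
      have := (hfam.summable_iff_norm_sq_summable (fun j => ⟪u j, h⟫_ℝ)).2
        (hu.inner_products_summable h)
      simpa [LinearIsometry.toSpanSingleton_apply] using this
    obtain ⟨Ph, hPh⟩ := hs
    have hperp : ∀ j, ⟪u j, h - Ph⟫_ℝ = 0 := by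
      intro j
      have h1 := hPh.mapL (innerSL ℝ (u j))
      have h2 : ∀ k, innerSL ℝ (u j) (⟪u k, h⟫_ℝ • u k) = if k = j then ⟪u j, h⟫_ℝ else 0 := by
        intro k
        rw [map_smul, innerSL_apply_apply, orthonormal_iff_ite.1 hu j k]
        by_cases hjk : k = j
        · subst hjk; simp
        · simp [hjk, Ne.symm hjk]
      simp only [h2] at h1
      have h3 := h1.unique (hasSum_ite_eq j ⟪u j, h⟫_ℝ)
      rw [innerSL_apply_apply] at h3
      rw [inner_sub_right, h3, sub_self]
    have h0 := hJzero _ hperp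
    rw [map_sub, sub_eq_zero] at h0
    rw [h0]
    simpa using hPh.mapL J
  obtain ⟨I, hI, e, hanti⟩ := exists_antitone_enumeration lam hpos hfin
  have hsq : ∀ j, √(lam j) ≠ 0 := fun j => (Real.sqrt_pos.2 (hpos j)).ne'
  have hu' : ∀ j, √(lam j) • (√(lam j))⁻¹ • u j = u j := fun j => by
    rw [smul_smul, mul_inv_cancel₀ (hsq j), one_smul]
  have hcoef : ∀ j, lam j * (√(lam j))⁻¹ * (√(lam j))⁻¹ = 1 := fun j => by
    have := Real.mul_self_sqrt (hpos j).le
    have h2 := hsq j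
    field_simp
    nlinarith
  refine ⟨⟨I, hI, lam ∘ e, fun i => hpos _, hanti, (e.summable_iff).2 hsum,
    fun i => (√(lam (e i)))⁻¹ • u (e i), ?_, ?_, ?_, ?_⟩⟩
  · simp only [Function.comp, hu']
    exact hu.comp e e.injective
  · have : Orthonormal ℝ fun j => J ((√(lam j))⁻¹ • u j) := by
      rw [orthonormal_iff_ite]
      intro i j
      rw [map_smul, map_smul, real_inner_smul_left, real_inner_smul_right, ← hCin, huV,
        real_inner_smul_left, orthonormal_iff_ite.1 hu i j]
      by_cases hij : i = j
      · subst hij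
        have := hcoef i
        simp only [if_true, mul_one]
        linarith
      · simp [hij]
    exact this.comp e e.injective
  · intro h
    simp only [Function.comp, hu']
    have h1 := (hJexp h).mapL J.adjoint
    have h2 : ∀ j, J.adjoint (⟪u j, h⟫_ℝ • J (u j)) = (lam j * ⟪u j, h⟫_ℝ) • u j := by
      intro j
      have : J.adjoint (J (u j)) = lam j • u j := huV j
      rw [map_smul, this, smul_smul, mul_comm]
    simp only [h2] at h1
    exact (e.hasSum_iff (f := fun j => (lam j * ⟪u j, h⟫_ℝ) • u j)).2 h1
  · intro f
    have h1 := hJexp (J.adjoint f)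
    have h2 : ∀ j, ⟪u j, J.adjoint f⟫_ℝ • J (u j) =
        (lam j * ⟪J ((√(lam j))⁻¹ • u j), f⟫_ℝ) • J ((√(lam j))⁻¹ • u j) := by
      intro j
      rw [ContinuousLinearMap.adjoint_inner_right, map_smul, real_inner_smul_left, smul_smul]
      congr 1
      have := hcoef j
      linear_combination (-⟪J (u j), f⟫_ℝ) * this
    simp only [h2] at h1
    exact (e.hasSum_iff (f := fun j => (lam j * ⟪J ((√(lam j))⁻¹ • u j), f⟫_ℝ) •
      J ((√(lam j))⁻¹ • u j))).2 h1

/-! ### The embedding of the RKHS into `L₂(ν)` -/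

section RKHSDefs
variable {X : Type*} (H : Type*) [NormedAddCommGroup H]
  [InnerProductSpace ℝ H] [CompleteSpace H] [RKHS ℝ H X ℝ]

/-- The reproducing kernel `k : X × X → ℝ` of the real RKHS `H` on `X`. -/
noncomputable def rkhsKernel (x x' : X) : ℝ := RKHS.kernel H x x' 1

theorem rkhsKernel_eq_inner (x x' : X) :
    rkhsKernel H x x' = ⟪RKHS.kerFun H x' (1 : ℝ), RKHS.kerFun H x (1 : ℝ)⟫_ℝ := by
  rw [← RKHS.kernel_inner]
  simp [rkhsKernel]

variable {H} in
theorem rkhs_apply_eq_inner (h : H) (x : X) : h x = ⟪RKHS.kerFun H x (1 : ℝ), h⟫_ℝ := by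
  simp

variable {H} in
theorem rkhs_sq_le (h : H) (x : X) : h x ^ 2 ≤ rkhsKernel H x x * ‖h‖ ^ 2 := by
  rw [rkhs_apply_eq_inner, rkhsKernel_eq_inner, ← real_inner_self_eq_norm_sq h, sq]
  exact real_inner_mul_inner_self_le _ _

variable [MeasurableSpace X]

/-- The kernel of `H` is bounded and measurable for the product `σ`-algebra. -/
class MeasurableBoundedKernel : Prop where
  measurable_kernel : Measurable fun z : X × X => rkhsKernel H z.1 z.2
  bounded_kernel : ∃ κ : ℝ, ∀ x x' : X, |rkhsKernel H x x'| ≤ κ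

variable {H} in
theorem rkhs_measurable [MeasurableBoundedKernel H] (h : H) : Measurable (h : X → ℝ) := by
  let S : Submodule ℝ H :=
    { carrier := {f | Measurable (f : X → ℝ)}
      add_mem' := fun {a b} ha hb => by
        have : ⇑(a + b) = fun x => a x + b x := by ext x; simp
        change Measurable _
        rw [this]; exact Measurable.add ha hb
      zero_mem' := by
        change Measurable _
        rw [RKHS.coe_zero]; exact measurable_zero
      smul_mem' := fun c a ha => by
        have : ⇑(c • a) = fun x => c * a x := by ext x; simp
        change Measurable _
        rw [this]; exact Measurable.const_mul ha c }
  have hS : IsClosed (S : Set H) := by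
    refine IsSeqClosed.isClosed fun u f hu hf => ?_
    refine measurable_of_tendsto_metrizable hu (tendsto_pi_nhds.2 fun x => ?_)
    exact ((RKHS.continuous_eval x).tendsto f).comp hf
  have hle : Submodule.span ℝ {RKHS.kerFun H x v | (x : X) (v : ℝ)} ≤ S := by
    rw [Submodule.span_le]
    rintro _ ⟨y, v, rfl⟩
    have : ⇑(RKHS.kerFun H y v) = fun x => v * rkhsKernel H x y := by
      ext x
      rw [RKHS.kerFun_apply, rkhsKernel]
      have : (v : ℝ) = v • (1 : ℝ) := by simp
      conv_lhs => rw [this, map_smul]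
      simp
    change Measurable _
    rw [this]
    exact ((MeasurableBoundedKernel.measurable_kernel (H := H)).comp
      (measurable_id.prodMk measurable_const)).const_mul v
  have htop : (⊤ : Submodule ℝ H) ≤ S := by
    rw [← RKHS.kerFun_dense H]
    exact Submodule.topologicalClosure_minimal _ hle hS
  exact htop (Submodule.mem_top : h ∈ ⊤)

theorem exists_rkhs_bound [MeasurableBoundedKernel H] :
    ∃ C : ℝ, 0 ≤ C ∧ ∀ (h : H) (x : X), ‖h x‖ ≤ C * ‖h‖ := by
  obtain ⟨κ, hκ⟩ := ‹MeasurableBoundedKernel H›.bounded_kernel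
  refine ⟨√κ, Real.sqrt_nonneg _, fun h x => ?_⟩
  have h0 : 0 ≤ κ := (abs_nonneg _).trans (hκ x x)
  rw [Real.norm_eq_abs]
  refine abs_le_of_sq_le_sq ?_ (by positivity)
  rw [mul_pow, Real.sq_sqrt h0]
  exact (rkhs_sq_le h x).trans
    (mul_le_mul_of_nonneg_right ((le_abs_self _).trans (hκ x x)) (by positivity))

variable {H} in
theorem rkhs_memLp [MeasurableBoundedKernel H] (ν : Measure X) [IsFiniteMeasure ν] (h : H) :
    MemLp (h : X → ℝ) 2 ν := by
  obtain ⟨C, -, hC⟩ := exists_rkhs_bound H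
  exact MemLp.of_bound (rkhs_measurable h).aestronglyMeasurable (C * ‖h‖)
    (Eventually.of_forall (hC h))

/-- The embedding `H → L₂(ν)`, `h ↦ [h]_ν`. -/
noncomputable def rkhsEmbedding [MeasurableBoundedKernel H] (ν : Measure X) [IsFiniteMeasure ν] :
    H →L[ℝ] Lp ℝ 2 ν :=
  LinearMap.mkContinuousOfExistsBound
    { toFun := fun h => (rkhs_memLp ν h).toLp h
      map_add' := fun a b => by
        rw [← MemLp.toLp_add]
        exact MemLp.toLp_congr _ _ (Eventually.of_forall fun x => by simp)
      map_smul' := fun c a => by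
        rw [RingHom.id_apply, ← MemLp.toLp_const_smul]
        exact MemLp.toLp_congr _ _ (Eventually.of_forall fun x => by simp) }
    (by
      obtain ⟨C, hC0, hC⟩ := exists_rkhs_bound H
      refine ⟨measureUnivNNReal ν ^ (2 : ℝ≥0∞).toReal⁻¹ * C, fun h => ?_⟩
      have := Lp.norm_le_of_ae_bound (f := (rkhs_memLp ν h).toLp h) (C := C * ‖h‖) (by positivity)
        (by
          filter_upwards [(rkhs_memLp ν h).coeFn_toLp] with x hx
          rw [hx]; exact hC h x)
      rw [mul_assoc]
      exact this)

theorem rkhsEmbedding_hilbertSchmidt [MeasurableBoundedKernel H] (ν : Measure X)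
    [IsFiniteMeasure ν] : ∃ K : ℝ, ∀ w : Set H, Orthonormal ℝ ((↑) : w → H) →
      ∀ s : Finset w, ∑ i ∈ s, ‖rkhsEmbedding H ν i‖ ^ 2 ≤ K := by
  obtain ⟨κ, hκ⟩ := ‹MeasurableBoundedKernel H›.bounded_kernel
  refine ⟨∫ _, κ ∂ν, fun w hw s => ?_⟩
  have hnorm : ∀ h : H, ‖rkhsEmbedding H ν h‖ ^ 2 = ∫ x, h x ^ 2 ∂ν := by
    intro h
    rw [← real_inner_self_eq_norm_sq, L2.inner_def]
    refine integral_congr_ae ?_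
    have : rkhsEmbedding H ν h = (rkhs_memLp ν h).toLp h := rfl
    rw [this]
    filter_upwards [(rkhs_memLp ν h).coeFn_toLp] with x hx
    rw [hx, real_inner_self_eq_norm_sq, Real.norm_eq_abs, sq_abs]
  have hint : ∀ h : H, Integrable (fun x => h x ^ 2) ν := fun h => (rkhs_memLp ν h).integrable_sq
  simp only [hnorm]
  rw [← integral_finsetSum _ fun i _ => hint _]
  refine integral_mono (integrable_finsetSum _ fun i _ => hint _) (integrable_const _) fun x => ?_
  have hb := hw.sum_inner_products_le (RKHS.kerFun H x (1 : ℝ)) (s := s)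
  refine le_trans (le_of_eq (Finset.sum_congr rfl fun i _ => ?_))
    (hb.trans (le_trans (le_of_eq ?_) ((le_abs_self _).trans (hκ x x))))
  · rw [rkhs_apply_eq_inner, real_inner_comm, Real.norm_eq_abs, sq_abs]
  · rw [rkhsKernel_eq_inner, real_inner_self_eq_norm_sq]

/-- The spectral decomposition of `T_ν = I_ν I_ν*` and `C_ν = I_ν* I_ν`, where
`I_ν : H → L₂(ν)` is the embedding, whose adjoint is the integral operator of the kernel.
The eigenvalues are uniquely determined. The `fn i` are determined up to an orthogonal change of
basis inside each (finite-dimensional) eigenspace, so nothing below depends on the choice. -/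
noncomputable def spectralSystem [MeasurableBoundedKernel H] (ν : Measure X)
    [IsFiniteMeasure ν] : SpectralSystem (rkhsEmbedding H ν) :=
  (SpectralSystem.nonempty_of_hilbertSchmidt _ _ (rkhsEmbedding_hilbertSchmidt H ν).choose_spec).some

/-! ### Power spaces -/

/-- `a ∈ ℓ₂` is the coefficient sequence of `f ∈ L₂(ν)` in the `γ`-power space:
`f = ∑ a_i μ_i ^ (γ / 2) [e_i]_ν`. -/
def IsPowerCoeff [MeasurableBoundedKernel H] (ν : Measure X) [IsFiniteMeasure ν] (γ : ℝ)
    (a : lp (fun _ : (spectralSystem H ν).idx => ℝ) 2) (f : Lp ℝ 2 ν) : Prop :=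
  HasSum (fun i => (a i * (spectralSystem H ν).eig i ^ (γ / 2)) •
    rkhsEmbedding H ν ((spectralSystem H ν).fn i)) f

/-- The `γ`-power space `[H]_ν^γ`, as a subset of `L₂(ν)`. -/
def powerSpace [MeasurableBoundedKernel H] (ν : Measure X) [IsFiniteMeasure ν] (γ : ℝ) :
    Set (Lp ℝ 2 ν) :=
  {f | ∃ a, IsPowerCoeff H ν γ a f}

/-- The norm of (the `ν`-class of) `g` in `[H]_ν^γ`: the `ℓ₂`-norm of its (unique) coefficient
sequence, and `∞` if the class of `g` does not belong to `[H]_ν^γ`. -/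
noncomputable def powerNorm [MeasurableBoundedKernel H] (ν : Measure X) [IsFiniteMeasure ν]
    (γ : ℝ) (g : X → ℝ) : ℝ≥0∞ :=
  ⨅ (a : lp (fun _ : (spectralSystem H ν).idx => ℝ) 2)
    (_ : ∃ f : Lp ℝ 2 ν, g =ᵐ[ν] f ∧ IsPowerCoeff H ν γ a f), ‖a‖ₑ

/-! ### Classes of probability measures -/

/-- Probability measures `ν` on `X` such that `X` is `ν`-complete, `[H]_ν^α` embeds into `L_∞(ν)`
with norm at most `A`, and `μ_i ≤ C i ^ (-1 / p)` for all (one-based) indices `i`. -/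
def marginalClass [MeasurableBoundedKernel H] (α p A C : ℝ) : Set (ProbabilityMeasure X) :=
  {ν | (ν : Measure X).IsComplete ∧
    (∀ f ∈ powerSpace H (ν : Measure X) α,
      eLpNorm f ∞ (ν : Measure X) ≤ ENNReal.ofReal A * powerNorm H (ν : Measure X) α f) ∧
    ∀ i : (spectralSystem H (ν : Measure X)).idx,
      (spectralSystem H (ν : Measure X)).eig i ≤ C * (((i : ℕ) : ℝ) + 1) ^ (-1 / p)}

/-- The members of `marginalClass` with `c i ^ (-1 / q) ≤ μ_i` for all (one-based) indices `i`. -/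
def marginalClassLB [MeasurableBoundedKernel H] (α p q A C c : ℝ) : Set (ProbabilityMeasure X) :=
  {ν | ν ∈ marginalClass H α p A C ∧
    ∀ i : (spectralSystem H (ν : Measure X)).idx,
      c * (((i : ℕ) : ℝ) + 1) ^ (-1 / q) ≤ (spectralSystem H (ν : Measure X)).eig i}

/-- The marginal distribution on `X`. -/
noncomputable def marginal (P : ProbabilityMeasure (X × ℝ)) : ProbabilityMeasure X :=
  ⟨(P : Measure (X × ℝ)).fst, inferInstance⟩

/-- The conditional mean function `x ↦ ∫ y P(dy | x)`. -/
noncomputable def condMean (P : ProbabilityMeasure (X × ℝ)) (x : X) : ℝ :=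
  ∫ y, y ∂((P : Measure (X × ℝ)).condKernel x)

/-- Distributions on `X × ℝ` whose marginal lies in `𝔛`, with square integrable output, whose
conditional mean function `f` satisfies `‖f‖²_{L_∞} ≤ Binf` and `‖f‖²_{[H]^β} ≤ B`, and with
`∫ |y - f x| ^ m P(dy | x) ≤ (1 / 2) m! σ² L ^ (m - 2)` for almost all `x` and all `m ≥ 2`. -/
def jointClass [MeasurableBoundedKernel H] (β B Binf L σ : ℝ) (𝔛 : Set (ProbabilityMeasure X)) :
    Set (ProbabilityMeasure (X × ℝ)) :=
  {P | marginal P ∈ 𝔛 ∧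
    Integrable (fun z : X × ℝ => z.2 ^ 2) (P : Measure (X × ℝ)) ∧
    eLpNorm (condMean P) ∞ (marginal P : Measure X) ^ 2 ≤ ENNReal.ofReal Binf ∧
    powerNorm H (marginal P : Measure X) β (condMean P) ^ 2 ≤ ENNReal.ofReal B ∧
    ∀ᵐ x ∂(marginal P : Measure X), ∀ m : ℕ, 2 ≤ m →
      ∫⁻ y, ENNReal.ofReal (|y - condMean P x| ^ m) ∂((P : Measure (X × ℝ)).condKernel x) ≤
        ENNReal.ofReal (1 / 2 * (m.factorial : ℝ) * σ ^ 2 * L ^ (m - 2))}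

/-! ### Learning methods -/

/-- The universal completion of a `σ`-algebra: the intersection of its completions with respect to
all probability measures. -/
@[reducible]
def universalCompletion {Ω : Type*} (m : MeasurableSpace Ω) : MeasurableSpace Ω where
  MeasurableSet' s := ∀ μ : @Measure Ω m, IsProbabilityMeasure μ → NullMeasurableSet s μ
  measurableSet_empty _ _ := nullMeasurableSet_empty
  measurableSet_compl _ hs μ hμ := (hs μ hμ).compl
  measurableSet_iUnion _ hf μ hμ := NullMeasurableSet.iUnion fun i => hf i μ hμ

/-- The measurable learning methods for samples of size `n` with respect to `𝔐` and `γ`. -/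
def learningMethods [MeasurableBoundedKernel H] (γ : ℝ) (𝔐 : Set (ProbabilityMeasure (X × ℝ)))
    (n : ℕ) : Set ((Fin n → X × ℝ) → X → ℝ) :=
  {fhat | (∀ D, Measurable (fhat D)) ∧
    ∀ P ∈ 𝔐, Measurable[universalCompletion inferInstance] fun D : Fin n → X × ℝ =>
      powerNorm H (marginal P : Measure X) γ fun x => fhat D x - condMean P x}

/-- `P^n (D : ‖[fhat_D] - f_P‖²_{[H]_ν^γ} > t)` with `ν` the marginal of `P`. On the universal
completion of the product `σ`-algebra the (outer) measure is the completed product measure. -/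
noncomputable def errorProb [MeasurableBoundedKernel H] (γ : ℝ) {n : ℕ}
    (fhat : (Fin n → X × ℝ) → X → ℝ) (P : ProbabilityMeasure (X × ℝ)) (t : ℝ) : ℝ≥0∞ :=
  Measure.pi (fun _ : Fin n => (P : Measure (X × ℝ)))
    {D | ENNReal.ofReal t <
      powerNorm H (marginal P : Measure X) γ (fun x => fhat D x - condMean P x) ^ 2}

end RKHSDefs

/-! ### The least-squares support vector machine -/

section LSSVM

variable {X : Type*} (H : Type*) [NormedAddCommGroup H]
  [InnerProductSpace ℝ H] [CompleteSpace H] [RKHS ℝ H X ℝ]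

/-- The regularized empirical least-squares risk. -/
noncomputable def lsObjective (reg : ℝ) {n : ℕ} (D : Fin n → X × ℝ) (f : H) : ℝ :=
  reg * ‖f‖ ^ 2 + 1 / (n : ℝ) * ∑ i, ((D i).2 - f (D i).1) ^ 2

theorem exists_isMinOn_lsObjective {reg : ℝ} (hreg : 0 < reg) {n : ℕ} (D : Fin n → X × ℝ) :
    ∃ f : H, ∀ g : H, g ≠ f → lsObjective H reg D f < lsObjective H reg D g := by
  let k : Fin n → H := fun i => RKHS.kerFun H (D i).1 (1 : ℝ)
  have hk : ∀ (f : H) i, ⟪k i, f⟫_ℝ = f (D i).1 := fun f i => (rkhs_apply_eq_inner f _).symm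
  let ip : H →L[ℝ] H →L[ℝ] ℝ := innerSL ℝ
  let Bil : H →L[ℝ] H →L[ℝ] ℝ :=
    reg • ip + (1 / (n : ℝ)) • ∑ i, (innerSL ℝ (k i)).smulRight (innerSL ℝ (k i))
  have hB : ∀ f g : H, Bil f g =
      reg * ⟪f, g⟫_ℝ + 1 / (n : ℝ) * ∑ i, f (D i).1 * g (D i).1 := by
    intro f g
    have hip : ip f g = ⟪f, g⟫_ℝ := rfl
    simp [Bil, hip, hk]
  have hco : IsCoercive Bil := by
    refine ⟨reg, hreg, fun f => ?_⟩
    rw [hB, real_inner_self_eq_norm_mul_norm, mul_assoc]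
    have : 0 ≤ 1 / (n : ℝ) * ∑ i, f (D i).1 * f (D i).1 :=
      mul_nonneg (by positivity) (Finset.sum_nonneg fun i _ => mul_self_nonneg _)
    linarith
  let v : H := (1 / (n : ℝ)) • ∑ i, (D i).2 • k i
  obtain ⟨f, hf⟩ : ∃ f, ∀ g, Bil f g = ⟪v, g⟫_ℝ := by
    refine ⟨hco.continuousLinearEquivOfBilin.symm v, fun g => ?_⟩
    rw [← IsCoercive.continuousLinearEquivOfBilin_apply hco]
    simp
  have hv : ∀ g : H, ⟪v, g⟫_ℝ = 1 / (n : ℝ) * ∑ i, (D i).2 * g (D i).1 := by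
    intro g
    simp only [v, real_inner_smul_left, sum_inner, hk]
  refine ⟨f, fun g hg => ?_⟩
  have h1 := hf (g - f)
  rw [hB, hv] at h1
  have h2 : ‖g‖ ^ 2 = ‖f‖ ^ 2 + 2 * ⟪f, g - f⟫_ℝ + ‖g - f‖ ^ 2 := by
    rw [← norm_add_sq_real]; simp
  have h3 : ∑ i, ((D i).2 - g (D i).1) ^ 2 = ∑ i, ((D i).2 - f (D i).1) ^ 2 +
      2 * ∑ i, f (D i).1 * (g - f) (D i).1 - 2 * ∑ i, (D i).2 * (g - f) (D i).1 +
      ∑ i, (g - f) (D i).1 ^ 2 := by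
    rw [Finset.mul_sum, Finset.mul_sum, ← Finset.sum_add_distrib, ← Finset.sum_sub_distrib,
      ← Finset.sum_add_distrib]
    refine Finset.sum_congr rfl fun i _ => ?_
    rw [RKHS.coe_sub, Pi.sub_apply]
    ring
  have h4 : 0 < ‖g - f‖ ^ 2 := by
    have := norm_pos_iff.2 (sub_ne_zero.2 hg)
    positivity
  have h5 : 0 ≤ 1 / (n : ℝ) * ∑ i, (g - f) (D i).1 ^ 2 :=
    mul_nonneg (by positivity) (Finset.sum_nonneg fun i _ => sq_nonneg _)
  have h6 := mul_pos hreg h4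
  unfold lsObjective
  rw [h2, h3]
  nlinarith

/-- The LS-SVM: the minimizer over `H` of the regularized empirical least-squares risk. -/
noncomputable def lsSVM (reg : ℝ) {n : ℕ} (D : Fin n → X × ℝ) : H :=
  Classical.epsilon fun f : H => ∀ g : H, g ≠ f → lsObjective H reg D f < lsObjective H reg D g

theorem lsSVM_spec {reg : ℝ} (hreg : 0 < reg) {n : ℕ} (D : Fin n → X × ℝ) (g : H)
    (hg : g ≠ lsSVM H reg D) : lsObjective H reg D (lsSVM H reg D) < lsObjective H reg D g :=
  Classical.epsilon_spec (exists_isMinOn_lsObjective H hreg D) g hg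

end LSSVM

end KernelRegression

open KernelRegression

open KernelRegression

namespace KernelRegression

/-! ### Orthonormal expansions -/

section Orthonormal

variable {ι E : Type*} [NormedAddCommGroup E] [InnerProductSpace ℝ E]

/-! Throughout, b_i = √μ_i e_i is the orthonormal system in H.

The lower rate is a Bayesian testing argument on a cube. Fix ν with infinitely many eigenvalues and
a block F of m consecutive indices, where c (2m)^(-1/q) ≤ μ_i ≤ C m^(-1/p). To ω ⊆ F attach f_ω = δ
∑_{i ∈ ω} μ_i^(γ/2) e_i. Squared γ-distances are then δ² |ω ∆ ω₀|, so an estimator with squared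
error at most δ² m / 32 for two hypotheses forces |ω ∆ ω₀| ≤ m / 8, and a Hamming ball of that
radius holds at most (3/2)^m of the 2^m subsets (`card_hammingBall_le`). With noise on two points
±K, the likelihood ratio against the zero function is 1 + y f_ω(x) / K², and its n-fold product has
second moment at most exp(n ‖f_ω‖² / K²). When this is at most (17/16)^m, `sum_withDensity_le` makes
the average success probability decay geometrically in m (`le_iSup_errorProb`). With a = max(α, β),
the source condition and the bound |f_ω| ≤ K, which comes from the embedding of [H]^α, permit m δ² ≍
m^(-(a-γ)/q). The information bound then permits n ≲ m^(d/q), where d is the denominator of the rate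
exponent; hence m ≍ n^(q/d).

For the upper rate, f_D is compared with g = (C_ν + λ)⁻¹ I_ν* f_P*, whose squared γ-bias is at most
λ^(β-γ) B. The difference h = f_D - g, with c_i = ⟨b_i, h⟩, satisfies λ‖h‖² + n⁻¹ ∑_j h(x_j)² = ∑
c_i ℓ_i, where each ℓ_i is a centred sample mean. If the Gram matrix of the b_i on the sample,
rescaled by (μ_i + λ)^(-1/2) on both sides, is within 1/2 of its mean in Hilbert-Schmidt norm, the
left side is at least ½ ∑ (μ_i + λ) c_i², and Young's inequality yields ∑ (μ_i + λ) c_i² ≤ 4 ∑ ℓ_i²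
/ (μ_i + λ) (`sum_inner_sq_le_of_good_sample`). Variances of sample means bound the expectations of
the two random quantities by multiples of N(λ) / n and λ^(-α) N(λ) / n, where N(λ) = ∑ μ_i / (μ_i +
λ) ≲ λ^(-p). For λ ≍ n^(-1/(β+p)) these are of order λ^β and λ^(β-α); the latter vanishes because α
< β. Since only τ → ∞ is asked for, Markov's inequality suffices (`errorProb_lsSVM_le`). -/

theorem _root_.Orthonormal.inner_eq_of_hasSum {v : ι → E} (hv : Orthonormal ℝ v) {c : ι → ℝ}
    {f : E} (h : HasSum (fun i => c i • v i) f) (i : ι) : ⟪v i, f⟫_ℝ = c i := by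
  classical
  have h1 := h.mapL (innerSL ℝ (v i))
  have h2 : ∀ k, innerSL ℝ (v i) (c k • v k) = if k = i then c i else 0 := by
    intro k
    rw [map_smul, innerSL_apply_apply, orthonormal_iff_ite.1 hv i k]
    by_cases hik : k = i
    · subst hik; simp
    · simp [hik, Ne.symm hik]
  simp only [h2] at h1
  simpa using h1.unique (hasSum_ite_eq i (c i))

theorem _root_.Orthonormal.summable_smul [CompleteSpace E] {v : ι → E} (hv : Orthonormal ℝ v)
    {c : ι → ℝ} (hc : Summable fun i => c i ^ 2) : Summable fun i => c i • v i := by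
  have := (hv.orthogonalFamily.summable_iff_norm_sq_summable (fun i => c i)).2
    (by simpa using hc)
  simpa [LinearIsometry.toSpanSingleton_apply] using this

end Orthonormal

namespace SpectralSystem

variable {H : Type*} {E : Type*}
    [NormedAddCommGroup H] [InnerProductSpace ℝ H] [CompleteSpace H]
    [NormedAddCommGroup E] [InnerProductSpace ℝ E] [CompleteSpace E] {J : H →L[ℝ] E}
    (S : SpectralSystem J)

/-- The orthonormal system `√μ_i e_i` of the domain. -/
noncomputable def basis (i : S.idx) : H := √(S.eig i) • S.fn i

theorem orthonormal_basis : Orthonormal ℝ S.basis := S.orthonormal_dom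

theorem sqrt_eig_pos (i : S.idx) : 0 < √(S.eig i) := Real.sqrt_pos.2 (S.eig_pos i)

theorem fn_eq (i : S.idx) : S.fn i = (√(S.eig i))⁻¹ • S.basis i := by
  rw [basis, smul_smul, inv_mul_cancel₀ (S.sqrt_eig_pos i).ne', one_smul]

theorem inner_basis_adjoint_comp (i : S.idx) (u : H) :
    ⟪S.basis i, (J.adjoint ∘L J) u⟫_ℝ = S.eig i * ⟪S.basis i, u⟫_ℝ :=
  S.orthonormal_basis.inner_eq_of_hasSum (S.spectral_dom u) i

theorem inner_map_fn (i : S.idx) (u : H) :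
    ⟪J (S.fn i), J u⟫_ℝ = √(S.eig i) * ⟪S.basis i, u⟫_ℝ := by
  rw [← ContinuousLinearMap.adjoint_inner_right, fn_eq, real_inner_smul_left]
  have := S.inner_basis_adjoint_comp i u
  rw [ContinuousLinearMap.comp_apply] at this
  rw [this]
  have h := Real.mul_self_sqrt (S.eig_pos i).le
  have h0 := (S.sqrt_eig_pos i).ne'
  field_simp
  linear_combination (-⟪S.basis i, u⟫_ℝ) * h

theorem map_basis (i : S.idx) : J (S.basis i) = √(S.eig i) • J (S.fn i) := by
  rw [basis, map_smul]

theorem inner_map_basis (i j : S.idx) [DecidableEq S.idx] :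
    ⟪J (S.basis i), J (S.basis j)⟫_ℝ = if i = j then S.eig i else 0 := by
  rw [map_basis, real_inner_smul_left, inner_map_fn,
    orthonormal_iff_ite.1 S.orthonormal_basis i j, ← mul_assoc, Real.mul_self_sqrt (S.eig_pos i).le]
  simp

/-- The part of u orthogonal to every b_i is annihilated by J*J, by the spectral series, and hence
by J, since ‖J v‖² = ⟨v, J*J v⟩. The b_i need not span H, because J may have a kernel. -/
theorem exists_hasSum_basis (u : H) :
    ∃ u₀ : H, J u₀ = 0 ∧ HasSum (fun i => ⟪S.basis i, u⟫_ℝ • S.basis i) (u - u₀) := by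
  have hs : Summable fun i => ⟪S.basis i, u⟫_ℝ ^ 2 := by
    simpa using S.orthonormal_basis.inner_products_summable u
  obtain ⟨w, hw⟩ := S.orthonormal_basis.summable_smul hs
  refine ⟨u - w, ?_, by simpa using hw⟩
  have hperp : ∀ i, ⟪S.basis i, u - w⟫_ℝ = 0 := fun i => by
    rw [inner_sub_right, S.orthonormal_basis.inner_eq_of_hasSum hw i, sub_self]
  have h := S.spectral_dom (u - w)
  have h0 : (J.adjoint ∘L J) (u - w) = 0 := by
    refine h.unique ?_
    have : ∀ i, ⟪√(S.eig i) • S.fn i, u - w⟫_ℝ = 0 := hperp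
    simp only [this]
    simp
  have h1 : ‖J (u - w)‖ ^ 2 = 0 := by
    rw [← real_inner_self_eq_norm_sq, ← ContinuousLinearMap.adjoint_inner_right]
    rw [ContinuousLinearMap.comp_apply] at h0
    rw [h0, inner_zero_right]
  simpa using h1

theorem hasSum_map (u : H) :
    HasSum (fun i => (√(S.eig i) * ⟪S.basis i, u⟫_ℝ) • J (S.fn i)) (J u) := by
  obtain ⟨u₀, h0, hu⟩ := S.exists_hasSum_basis u
  have := hu.mapL J
  rw [map_sub, h0, sub_zero] at this
  refine this.congr_fun fun i => ?_
  rw [map_smul, map_basis, smul_smul, mul_comm]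

theorem exists_eig_le : ∃ M : ℝ, 0 < M ∧ ∀ i, S.eig i ≤ M := by
  -- The added 1 keeps the bound positive when there are no eigenvalues.
  refine ⟨∑' i, S.eig i + 1, ?_, fun i => ?_⟩
  · have := tsum_nonneg (L := .unconditional _) fun i => (S.eig_pos i).le
    linarith
  · have := S.eig_summable.le_tsum i fun j _ => (S.eig_pos j).le
    linarith

end SpectralSystem

/-! ### Power norms in coordinates -/

section Power

variable {X : Type*} {H : Type*} [NormedAddCommGroup H]
  [InnerProductSpace ℝ H] [CompleteSpace H] [RKHS ℝ H X ℝ] [MeasurableSpace X]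
  [MeasurableBoundedKernel H] {ν : Measure X} [IsFiniteMeasure ν]

theorem rkhsEmbedding_coeFn (h : H) : rkhsEmbedding H ν h =ᵐ[ν] h :=
  (rkhs_memLp ν h).coeFn_toLp

theorem IsPowerCoeff.inner_eq {γ : ℝ} {a : lp (fun _ : (spectralSystem H ν).idx => ℝ) 2}
    {f : Lp ℝ 2 ν} (h : IsPowerCoeff H ν γ a f) (i : (spectralSystem H ν).idx) :
    ⟪rkhsEmbedding H ν ((spectralSystem H ν).fn i), f⟫_ℝ =
      a i * (spectralSystem H ν).eig i ^ (γ / 2) :=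
  (spectralSystem H ν).orthonormal_cod.inner_eq_of_hasSum h i

theorem IsPowerCoeff.unique {γ : ℝ} {a a' : lp (fun _ : (spectralSystem H ν).idx => ℝ) 2}
    {f : Lp ℝ 2 ν} (h : IsPowerCoeff H ν γ a f) (h' : IsPowerCoeff H ν γ a' f) : a = a' := by
  ext i
  have := h.inner_eq i
  rw [h'.inner_eq i] at this
  exact (mul_right_cancel₀ (Real.rpow_pos_of_pos ((spectralSystem H ν).eig_pos i) _).ne' this).symm

theorem powerNorm_eq_enorm {γ : ℝ} {a : lp (fun _ : (spectralSystem H ν).idx => ℝ) 2}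
    {f : Lp ℝ 2 ν} {g : X → ℝ} (hg : g =ᵐ[ν] f) (h : IsPowerCoeff H ν γ a f) :
    powerNorm H ν γ g = ‖a‖ₑ := by
  refine le_antisymm (iInf₂_le a ⟨f, hg, h⟩) (le_iInf₂ ?_)
  rintro a' ⟨f', hg', h'⟩
  have : f = f' := Lp.ext (hg.symm.trans hg')
  subst this
  rw [h.unique h']

theorem exists_isPowerCoeff_of_powerNorm_ne_top {γ : ℝ} {g : X → ℝ}
    (h : powerNorm H ν γ g ≠ ∞) :
    ∃ (a : lp (fun _ : (spectralSystem H ν).idx => ℝ) 2) (f : Lp ℝ 2 ν), g =ᵐ[ν] f ∧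
      IsPowerCoeff H ν γ a f ∧ powerNorm H ν γ g = ‖a‖ₑ := by
  by_contra! hcon
  refine h (iInf₂_eq_top.2 ?_)
  rintro a ⟨f, hg, ha⟩
  exact absurd (powerNorm_eq_enorm hg ha) (hcon a f hg ha)

theorem powerNorm_congr {γ : ℝ} {g g' : X → ℝ} (h : g =ᵐ[ν] g') :
    powerNorm H ν γ g = powerNorm H ν γ g' := by
  have key : ∀ f : Lp ℝ 2 ν, g =ᵐ[ν] f ↔ g' =ᵐ[ν] f := fun f =>
    ⟨fun h' => h.symm.trans h', fun h' => h.trans h'⟩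
  simp only [powerNorm, key]

theorem powerNorm_sub_le {γ : ℝ} (g₁ g₂ : X → ℝ) :
    powerNorm H ν γ (fun x => g₁ x - g₂ x) ≤ powerNorm H ν γ g₁ + powerNorm H ν γ g₂ := by
  by_cases h1 : powerNorm H ν γ g₁ = ∞
  · simp [h1]
  by_cases h2 : powerNorm H ν γ g₂ = ∞
  · simp [h2]
  obtain ⟨a₁, f₁, hg₁, ha₁, e₁⟩ := exists_isPowerCoeff_of_powerNorm_ne_top h1
  obtain ⟨a₂, f₂, hg₂, ha₂, e₂⟩ := exists_isPowerCoeff_of_powerNorm_ne_top h2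
  have h3 : IsPowerCoeff H ν γ (a₁ - a₂) (f₁ - f₂) := by
    have := HasSum.sub ha₁ ha₂
    refine this.congr_fun fun i => ?_
    rw [lp.coeFn_sub, Pi.sub_apply, sub_mul, sub_smul]
  rw [powerNorm_eq_enorm _ h3, e₁, e₂]
  · exact enorm_sub_le
  · filter_upwards [hg₁, hg₂, Lp.coeFn_sub f₁ f₂] with x h1 h2 h3
    rw [h3, h1, h2, Pi.sub_apply]

theorem enorm_lp_sq {ι : Type*} (a : lp (fun _ : ι => ℝ) 2) :
    ‖a‖ₑ ^ 2 = ∑' i, ENNReal.ofReal (a i ^ 2) := by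
  have h := lp.norm_rpow_eq_tsum (p := 2) (by simp) a
  have hs : Summable fun i => a i ^ 2 := by
    have := (lp.memℓp a).summable (p := 2) (by simp)
    simpa using this
  rw [← ENNReal.ofReal_tsum_of_nonneg (fun _ => sq_nonneg _) hs, ← ofReal_norm,
    ← ENNReal.ofReal_pow (norm_nonneg _)]
  congr 1
  simpa using h

/-- Orthonormality of the [e_i] forces the coefficients a_i = c_i μ_i^(-γ/2), and both sides are
infinite exactly when these are not in ℓ₂. This turns norm estimates into estimates of series, and
measurability in the sample into measurability of a countable sum. -/
theorem powerNorm_sq {γ : ℝ} {c : (spectralSystem H ν).idx → ℝ} {f : Lp ℝ 2 ν} {g : X → ℝ}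
    (hg : g =ᵐ[ν] f)
    (hf : HasSum (fun i => c i • rkhsEmbedding H ν ((spectralSystem H ν).fn i)) f) :
    powerNorm H ν γ g ^ 2 =
      ∑' i, ENNReal.ofReal (c i ^ 2 * (spectralSystem H ν).eig i ^ (-γ)) := by
  have hpow : ∀ i, ((spectralSystem H ν).eig i ^ (-(γ / 2))) ^ 2 =
      (spectralSystem H ν).eig i ^ (-γ) := fun i => by
    rw [← Real.rpow_natCast, ← Real.rpow_mul ((spectralSystem H ν).eig_pos i).le]
    congr 1; push_cast; ring
  have hcancel : ∀ i, (spectralSystem H ν).eig i ^ (-(γ / 2)) *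
      (spectralSystem H ν).eig i ^ (γ / 2) = 1 := fun i => by
    rw [← Real.rpow_add ((spectralSystem H ν).eig_pos i)]; simp
  by_cases hfin : powerNorm H ν γ g = ∞
  · rw [hfin]
    by_contra hne
    have hne' : ∑' i, ENNReal.ofReal (c i ^ 2 * (spectralSystem H ν).eig i ^ (-γ)) ≠ ∞ :=
      fun h => hne (by simp [h])
    have hsum : Summable fun i => c i ^ 2 * (spectralSystem H ν).eig i ^ (-γ) := by
      have := ENNReal.summable_toReal hne'
      refine this.congr fun i => ENNReal.toReal_ofReal ?_
      have := Real.rpow_nonneg ((spectralSystem H ν).eig_pos i).le (-γ)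
      positivity
    let a : lp (fun _ : (spectralSystem H ν).idx => ℝ) 2 :=
      ⟨fun i => c i * (spectralSystem H ν).eig i ^ (-(γ / 2)), memℓp_gen (by
      refine hsum.congr fun i => ?_
      simp [mul_pow, hpow])⟩
    have ha : IsPowerCoeff H ν γ a f := by
      refine hf.congr_fun fun i => ?_
      change (c i * (spectralSystem H ν).eig i ^ (-(γ / 2)) *
        (spectralSystem H ν).eig i ^ (γ / 2)) • _ = _
      rw [mul_assoc, hcancel, mul_one]
    rw [powerNorm_eq_enorm hg ha] at hfin
    exact enorm_ne_top hfin
  · obtain ⟨a, f', hg', ha, e⟩ := exists_isPowerCoeff_of_powerNorm_ne_top hfin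
    have : f = f' := Lp.ext (hg.symm.trans hg')
    subst this
    rw [e, enorm_lp_sq]
    refine tsum_congr fun i => ?_
    have h1 := ha.inner_eq i
    rw [(spectralSystem H ν).orthonormal_cod.inner_eq_of_hasSum hf i] at h1
    rw [h1, mul_pow, ← hpow i, mul_assoc, ← mul_pow,
      mul_comm ((spectralSystem H ν).eig i ^ (γ / 2)), hcancel]
    simp

theorem coe_rkhsEmbedding_mem_powerSpace {γ : ℝ} {u : H} (h : powerNorm H ν γ u ≠ ∞) :
    rkhsEmbedding H ν u ∈ powerSpace H ν γ := by
  obtain ⟨a, f, hg, ha, -⟩ := exists_isPowerCoeff_of_powerNorm_ne_top h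
  have : rkhsEmbedding H ν u = f := Lp.ext ((rkhsEmbedding_coeFn u).trans hg)
  exact this ▸ ⟨a, ha⟩

theorem powerNorm_sum_fn_sq {γ : ℝ} (F : Finset (spectralSystem H ν).idx)
    (w : (spectralSystem H ν).idx → ℝ) :
    powerNorm H ν γ (∑ i ∈ F, w i • (spectralSystem H ν).fn i : H) ^ 2 =
      ENNReal.ofReal (∑ i ∈ F, w i ^ 2 * (spectralSystem H ν).eig i ^ (-γ)) := by
  classical
  have h1 : HasSum
      (fun i => (if i ∈ F then w i else 0) • rkhsEmbedding H ν ((spectralSystem H ν).fn i))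
      (rkhsEmbedding H ν (∑ i ∈ F, w i • (spectralSystem H ν).fn i)) := by
    rw [map_sum]
    have := hasSum_sum_of_ne_finset_zero (s := F) (L := .unconditional _)
      (f := fun i => (if i ∈ F then w i else 0) • rkhsEmbedding H ν ((spectralSystem H ν).fn i))
      (fun i hi => by simp [hi])
    convert! this using 1
    exact Finset.sum_congr rfl fun i hi => by simp [hi]
  rw [powerNorm_sq (rkhsEmbedding_coeFn _).symm h1, tsum_eq_sum (s := F) (fun i hi => by simp [hi]),
    ENNReal.ofReal_sum_of_nonneg]
  · exact Finset.sum_congr rfl fun i hi => by simp [hi]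
  · intro i _
    have := Real.rpow_nonneg ((spectralSystem H ν).eig_pos i).le (-γ)
    positivity

end Power

/-! ### Hamming balls and a Bayesian bound for multiple testing -/

/-- Chernoff's bound with x = 4/5: the sum of x^(8 |ω ∆ ω₀|) over all ω ⊆ F is (x^8 + 1)^m, by
translation with ω₀ and the binomial formula, while each point of the ball contributes at least x^m.
Numerically x^8 + 1 ≤ (3/2) x. -/
theorem card_hammingBall_le {ι : Type*} [DecidableEq ι] (F ω₀ : Finset ι) (hω₀ : ω₀ ⊆ F) :
    (({ω ∈ F.powerset | 8 * (symmDiff ω ω₀).card ≤ F.card} : Finset (Finset ι)).card : ℝ) ≤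
      (3 / 2) ^ F.card := by
  set m := F.card with hm
  have hbij : ∑ ω ∈ F.powerset, ((4 / 5 : ℝ) ^ 8) ^ (symmDiff ω ω₀).card =
      ((4 / 5 : ℝ) ^ 8 + 1) ^ m := by
    rw [← Finset.sum_pow_mul_eq_add_pow]
    refine Finset.sum_bij' (fun ω _ => symmDiff ω ω₀) (fun ω _ => symmDiff ω ω₀) ?_ ?_ ?_ ?_ ?_
    · intro ω hω
      rw [Finset.mem_powerset] at hω ⊢
      exact (symmDiff_le_sup (a := ω) (b := ω₀)).trans (Finset.union_subset hω hω₀)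
    · intro ω hω
      rw [Finset.mem_powerset] at hω ⊢
      exact (symmDiff_le_sup (a := ω) (b := ω₀)).trans (Finset.union_subset hω hω₀)
    · intro ω _
      simp
    · intro ω _
      simp
    · intro ω _
      simp
  have h1 : (({ω ∈ F.powerset | 8 * (symmDiff ω ω₀).card ≤ m} : Finset (Finset ι)).card : ℝ) *
      (4 / 5) ^ m ≤ ((4 / 5 : ℝ) ^ 8 + 1) ^ m := by
    rw [← hbij, ← nsmul_eq_mul, ← Finset.sum_const]
    refine (Finset.sum_le_sum fun ω hω => ?_).trans
      (Finset.sum_le_sum_of_subset_of_nonneg (Finset.filter_subset _ _)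
        fun _ _ _ => by positivity)
    rw [Finset.mem_filter] at hω
    rw [← pow_mul]
    exact pow_le_pow_of_le_one (by norm_num) (by norm_num) hω.2
  have h2 : ((4 / 5 : ℝ) ^ 8 + 1) ^ m ≤ (3 / 2) ^ m * (4 / 5) ^ m := by
    rw [← mul_pow]
    exact pow_le_pow_left₀ (by norm_num) (by norm_num) _
  exact le_of_mul_le_mul_right (h1.trans h2) (by positivity)

/-- Pointwise L ≤ θ L² + 1/θ, according to whether L exceeds 1/θ. Integrating over A ω and summing,
the first term costs second moments of the likelihood ratios, and the second costs the number of
sets A ω that can overlap at one sample. In the application A ω is the success event under ω and Q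
is a common reference law. -/
theorem sum_withDensity_le {Ω τ : Type*} [MeasurableSpace Ω] (Q : Measure Ω)
    [IsProbabilityMeasure Q] (T : Finset τ) (L : τ → Ω → ℝ≥0∞) (hL : ∀ ω ∈ T, Measurable (L ω))
    (A : τ → Set Ω) (hA : ∀ ω ∈ T, NullMeasurableSet (A ω) Q) (V E θ : ℝ≥0∞)
    (hV : ∀ D, ∑ ω ∈ T, (A ω).indicator (fun _ => 1) D ≤ V)
    (hE : ∀ ω ∈ T, ∫⁻ D, L ω D ^ 2 ∂Q ≤ E) (hθ : θ ≠ 0) (hθ' : θ ≠ ∞) :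
    ∑ ω ∈ T, Q.withDensity (L ω) (A ω) ≤ θ * (T.card * E) + V / θ := by
  have h1 : ∀ ω ∈ T, Q.withDensity (L ω) (A ω) ≤
      θ * E + ∫⁻ D, (A ω).indicator (fun _ => 1) D / θ ∂Q := by
    intro ω hω
    rw [withDensity_apply₀ _ (hA ω hω), ← lintegral_indicator₀ (hA ω hω)]
    calc ∫⁻ D, (A ω).indicator (L ω) D ∂Q
        ≤ ∫⁻ D, (θ * L ω D ^ 2 + (A ω).indicator (fun _ => 1) D / θ) ∂Q := by
          refine lintegral_mono fun D => ?_
          by_cases hD : D ∈ A ω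
          · simp only [hD, Set.indicator_of_mem]
            rcases le_total (L ω D) (1 / θ) with h | h
            · exact h.trans le_add_self
            · refine le_trans ?_ le_self_add
              have : 1 ≤ θ * L ω D := by
                rw [mul_comm]
                exact (ENNReal.div_le_iff hθ hθ').1 h
              calc L ω D = 1 * L ω D := (one_mul _).symm
                _ ≤ θ * L ω D * L ω D := by gcongr
                _ = _ := by ring
          · simp [hD]
      _ = θ * ∫⁻ D, L ω D ^ 2 ∂Q + ∫⁻ D, (A ω).indicator (fun _ => 1) D / θ ∂Q := by
          rw [lintegral_add_left (((hL ω hω).pow_const 2).const_mul θ),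
            lintegral_const_mul _ ((hL ω hω).pow_const 2)]
      _ ≤ _ := by gcongr; exact hE ω hω
  refine (Finset.sum_le_sum h1).trans ?_
  rw [Finset.sum_add_distrib, Finset.sum_const, nsmul_eq_mul]
  refine add_le_add (le_of_eq (by ring)) ?_
  rw [← lintegral_finsetSum' _ fun ω hω =>
    ((aemeasurable_indicator_const_iff (1 : ℝ≥0∞)).2 (hA ω hω)).div_const θ]
  calc ∫⁻ D, ∑ ω ∈ T, (A ω).indicator (fun _ => 1) D / θ ∂Q
      ≤ ∫⁻ _, V / θ ∂Q := by
        refine lintegral_mono fun D => ?_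
        simp only [div_eq_mul_inv]
        rw [← Finset.sum_mul]
        gcongr
        exact hV D
    _ = V / θ := by simp

/-! ### Products of densities -/

/-- The coordinates are independent under the product measure. -/
theorem lintegral_pi_prod {Ω : Type*} [MeasurableSpace Ω] (P : Measure Ω) [IsProbabilityMeasure P]
    {n : ℕ} (f : Fin n → Ω → ℝ≥0∞) (hf : ∀ i, Measurable (f i)) :
    ∫⁻ D, ∏ i, f i (D i) ∂Measure.pi (fun _ : Fin n => P) = ∏ i, ∫⁻ z, f i z ∂P := by
  have hind := ProbabilityTheory.iIndepFun_pi (μ := fun _ : Fin n => P) (X := f)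
    fun i => (hf i).aemeasurable
  refine (ProbabilityTheory.lintegral_prod_eq_prod_lintegral_of_indepFun Finset.univ
    (fun i (D : Fin n → Ω) => f i (D i)) hind fun i => (hf i).comp (measurable_pi_apply i)).trans ?_
  refine Finset.prod_congr rfl fun i _ => ?_
  exact (measurePreserving_eval (fun _ : Fin n => P) i).lintegral_comp (hf i)

/-- Both measures agree on rectangles, where the indicator of the rectangle factorises along with
the density. -/
theorem pi_withDensity_prod {Ω : Type*} [MeasurableSpace Ω] (P : Measure Ω)
    [IsProbabilityMeasure P] (ρ : Ω → ℝ≥0∞) (hρ : Measurable ρ)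
    [IsProbabilityMeasure (P.withDensity ρ)] (n : ℕ) :
    Measure.pi (fun _ : Fin n => P.withDensity ρ) =
      (Measure.pi fun _ : Fin n => P).withDensity fun D => ∏ i, ρ (D i) := by
  refine Measure.pi_eq fun s hs => ?_
  rw [withDensity_apply _ (MeasurableSet.univ_pi hs),
    ← lintegral_indicator (MeasurableSet.univ_pi hs)]
  have : (Set.univ.pi s).indicator (fun D : Fin n → Ω => ∏ i, ρ (D i)) =
      fun D => ∏ i, (s i).indicator ρ (D i) := by
    ext D
    by_cases hD : D ∈ Set.univ.pi s
    · rw [Set.indicator_of_mem hD]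
      exact Finset.prod_congr rfl fun i _ => (Set.indicator_of_mem (hD i trivial) _).symm
    · rw [Set.indicator_of_notMem hD]
      simp only [Set.mem_univ_pi, not_forall] at hD
      obtain ⟨i, hi⟩ := hD
      exact (Finset.prod_eq_zero (Finset.mem_univ i) (Set.indicator_of_notMem hi _)).symm
  rw [this, lintegral_pi_prod P _ fun i => hρ.indicator (hs i)]
  refine Finset.prod_congr rfl fun i _ => ?_
  rw [withDensity_apply _ (hs i), lintegral_indicator (hs i)]

/-! ### Regression with two-point noise -/

section TwoPoint

open ProbabilityTheory

variable {X : Type*} [MeasurableSpace X]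

/-- The kernel of distributions on `{K, -K}` with mean `g x`. -/
noncomputable def twoPointKernel (K : ℝ) (g : X → ℝ) (hg : Measurable g) : Kernel X ℝ where
  toFun x := ENNReal.ofReal ((1 + g x / K) / 2) • Measure.dirac K +
    ENNReal.ofReal ((1 - g x / K) / 2) • Measure.dirac (-K)
  measurable' := by
    refine Measure.measurable_of_measurable_coe _ fun s hs => ?_
    simp only [Measure.coe_add, Measure.coe_smul, Pi.add_apply, Pi.smul_apply, smul_eq_mul]
    fun_prop

variable {K : ℝ} {g : X → ℝ} {hg : Measurable g}

theorem twoPointKernel_apply (x : X) : twoPointKernel K g hg x =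
    ENNReal.ofReal ((1 + g x / K) / 2) • Measure.dirac K +
      ENNReal.ofReal ((1 - g x / K) / 2) • Measure.dirac (-K) := rfl

theorem twoPoint_weights (hK : 0 < K) {t : ℝ} (ht : |t| ≤ K) :
    0 ≤ (1 + t / K) / 2 ∧ 0 ≤ (1 - t / K) / 2 := by
  obtain ⟨h1, h2⟩ := abs_le.1 ht
  have h3 : t / K ≤ 1 := (div_le_one hK).2 h2
  have h4 : -1 ≤ t / K := by rw [le_div_iff₀ hK]; linarith
  constructor <;> linarith

theorem isMarkovKernel_twoPointKernel (hK : 0 < K) (hgK : ∀ x, |g x| ≤ K) :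
    IsMarkovKernel (twoPointKernel K g hg) := by
  refine ⟨fun x => ⟨?_⟩⟩
  obtain ⟨h1, h2⟩ := twoPoint_weights hK (hgK x)
  rw [twoPointKernel_apply]
  simp only [Measure.coe_add, Measure.coe_smul, Pi.add_apply, Pi.smul_apply, smul_eq_mul,
    measure_univ, mul_one]
  rw [← ENNReal.ofReal_add h1 h2]
  ring_nf
  simp

theorem lintegral_twoPointKernel (x : X) (φ : ℝ → ℝ≥0∞) :
    ∫⁻ y, φ y ∂twoPointKernel K g hg x = ENNReal.ofReal ((1 + g x / K) / 2) * φ K +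
      ENNReal.ofReal ((1 - g x / K) / 2) * φ (-K) := by
  rw [twoPointKernel_apply, lintegral_add_measure, lintegral_smul_measure, lintegral_smul_measure,
    lintegral_dirac, lintegral_dirac]
  simp

theorem integral_twoPointKernel (hK : 0 < K) (hgK : ∀ x, |g x| ≤ K) (x : X) :
    ∫ y, y ∂twoPointKernel K g hg x = g x := by
  obtain ⟨h1, h2⟩ := twoPoint_weights hK (hgK x)
  rw [twoPointKernel_apply, integral_add_measure, integral_smul_measure, integral_smul_measure,
    integral_dirac, integral_dirac, ENNReal.toReal_ofReal h1, ENNReal.toReal_ofReal h2]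
  · simp only [smul_eq_mul]
    field_simp
    ring
  · exact (integrable_dirac (by simp)).smul_measure ENNReal.ofReal_ne_top
  · exact (integrable_dirac (by simp)).smul_measure ENNReal.ofReal_ne_top

/-- Both atoms are within 2K of the mean, so m - 2 of the factors are bounded by 2K; what remains is
the variance K² - g². -/
theorem lintegral_pow_sub_twoPointKernel_le (hK : 0 < K) (hgK : ∀ x, |g x| ≤ K) (x : X) {m : ℕ}
    (hm : 2 ≤ m) :
    ∫⁻ y, ENNReal.ofReal (|y - g x| ^ m) ∂twoPointKernel K g hg x ≤
      ENNReal.ofReal (K ^ 2 * (2 * K) ^ (m - 2)) := by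
  obtain ⟨h1, h2⟩ := twoPoint_weights hK (hgK x)
  obtain ⟨h3, h4⟩ := abs_le.1 (hgK x)
  have hsplit : ∀ t : ℝ, |t| ≤ 2 * K → |t| ^ m ≤ t ^ 2 * (2 * K) ^ (m - 2) := by
    intro t ht
    calc |t| ^ m = |t| ^ 2 * |t| ^ (m - 2) := by rw [← pow_add]; congr 1; omega
      _ ≤ _ := by rw [sq_abs]; gcongr
  have h5 := hsplit (K - g x) (abs_le.2 ⟨by linarith, by linarith⟩)
  have h6 := hsplit (-K - g x) (abs_le.2 ⟨by linarith, by linarith⟩)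
  rw [lintegral_twoPointKernel, ← ENNReal.ofReal_mul h1, ← ENNReal.ofReal_mul h2,
    ← ENNReal.ofReal_add (by positivity) (by positivity)]
  refine ENNReal.ofReal_le_ofReal ?_
  have h7 : (1 + g x / K) / 2 * (K - g x) ^ 2 + (1 - g x / K) / 2 * (-K - g x) ^ 2 =
      K ^ 2 - g x ^ 2 := by
    field_simp
    ring
  calc _ ≤ (1 + g x / K) / 2 * ((K - g x) ^ 2 * (2 * K) ^ (m - 2)) +
        (1 - g x / K) / 2 * ((-K - g x) ^ 2 * (2 * K) ^ (m - 2)) := by gcongr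
    _ = (K ^ 2 - g x ^ 2) * (2 * K) ^ (m - 2) := by rw [← h7]; ring
    _ ≤ _ := by
      gcongr
      nlinarith [sq_nonneg (g x)]

variable (ν : Measure X) [IsProbabilityMeasure ν]

theorem lintegral_compProd_twoPointKernel (hK : 0 < K) (hgK : ∀ x, |g x| ≤ K)
    {φ : X × ℝ → ℝ≥0∞} (hφ : Measurable φ) :
    ∫⁻ z, φ z ∂(ν ⊗ₘ twoPointKernel K g hg) = ∫⁻ x, (ENNReal.ofReal ((1 + g x / K) / 2) * φ (x, K) +
      ENNReal.ofReal ((1 - g x / K) / 2) * φ (x, -K)) ∂ν := by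
  have := isMarkovKernel_twoPointKernel (hg := hg) hK hgK
  rw [Measure.lintegral_compProd hφ]
  simp only [lintegral_twoPointKernel]

/-- The likelihood ratio of the two-point noise model with regression function `g` with respect
to the one with regression function zero. -/
noncomputable def twoPointDensity (K : ℝ) (g : X → ℝ) (z : X × ℝ) : ℝ≥0∞ :=
  ENNReal.ofReal (1 + z.2 * g z.1 / K ^ 2)

theorem measurable_twoPointDensity (hg : Measurable g) : Measurable (twoPointDensity K g) := by
  unfold twoPointDensity
  fun_prop

/-- At y = ±K the weight (1 ± g/K)/2 is the symmetric weight 1/2 times 1 + y g / K². -/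
theorem compProd_twoPointKernel_eq (hK : 0 < K) (hgK : ∀ x, |g x| ≤ K) :
    ν ⊗ₘ twoPointKernel K g hg =
      (ν ⊗ₘ twoPointKernel K 0 measurable_zero).withDensity (twoPointDensity K g) := by
  have h0 : ∀ x : X, |(0 : X → ℝ) x| ≤ K := fun x => by simpa using hK.le
  ext s hs
  rw [withDensity_apply _ hs, ← lintegral_indicator hs, ← lintegral_indicator_one hs,
    lintegral_compProd_twoPointKernel ν hK hgK (measurable_one.indicator hs),
    lintegral_compProd_twoPointKernel ν hK h0 ((measurable_twoPointDensity hg).indicator hs)]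
  refine lintegral_congr fun x => ?_
  obtain ⟨h1, h2⟩ := twoPoint_weights hK (hgK x)
  have e1 : ENNReal.ofReal ((1 + (0 : X → ℝ) x / K) / 2) * s.indicator (twoPointDensity K g) (x, K)
      = ENNReal.ofReal ((1 + g x / K) / 2) * s.indicator 1 (x, K) := by
    by_cases hx : (x, K) ∈ s
    · simp only [hx, Set.indicator_of_mem, twoPointDensity, Pi.zero_apply, Pi.one_apply, mul_one]
      rw [← ENNReal.ofReal_mul (by norm_num)]
      congr 1
      field_simp
      ring
    · simp [hx]
  have e2 : ENNReal.ofReal ((1 - (0 : X → ℝ) x / K) / 2) *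
      s.indicator (twoPointDensity K g) (x, -K)
      = ENNReal.ofReal ((1 - g x / K) / 2) * s.indicator 1 (x, -K) := by
    by_cases hx : (x, -K) ∈ s
    · simp only [hx, Set.indicator_of_mem, twoPointDensity, Pi.zero_apply, Pi.one_apply, mul_one]
      rw [← ENNReal.ofReal_mul (by norm_num)]
      congr 1
      field_simp
      ring
    · simp [hx]
  rw [e1, e2]

/-- Under symmetric noise the term linear in g cancels, leaving 1 + ∫ g² / K². The exponential bound
is chosen because it multiplies well over n independent samples. -/
theorem lintegral_twoPointDensity_sq_le (hK : 0 < K) (hg : Measurable g) (hgK : ∀ x, |g x| ≤ K)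
    {r : ℝ} (hr0 : 0 ≤ r) (hr : ∫⁻ x, ENNReal.ofReal (g x ^ 2) ∂ν ≤ ENNReal.ofReal r) :
    ∫⁻ z, twoPointDensity K g z ^ 2 ∂(ν ⊗ₘ twoPointKernel K 0 measurable_zero) ≤
      ENNReal.ofReal (Real.exp (r / K ^ 2)) := by
  have h0 : ∀ x : X, |(0 : X → ℝ) x| ≤ K := fun x => by simpa using hK.le
  rw [lintegral_compProd_twoPointKernel ν hK h0 ((measurable_twoPointDensity hg).pow_const 2)]
  have hpt : ∀ x, ENNReal.ofReal ((1 + (0 : X → ℝ) x / K) / 2) * twoPointDensity K g (x, K) ^ 2 +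
      ENNReal.ofReal ((1 - (0 : X → ℝ) x / K) / 2) * twoPointDensity K g (x, -K) ^ 2 =
      1 + ENNReal.ofReal (1 / K ^ 2) * ENNReal.ofReal (g x ^ 2) := by
    intro x
    obtain ⟨h1, h2⟩ := twoPoint_weights hK (hgK x)
    have e1 : (1 : ℝ) + K * g x / K ^ 2 = 1 + g x / K := by field_simp
    have e2 : (1 : ℝ) + -K * g x / K ^ 2 = 1 - g x / K := by field_simp; ring
    simp only [twoPointDensity, Pi.zero_apply, e1, e2, zero_div, add_zero, sub_zero]
    rw [← ENNReal.ofReal_pow (by linarith), ← ENNReal.ofReal_pow (by linarith),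
      ← ENNReal.ofReal_mul (by norm_num), ← ENNReal.ofReal_mul (by norm_num),
      ← ENNReal.ofReal_mul (by positivity), ← ENNReal.ofReal_add (by positivity) (by positivity),
      ← ENNReal.ofReal_one, ← ENNReal.ofReal_add (by norm_num) (by positivity)]
    congr 1
    field_simp
    ring
  simp only [hpt]
  rw [lintegral_add_left measurable_const, lintegral_const_mul _ (by fun_prop)]
  simp only [lintegral_const, measure_univ, mul_one]
  calc 1 + ENNReal.ofReal (1 / K ^ 2) * ∫⁻ x, ENNReal.ofReal (g x ^ 2) ∂ν
      ≤ 1 + ENNReal.ofReal (1 / K ^ 2) * ENNReal.ofReal r := by gcongr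
    _ = ENNReal.ofReal 1 + ENNReal.ofReal (r / K ^ 2) := by
      rw [← ENNReal.ofReal_mul (by positivity), ENNReal.ofReal_one]
      congr 2
      ring
    _ ≤ ENNReal.ofReal (Real.exp (r / K ^ 2)) := by
      rw [← ENNReal.ofReal_add zero_le_one (by positivity)]
      refine ENNReal.ofReal_le_ofReal ?_
      have := Real.add_one_le_exp (r / K ^ 2)
      linarith

end TwoPoint

/-! ### Truncation of regression functions -/

section Truncation

variable {X : Type*}

/-- The values of `u` truncated to `[-K, K]`. -/
def truncation (K : ℝ) (u : X → ℝ) (x : X) : ℝ := max (-K) (min K (u x))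

theorem abs_truncation_le {K : ℝ} (hK : 0 < K) (u : X → ℝ) (x : X) : |truncation K u x| ≤ K :=
  abs_le.2 ⟨le_max_left _ _, max_le (by linarith) (min_le_left _ _)⟩

/-- The two-point weights must be nonnegative at every x, while the embedding bounds the test
functions only almost everywhere. Truncation repairs the exceptional points and changes nothing
elsewhere. -/
theorem truncation_eq {K : ℝ} {u : X → ℝ} {x : X} (h : |u x| ≤ K) : truncation K u x = u x := by
  obtain ⟨h1, h2⟩ := abs_le.1 h
  rw [truncation, min_eq_right h2, max_eq_right h1]

end Truncation

/-! ### `L₂(ν)`-norms of finite spectral sums -/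

section LowerBound

open ProbabilityTheory

variable {X : Type*} {H : Type*} [NormedAddCommGroup H]
  [InnerProductSpace ℝ H] [CompleteSpace H] [RKHS ℝ H X ℝ] [MeasurableSpace X]
  [MeasurableBoundedKernel H]

theorem norm_rkhsEmbedding_sq (ν : Measure X) [IsFiniteMeasure ν] (h : H) :
    ‖rkhsEmbedding H ν h‖ ^ 2 = ∫ x, h x ^ 2 ∂ν := by
  rw [← real_inner_self_eq_norm_sq, L2.inner_def]
  refine integral_congr_ae ?_
  filter_upwards [rkhsEmbedding_coeFn (ν := ν) h] with x hx
  rw [hx, real_inner_self_eq_norm_sq, Real.norm_eq_abs, sq_abs]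

theorem lintegral_ofReal_sq (ν : Measure X) [IsFiniteMeasure ν] (h : H) :
    ∫⁻ x, ENNReal.ofReal (h x ^ 2) ∂ν = ENNReal.ofReal (‖rkhsEmbedding H ν h‖ ^ 2) := by
  rw [norm_rkhsEmbedding_sq, ofReal_integral_eq_lintegral_ofReal (rkhs_memLp ν h).integrable_sq
    (Eventually.of_forall fun x => sq_nonneg _)]

theorem norm_rkhsEmbedding_sum_fn_sq (ν : Measure X) [IsFiniteMeasure ν]
    (F : Finset (spectralSystem H ν).idx) (w : (spectralSystem H ν).idx → ℝ) :
    ‖rkhsEmbedding H ν (∑ i ∈ F, w i • (spectralSystem H ν).fn i)‖ ^ 2 = ∑ i ∈ F, w i ^ 2 := by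
  rw [map_sum, ← real_inner_self_eq_norm_sq]
  simp only [map_smul]
  rw [(spectralSystem H ν).orthonormal_cod.inner_sum]
  simp [sq]

/-! ### The two-point noise model as a member of `jointClass` -/

theorem measurable_truncation {K : ℝ} {u : X → ℝ} (hu : Measurable u) :
    Measurable (truncation K u) :=
  measurable_const.max (measurable_const.min hu)

/-- The joint distribution with marginal `ν` and two-point noise at `±K` whose regression function
is the truncation of `u`. -/
noncomputable def twoPointJoint (ν : ProbabilityMeasure X) {K : ℝ} (hK : 0 < K) (u : X → ℝ)
    (hu : Measurable u) : ProbabilityMeasure (X × ℝ) :=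
  ⟨(ν : Measure X) ⊗ₘ twoPointKernel K (truncation K u) (measurable_truncation hu),
    have := isMarkovKernel_twoPointKernel (hg := measurable_truncation hu) hK
      (abs_truncation_le hK u)
    inferInstance⟩

variable {ν : ProbabilityMeasure X} {K : ℝ} {hK : 0 < K} {u : X → ℝ} {hu : Measurable u}

theorem coe_twoPointJoint : (twoPointJoint ν hK u hu : Measure (X × ℝ)) =
    (ν : Measure X) ⊗ₘ twoPointKernel K (truncation K u) (measurable_truncation hu) := rfl

theorem marginal_twoPointJoint : marginal (twoPointJoint ν hK u hu) = ν := by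
  have := isMarkovKernel_twoPointKernel (hg := measurable_truncation hu) hK
    (abs_truncation_le hK u)
  refine Subtype.ext ?_
  change (twoPointJoint ν hK u hu : Measure (X × ℝ)).fst = ν
  rw [coe_twoPointJoint, Measure.fst_compProd]

theorem powerNorm_marginal_twoPointJoint (γ : ℝ) (g : X → ℝ) :
    powerNorm H (marginal (twoPointJoint ν hK u hu) : Measure X) γ g =
      powerNorm H (ν : Measure X) γ g :=
  congrArg (fun ν' : ProbabilityMeasure X => powerNorm H (ν' : Measure X) γ g)
    marginal_twoPointJoint

/-- Disintegrations over a standard Borel fibre are almost everywhere unique. -/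
theorem condKernel_twoPointJoint :
    ∀ᵐ x ∂(ν : Measure X), (twoPointJoint ν hK u hu : Measure (X × ℝ)).condKernel x =
      twoPointKernel K (truncation K u) (measurable_truncation hu) x := by
  have := isMarkovKernel_twoPointKernel (hg := measurable_truncation hu) hK
    (abs_truncation_le hK u)
  have hfst : (twoPointJoint ν hK u hu : Measure (X × ℝ)).fst = ν := by
    rw [coe_twoPointJoint, Measure.fst_compProd]
  have h := eq_condKernel_of_measure_eq_compProd
    (ρ := (twoPointJoint ν hK u hu : Measure (X × ℝ)))
    (twoPointKernel K (truncation K u) (measurable_truncation hu)) (by rw [hfst]; rfl)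
  rw [hfst] at h
  filter_upwards [h] with x hx using hx.symm

theorem condMean_twoPointJoint (huK : ∀ᵐ x ∂(ν : Measure X), |u x| ≤ K) :
    condMean (twoPointJoint ν hK u hu) =ᵐ[(ν : Measure X)] u := by
  filter_upwards [condKernel_twoPointJoint (hK := hK) (hu := hu), huK] with x hx hx'
  rw [condMean, hx, integral_twoPointKernel hK (abs_truncation_le hK u), truncation_eq hx']

/-- The moment condition holds because m!/2 ≥ 1 for m ≥ 2, while the centred moments are at most K²
(2K)^(m-2). -/
theorem twoPointJoint_mem_jointClass {𝔛 : Set (ProbabilityMeasure X)} (hν : ν ∈ 𝔛)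
    {β B Binf L σ : ℝ} (hKσ : K ≤ σ) (hKL : 2 * K ≤ L)
    (huK : ∀ᵐ x ∂(ν : Measure X), |u x| ≤ K)
    (huB : powerNorm H (ν : Measure X) β u ^ 2 ≤ ENNReal.ofReal B)
    (huinf : eLpNorm u ∞ (ν : Measure X) ^ 2 ≤ ENNReal.ofReal Binf) :
    twoPointJoint ν hK u hu ∈ jointClass H β B Binf L σ 𝔛 := by
  have hmean := condMean_twoPointJoint (hK := hK) (hu := hu) huK
  refine ⟨by rwa [marginal_twoPointJoint], ?_, ?_, ?_, ?_⟩
  · refine ⟨(measurable_snd.pow_const 2).aestronglyMeasurable, ?_⟩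
    rw [HasFiniteIntegral, coe_twoPointJoint,
      lintegral_compProd_twoPointKernel _ hK (abs_truncation_le hK u) (by fun_prop)]
    calc _ ≤ ∫⁻ _ : X, (ENNReal.ofReal 1 * ‖K ^ 2‖ₑ + ENNReal.ofReal 1 * ‖K ^ 2‖ₑ)
          ∂(ν : Measure X) := by
          refine lintegral_mono fun x => ?_
          obtain ⟨h1, h2⟩ := twoPoint_weights hK (abs_truncation_le hK u x)
          simp only [even_two, Even.neg_pow]
          gcongr <;> linarith
      _ < ∞ := by
          simp only [lintegral_const, measure_univ, mul_one, ENNReal.ofReal_one, one_mul]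
          exact ENNReal.add_lt_top.2 ⟨enorm_lt_top, enorm_lt_top⟩
  · rw [marginal_twoPointJoint, eLpNorm_congr_ae hmean]
    exact huinf
  · rw [powerNorm_marginal_twoPointJoint, powerNorm_congr hmean]
    exact huB
  · rw [marginal_twoPointJoint]
    filter_upwards [condKernel_twoPointJoint (hK := hK) (hu := hu), hmean, huK] with x hx hx' hx''
    intro m hm
    have ht : condMean (twoPointJoint ν hK u hu) x = truncation K u x := by
      rw [hx', truncation_eq hx'']
    rw [ht, hx]
    refine (lintegral_pow_sub_twoPointKernel_le hK (abs_truncation_le hK u) x hm).trans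
      (ENNReal.ofReal_le_ofReal ?_)
    have hfac : (2 : ℝ) ≤ m.factorial := by
      exact_mod_cast (show Nat.factorial 2 ≤ m.factorial from Nat.factorial_le hm)
    calc K ^ 2 * (2 * K) ^ (m - 2) ≤ σ ^ 2 * L ^ (m - 2) := by gcongr
      _ = 1 / 2 * 2 * (σ ^ 2 * L ^ (m - 2)) := by ring
      _ ≤ 1 / 2 * m.factorial * (σ ^ 2 * L ^ (m - 2)) := by
        have : 0 ≤ L := by linarith
        gcongr
      _ = _ := by ring

/-! ### The testing bound over a finite block of indices -/

theorem ae_abs_le_of_eLpNorm_top_sq_le {ν : Measure X}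
    (h : eLpNorm u ∞ ν ^ 2 ≤ ENNReal.ofReal (K ^ 2)) (hK : 0 ≤ K) : ∀ᵐ x ∂ν, |u x| ≤ K := by
  rw [ENNReal.ofReal_pow hK, ENNReal.pow_le_pow_left_iff two_ne_zero, eLpNorm_exponent_top] at h
  filter_upwards [ae_le_eLpNormEssSup (μ := ν) (f := u)] with x hx
  have := hx.trans h
  rwa [← ofReal_norm, ENNReal.ofReal_le_ofReal_iff hK] at this

/-- Universal measurability applies to every probability measure Q, not only to powers of P. The
Bayesian bound needs this for one reference law Q shared by all hypotheses. -/
theorem nullMeasurableSet_powerNorm_le {γ : ℝ} {𝔐 : Set (ProbabilityMeasure (X × ℝ))} {n : ℕ}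
    {fhat : (Fin n → X × ℝ) → X → ℝ} (hf : fhat ∈ learningMethods H γ 𝔐 n)
    {P : ProbabilityMeasure (X × ℝ)} (hP : P ∈ 𝔐) (t : ℝ≥0∞)
    (Q : Measure (Fin n → X × ℝ)) [IsProbabilityMeasure Q] :
    NullMeasurableSet {D | powerNorm H (marginal P : Measure X) γ
      (fun x => fhat D x - condMean P x) ^ 2 ≤ t} Q := by
  have h := hf.2 P hP
  have hs : MeasurableSet {r : ℝ≥0∞ | r ^ 2 ≤ t} :=
    measurableSet_le (measurable_id.pow_const 2) measurable_const
  exact h hs Q inferInstance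

/-- The hypotheses are the 2^m subsets of the block. The first sum condition is the source
condition, the second bounds the regression functions by K through the embedding, and the third
limits the information in n samples; `ht` keeps the hypotheses separated. Averaging produces one
distribution under which success is exponentially unlikely in m. -/
theorem le_iSup_errorProb {𝔛 : Set (ProbabilityMeasure X)} (hν : ν ∈ 𝔛)
    {α β γ A B Binf L σ δ t : ℝ} (hA : 0 < A) (hK : 0 < K)
    (hKσ : K ≤ σ) (hKL : 2 * K ≤ L) (hKB : K ^ 2 ≤ Binf)
    (hemb : ∀ f ∈ powerSpace H (ν : Measure X) α,
      eLpNorm f ∞ (ν : Measure X) ≤ ENNReal.ofReal A * powerNorm H (ν : Measure X) α f)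
    (F : Finset (spectralSystem H (ν : Measure X)).idx) (n : ℕ)
    (hδB : ∑ i ∈ F, δ ^ 2 * (spectralSystem H (ν : Measure X)).eig i ^ (γ - β) ≤ B)
    (hδA : A ^ 2 * ∑ i ∈ F, δ ^ 2 * (spectralSystem H (ν : Measure X)).eig i ^ (γ - α) ≤ K ^ 2)
    (hδn : n * (∑ i ∈ F, δ ^ 2 * (spectralSystem H (ν : Measure X)).eig i ^ γ) / K ^ 2 ≤
      F.card / 17)
    (hδ : 0 < δ) (ht : 32 * t ≤ δ ^ 2 * F.card)
    {fhat : (Fin n → X × ℝ) → X → ℝ}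
    (hf : fhat ∈ learningMethods H γ (jointClass H β B Binf L σ 𝔛) n) :
    1 - ENNReal.ofReal ((17 / 18) ^ F.card + (27 / 32) ^ F.card) ≤
      ⨆ P ∈ jointClass H β B Binf L σ 𝔛, errorProb H γ fhat P t := by
  classical
  set m := F.card with hm
  -- The factor μ_i^(γ/2) cancels the weight μ_i^(-γ) of the squared γ-norm, so flipping one
  -- coordinate moves the function by exactly δ² there.
  let w : Finset (spectralSystem H (ν : Measure X)).idx →
      (spectralSystem H (ν : Measure X)).idx → ℝ :=
    fun ω i => if i ∈ ω then δ * (spectralSystem H (ν : Measure X)).eig i ^ (γ / 2) else 0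
  let f : Finset (spectralSystem H (ν : Measure X)).idx → H :=
    fun ω => ∑ i ∈ F, w ω i • (spectralSystem H (ν : Measure X)).fn i
  have hpos := fun i => (spectralSystem H (ν : Measure X)).eig_pos i
  have hw : ∀ ω i, w ω i ^ 2 ≤ δ ^ 2 * (spectralSystem H (ν : Measure X)).eig i ^ γ := by
    intro ω i
    by_cases hi : i ∈ ω
    · simp only [w, hi, if_true]
      rw [mul_pow, ← Real.rpow_natCast (_ ^ (γ / 2)), ← Real.rpow_mul (hpos i).le]
      simp
    · simp only [w, hi, if_false]
      have := Real.rpow_nonneg (hpos i).le γ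
      rw [zero_pow two_ne_zero]
      positivity
  have hfs : ∀ ω s, powerNorm H (ν : Measure X) s (f ω) ^ 2 ≤ ENNReal.ofReal
      (∑ i ∈ F, δ ^ 2 * (spectralSystem H (ν : Measure X)).eig i ^ (γ - s)) := by
    intro ω s
    rw [powerNorm_sum_fn_sq]
    refine ENNReal.ofReal_le_ofReal (Finset.sum_le_sum fun i _ => ?_)
    rw [sub_eq_add_neg, Real.rpow_add (hpos i), ← mul_assoc]
    exact mul_le_mul_of_nonneg_right (hw ω i) (Real.rpow_nonneg (hpos i).le _)
  have hfinf : ∀ ω, eLpNorm (f ω) ∞ (ν : Measure X) ^ 2 ≤ ENNReal.ofReal (K ^ 2) := by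
    intro ω
    have hfin : powerNorm H (ν : Measure X) α (f ω) ≠ ∞ := by
      intro h
      have := hfs ω α
      rw [h] at this
      simp at this
    have h1 := hemb _ (coe_rkhsEmbedding_mem_powerSpace hfin)
    rw [eLpNorm_congr_ae (rkhsEmbedding_coeFn (f ω)), powerNorm_congr
      (rkhsEmbedding_coeFn (f ω))] at h1
    calc _ ≤ (ENNReal.ofReal A * powerNorm H (ν : Measure X) α (f ω)) ^ 2 := by gcongr
      _ = ENNReal.ofReal (A ^ 2) * powerNorm H (ν : Measure X) α (f ω) ^ 2 := by
        rw [mul_pow, ENNReal.ofReal_pow hA.le]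
      _ ≤ ENNReal.ofReal (A ^ 2) * ENNReal.ofReal
          (∑ i ∈ F, δ ^ 2 * (spectralSystem H (ν : Measure X)).eig i ^ (γ - α)) := by
        gcongr; exact hfs ω α
      _ ≤ _ := by
        rw [← ENNReal.ofReal_mul (by positivity)]
        exact ENNReal.ofReal_le_ofReal hδA
  have hfK : ∀ ω, ∀ᵐ x ∂(ν : Measure X), |f ω x| ≤ K := fun ω =>
    ae_abs_le_of_eLpNorm_top_sq_le (hfinf ω) hK.le
  let P : Finset (spectralSystem H (ν : Measure X)).idx → ProbabilityMeasure (X × ℝ) :=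
    fun ω => twoPointJoint ν hK (f ω) (rkhs_measurable (f ω))
  have hPmem : ∀ ω, P ω ∈ jointClass H β B Binf L σ 𝔛 := fun ω =>
    twoPointJoint_mem_jointClass hν hKσ hKL (hfK ω)
      ((hfs ω β).trans (ENNReal.ofReal_le_ofReal hδB))
      ((hfinf ω).trans (ENNReal.ofReal_le_ofReal hKB))
  let P₀ : Measure (X × ℝ) := (ν : Measure X) ⊗ₘ twoPointKernel K 0 measurable_zero
  have hP₀ : IsProbabilityMeasure P₀ := by
    have := isMarkovKernel_twoPointKernel (X := X) (hg := measurable_zero) hK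
      (fun x => by simpa using hK.le)
    infer_instance
  let ρ : Finset (spectralSystem H (ν : Measure X)).idx → X × ℝ → ℝ≥0∞ :=
    fun ω => twoPointDensity K (truncation K (f ω))
  have hρ : ∀ ω, Measurable (ρ ω) := fun ω =>
    measurable_twoPointDensity (measurable_truncation (rkhs_measurable (f ω)))
  have hPρ : ∀ ω, (P ω : Measure (X × ℝ)) = P₀.withDensity (ρ ω) := fun ω =>
    compProd_twoPointKernel_eq _ hK (abs_truncation_le hK _)
  let A' : Finset (spectralSystem H (ν : Measure X)).idx → Set (Fin n → X × ℝ) := fun ω =>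
    {D | powerNorm H (marginal (P ω) : Measure X) γ
      (fun x => fhat D x - condMean (P ω) x) ^ 2 ≤ ENNReal.ofReal t}
  let Q : Measure (Fin n → X × ℝ) := Measure.pi fun _ => P₀
  have hPQ : ∀ ω, Measure.pi (fun _ : Fin n => (P ω : Measure (X × ℝ))) =
      Q.withDensity fun D => ∏ i, ρ ω (D i) := by
    intro ω
    have : IsProbabilityMeasure (P₀.withDensity (ρ ω)) := by rw [← hPρ]; infer_instance
    rw [hPρ]
    exact pi_withDensity_prod P₀ (ρ ω) (hρ ω) n
  -- By the triangle inequality two squared errors at most t give δ² |ω ∆ ω₀| ≤ 4t ≤ δ² m / 8; this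
  -- is the origin of the factor 32.
  have hdist : ∀ ω ω₀, ω ⊆ F → ω₀ ⊆ F → ∀ D, D ∈ A' ω → D ∈ A' ω₀ →
      8 * (symmDiff ω ω₀).card ≤ m := by
    intro ω ω₀ hωF hω₀F D hD hD₀
    have hnorm : ∀ ω, powerNorm H (marginal (P ω) : Measure X) γ
        (fun x => fhat D x - condMean (P ω) x) =
        powerNorm H (ν : Measure X) γ (fun x => fhat D x - f ω x) := by
      intro ω
      rw [powerNorm_marginal_twoPointJoint]
      refine powerNorm_congr ?_
      filter_upwards [condMean_twoPointJoint (hK := hK) (hu := rkhs_measurable (f ω)) (hfK ω)]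
        with x hx
      rw [hx]
    simp only [A', Set.mem_ofPred_eq, hnorm] at hD hD₀
    have htri := powerNorm_sub_le (H := H) (ν := (ν : Measure X)) (γ := γ)
      (fun x => fhat D x - f ω₀ x) (fun x => fhat D x - f ω x)
    set a := powerNorm H (ν : Measure X) γ (fun x => fhat D x - f ω x)
    set b := powerNorm H (ν : Measure X) γ (fun x => fhat D x - f ω₀ x)
    have hdiff : (fun x => fhat D x - f ω₀ x - (fhat D x - f ω x)) =
        ⇑(∑ i ∈ F, (w ω i - w ω₀ i) • (spectralSystem H (ν : Measure X)).fn i) := by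
      have : ∑ i ∈ F, (w ω i - w ω₀ i) • (spectralSystem H (ν : Measure X)).fn i =
          f ω - f ω₀ := by
        simp only [f, sub_smul, Finset.sum_sub_distrib]
      rw [this]
      ext x
      rw [RKHS.coe_sub, Pi.sub_apply]
      ring
    rw [hdiff] at htri
    have hsq : powerNorm H (ν : Measure X) γ
        (∑ i ∈ F, (w ω i - w ω₀ i) • (spectralSystem H (ν : Measure X)).fn i : H) ^ 2 =
        ENNReal.ofReal (δ ^ 2 * (symmDiff ω ω₀).card) := by
      rw [powerNorm_sum_fn_sq]
      congr 1
      have hsub : symmDiff ω ω₀ ⊆ F :=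
        (symmDiff_le_sup (a := ω) (b := ω₀)).trans (Finset.union_subset hωF hω₀F)
      have h1 : ∀ i, (w ω i - w ω₀ i) ^ 2 * (spectralSystem H (ν : Measure X)).eig i ^ (-γ) =
          if i ∈ symmDiff ω ω₀ then δ ^ 2 else 0 := by
        intro i
        have h2 : ((spectralSystem H (ν : Measure X)).eig i ^ (γ / 2)) ^ 2 *
            (spectralSystem H (ν : Measure X)).eig i ^ (-γ) = 1 := by
          rw [← Real.rpow_natCast (_ ^ (γ / 2)), ← Real.rpow_mul (hpos i).le,
            ← Real.rpow_add (hpos i)]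
          simp
        by_cases hi : i ∈ ω <;> by_cases hi₀ : i ∈ ω₀ <;>
          simp [Finset.mem_symmDiff, w, hi, hi₀, mul_pow, mul_assoc, h2]
      simp only [h1]
      rw [← Finset.sum_filter, Finset.filter_mem_eq_inter, Finset.inter_eq_right.2 hsub,
        Finset.sum_const, nsmul_eq_mul, mul_comm]
    have h4 : (b + a) ^ 2 ≤ 4 * ENNReal.ofReal t := by
      calc (b + a) ^ 2 ≤ (max a b + max a b) ^ 2 := by
            gcongr
            · exact le_max_right _ _
            · exact le_max_left _ _
        _ = 4 * (max a b) ^ 2 := by ring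
        _ ≤ 4 * ENNReal.ofReal t := by
          gcongr
          rcases max_cases a b with h | h <;> rw [h.1] <;> assumption
    have h5 : ENNReal.ofReal (δ ^ 2 * (symmDiff ω ω₀).card) ≤ ENNReal.ofReal (δ ^ 2 * m / 8) := by
      rw [← hsq]
      refine (pow_le_pow_left' htri 2).trans (h4.trans ?_)
      rw [show (4 : ℝ≥0∞) = ENNReal.ofReal 4 by simp, ← ENNReal.ofReal_mul (by norm_num)]
      exact ENNReal.ofReal_le_ofReal (by linarith)
    rw [ENNReal.ofReal_le_ofReal_iff (by positivity)] at h5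
    have h6 : δ ^ 2 * (8 * (symmDiff ω ω₀).card : ℝ) ≤ δ ^ 2 * m := by linarith
    have h7 := le_of_mul_le_mul_left h6 (by positivity)
    exact_mod_cast h7
  have hV : ∀ D, ∑ ω ∈ F.powerset, (A' ω).indicator (fun _ => (1 : ℝ≥0∞)) D ≤
      ENNReal.ofReal ((3 / 2) ^ m) := by
    intro D
    by_cases hex : ∃ ω₀ ∈ F.powerset, D ∈ A' ω₀
    · obtain ⟨ω₀, hω₀, hD₀⟩ := hex
      have hcard := card_hammingBall_le F ω₀ (Finset.mem_powerset.1 hω₀)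
      calc ∑ ω ∈ F.powerset, (A' ω).indicator (fun _ => (1 : ℝ≥0∞)) D
          = (({ω ∈ F.powerset | D ∈ A' ω} : Finset _).card : ℝ≥0∞) := by
            rw [← Finset.sum_boole]
            exact Finset.sum_congr rfl fun ω _ => by simp [Set.indicator_apply]
        _ ≤ (({ω ∈ F.powerset | 8 * (symmDiff ω ω₀).card ≤ m} : Finset _).card : ℝ≥0∞) := by
            gcongr with ω hω
            intro hD
            exact hdist ω ω₀ (Finset.mem_powerset.1 hω) (Finset.mem_powerset.1 hω₀) D hD hD₀
        _ ≤ _ := by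
            rw [← ENNReal.ofReal_natCast]
            exact ENNReal.ofReal_le_ofReal hcard
    · push Not at hex
      rw [Finset.sum_eq_zero fun ω hω => Set.indicator_of_notMem (hex ω hω) _]
      exact zero_le
  have hE : ∀ ω ∈ F.powerset, ∫⁻ D, (∏ i, ρ ω (D i)) ^ 2 ∂Q ≤
      ENNReal.ofReal ((17 / 16) ^ m) := by
    intro ω _
    set r := ∑ i ∈ F, δ ^ 2 * (spectralSystem H (ν : Measure X)).eig i ^ γ
    have hr0 : 0 ≤ r := Finset.sum_nonneg fun i _ => by
      have := Real.rpow_nonneg (hpos i).le γ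
      positivity
    have hr : ∫⁻ x, ENNReal.ofReal (truncation K (f ω) x ^ 2) ∂(ν : Measure X) ≤
        ENNReal.ofReal r := by
      calc _ = ∫⁻ x, ENNReal.ofReal (f ω x ^ 2) ∂(ν : Measure X) := by
            refine lintegral_congr_ae ?_
            filter_upwards [hfK ω] with x hx
            rw [truncation_eq hx]
        _ ≤ _ := by
            rw [lintegral_ofReal_sq, norm_rkhsEmbedding_sum_fn_sq]
            exact ENNReal.ofReal_le_ofReal (Finset.sum_le_sum fun i _ => hw ω i)
    simp only [← Finset.prod_pow]
    rw [lintegral_pi_prod P₀ (fun _ z => ρ ω z ^ 2) fun _ => (hρ ω).pow_const 2]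
    rw [Finset.prod_const, Finset.card_univ, Fintype.card_fin]
    have h1 := lintegral_twoPointDensity_sq_le (ν : Measure X) hK
      (measurable_truncation (K := K) (rkhs_measurable (f ω))) (abs_truncation_le hK (f ω)) hr0 hr
    refine (pow_le_pow_left' h1 n).trans ?_
    rw [← ENNReal.ofReal_pow (Real.exp_pos _).le]
    refine ENNReal.ofReal_le_ofReal ?_
    rw [← Real.exp_nat_mul, ← mul_div_assoc]
    refine (Real.exp_le_exp.2 hδn).trans ?_
    -- Invert exp(-1/17) ≥ 1 - 1/17 = 16/17.
    have h2 : Real.exp (1 / 17) ≤ 17 / 16 := by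
      have h3 := Real.add_one_le_exp (-(1 / 17 : ℝ))
      rw [Real.exp_neg] at h3
      have h4 := inv_anti₀ (by norm_num) h3
      rw [inv_inv] at h4
      refine h4.trans (by norm_num)
    rw [show (m : ℝ) / 17 = m * (1 / 17) by ring, Real.exp_nat_mul]
    exact pow_le_pow_left₀ (Real.exp_pos _).le h2 m
  -- With θ = (8/9)^m, the two terms, divided by the 2^m hypotheses, have bases (8/9)(17/16) = 17/18
  -- and (3/2)(9/8)/2 = 27/32, both below 1.
  have hsum := sum_withDensity_le Q F.powerset (fun ω D => ∏ i, ρ ω (D i))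
    (fun ω _ => Finset.measurable_fun_prod _ fun i _ => (hρ ω).comp (measurable_pi_apply i)) A'
    (fun ω _ => nullMeasurableSet_powerNorm_le hf (hPmem ω) _ Q) _ _
    (ENNReal.ofReal ((8 / 9) ^ m)) hV hE
    (by simp only [ne_eq, ENNReal.ofReal_eq_zero, not_le]; positivity) ENNReal.ofReal_ne_top
  set η := ENNReal.ofReal ((17 / 18) ^ m + (27 / 32) ^ m) with hη
  obtain ⟨ω, hω⟩ : ∃ ω, Measure.pi (fun _ : Fin n => (P ω : Measure (X × ℝ))) (A' ω) ≤ η := by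
    by_contra! hcon
    have h1 := ENNReal.sum_lt_sum_of_nonempty (s := F.powerset) ⟨∅, by simp⟩
      (f := fun _ => η) (fun ω _ => hcon ω)
    simp only [hPQ] at h1
    refine absurd (h1.trans_le hsum) (not_lt.2 (le_of_eq ?_))
    rw [Finset.sum_const, Finset.card_powerset, ← hm, nsmul_eq_mul, ← ENNReal.ofReal_natCast, hη,
      ← ENNReal.ofReal_mul (by positivity), ← ENNReal.ofReal_mul (by positivity),
      ← ENNReal.ofReal_div_of_pos (by positivity), ← ENNReal.ofReal_mul (by positivity),
      ← ENNReal.ofReal_add (by positivity) (by positivity)]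
    congr 1
    push_cast
    rw [← div_pow, ← mul_pow, ← mul_pow, mul_add, ← mul_pow, ← mul_pow]
    norm_num
  refine le_trans ?_ (le_iSup₂ (P ω) (hPmem ω))
  have hcompl : {D | ENNReal.ofReal t < powerNorm H (marginal (P ω) : Measure X) γ
      (fun x => fhat D x - condMean (P ω) x) ^ 2} = (A' ω)ᶜ := by
    ext D
    simp [A']
  rw [errorProb, hcompl, tsub_le_iff_right]
  -- Subadditivity is enough to pass from the success event to its complement, so no measurability
  -- under P^n is needed here.
  calc (1 : ℝ≥0∞) = Measure.pi (fun _ : Fin n => (P ω : Measure (X × ℝ))) Set.univ := by simp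
    _ = Measure.pi (fun _ : Fin n => (P ω : Measure (X × ℝ))) ((A' ω)ᶜ ∪ A' ω) := by
      rw [Set.compl_union_self]
    _ ≤ _ := (measure_union_le _ _).trans (by gcongr)

end LowerBound

/-! ### The minimax lower rate -/

/-- For γ ≤ s the power is decreasing in t and the lower eigenvalue bound gives the claim. For s ≤ γ
it is bounded by a constant while the power of m is at least 1; this covers α < γ. -/
theorem exists_rpow_sub_le {c C γ s a q : ℝ} (hc : 0 < c) (hC : 0 < C) (hq : 0 < q) (hs : s ≤ a)
    (hγ : γ ≤ a) : ∃ W : ℝ, 0 < W ∧ ∀ m : ℕ, 1 ≤ m → ∀ t : ℝ,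
      c * (2 * (m : ℝ)) ^ (-1 / q) ≤ t → t ≤ C → t ^ (γ - s) ≤ W * (m : ℝ) ^ ((a - γ) / q) := by
  rcases le_total γ s with h | h
  · refine ⟨c ^ (γ - s) * 2 ^ ((s - γ) / q), by positivity, fun m hm t ht _ => ?_⟩
    have hm' : (1 : ℝ) ≤ m := by exact_mod_cast hm
    calc t ^ (γ - s) ≤ (c * (2 * (m : ℝ)) ^ (-1 / q)) ^ (γ - s) :=
          Real.rpow_le_rpow_of_nonpos (by positivity) ht (by linarith)
      _ = c ^ (γ - s) * 2 ^ ((s - γ) / q) * (m : ℝ) ^ ((s - γ) / q) := by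
          rw [Real.mul_rpow hc.le (by positivity), ← Real.rpow_mul (by positivity), mul_assoc,
            ← Real.mul_rpow (by norm_num) (by positivity)]
          congr 2
          ring
      _ ≤ _ := by gcongr
  · refine ⟨C ^ (γ - s), by positivity, fun m hm t ht htC => ?_⟩
    have hm' : (1 : ℝ) ≤ m := by exact_mod_cast hm
    have ht0 : 0 < t := lt_of_lt_of_le (by positivity) ht
    calc t ^ (γ - s) ≤ C ^ (γ - s) := Real.rpow_le_rpow ht0.le htC (by linarith)
      _ ≤ _ := le_mul_of_one_le_right (by positivity)
        (Real.one_le_rpow hm' (div_nonneg (by linarith) hq.le))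

/-- The zero-based positions m, …, 2m - 1 have one-based indices between m and 2m, so both
eigenvalue bounds are uniform on the block. An infinite lower set of ℕ contains every position. -/
theorem exists_block {X : Type*} [MeasurableSpace X] {H : Type*} [NormedAddCommGroup H]
    [InnerProductSpace ℝ H] [CompleteSpace H] [RKHS ℝ H X ℝ] [MeasurableBoundedKernel H]
    {α p q A C c : ℝ} (hq : 0 < q) (hp : 0 < p) (hC : 0 < C) (hc : 0 < c)
    {ν : ProbabilityMeasure X} (hν : ν ∈ marginalClassLB H α p q A C c)
    (hinf : (spectralSystem H (ν : Measure X)).idx.Infinite) {m : ℕ} (hm : 1 ≤ m) :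
    ∃ F : Finset (spectralSystem H (ν : Measure X)).idx, F.card = m ∧ ∀ i ∈ F,
      c * (2 * (m : ℝ)) ^ (-1 / q) ≤ (spectralSystem H (ν : Measure X)).eig i ∧
      (spectralSystem H (ν : Measure X)).eig i ≤ C * (m : ℝ) ^ (-1 / p) := by
  have huniv : ∀ k, k ∈ (spectralSystem H (ν : Measure X)).idx := by
    intro k
    obtain ⟨j, hj, hkj⟩ := hinf.exists_gt k
    exact (spectralSystem H (ν : Measure X)).isLowerSet_idx hkj.le hj
  refine ⟨(Finset.Ico m (2 * m)).map ⟨fun k => ⟨k, huniv k⟩, fun a b h => congrArg Subtype.val h⟩,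
    by simp; omega, ?_⟩
  intro i hi
  rw [Finset.mem_map] at hi
  obtain ⟨k, hk, rfl⟩ := hi
  rw [Finset.mem_Ico] at hk
  have hm' : (0 : ℝ) < m := by exact_mod_cast hm
  have h1 : (m : ℝ) ≤ (k : ℝ) + 1 := by
    have : m ≤ k + 1 := by omega
    exact_mod_cast this
  have h2 : (k : ℝ) + 1 ≤ 2 * m := by
    have : k + 1 ≤ 2 * m := by omega
    exact_mod_cast this
  have hneg : ∀ s : ℝ, 0 < s → -1 / s ≤ 0 := fun s hs =>
    div_nonpos_of_nonpos_of_nonneg (by norm_num) hs.le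
  refine ⟨le_trans ?_ (hν.2 ⟨k, huniv k⟩), (hν.1.2.2 ⟨k, huniv k⟩).trans ?_⟩
  · exact mul_le_mul_of_nonneg_left
      (Real.rpow_le_rpow_of_nonpos (by positivity) h2 (hneg q hq)) hc.le
  · exact mul_le_mul_of_nonneg_left
      (Real.rpow_le_rpow_of_nonpos (by positivity) h1 (hneg p hp)) hC.le

/-- Balancing the constraints of `le_iSup_errorProb`: the first two allow m δ² = κ m^(-(a-γ)/q), the
third then asks for n ≤ m^(d/q), and m = ⌈n^(q/d)⌉ is the least such block size. The separation m δ²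
is of the order of the claimed rate. -/
theorem minimax_lower_rate {X : Type*} [MeasurableSpace X] (H : Type*) [NormedAddCommGroup H]
    [InnerProductSpace ℝ H] [CompleteSpace H] [RKHS ℝ H X ℝ]
    [MeasurableBoundedKernel H]
    (α β γ p q A C c B Binf L σ : ℝ)
    (hq : 0 < q) (hqp : q ≤ p) (hγ0 : 0 ≤ γ) (hγβ : γ < β)
    (hA : 0 < A) (hC : 0 < C) (hc : 0 < c) (hB : 0 < B) (hBinf : 0 < Binf)
    (hL : 0 < L) (hσ : 0 < σ)
    (hne : ∃ ν ∈ marginalClassLB H α p q A C c,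
      (spectralSystem H (ν : Measure X)).idx.Infinite) :
    Tendsto (fun τ : ℝ => liminf (fun n : ℕ =>
        ⨅ fhat ∈ learningMethods H γ
            (jointClass H β B Binf L σ (marginalClassLB H α p q A C c)) n,
          ⨆ P ∈ jointClass H β B Binf L σ (marginalClassLB H α p q A C c),
            errorProb H γ fhat P
              (τ * (1 / (n : ℝ)) ^ ((max α β - γ) / (max α β + q - γ * (1 - q / p))))) atTop)
      (𝓝[>] 0) (𝓝 1) := by
  obtain ⟨ν, hν, hinf⟩ := hne
  have hp : 0 < p := hq.trans_le hqp
  set a := max α β with ha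
  have hβa : β ≤ a := le_max_right _ _
  have hαa : α ≤ a := le_max_left _ _
  have hγa : γ < a := hγβ.trans_le hβa
  set d := a + q - γ * (1 - q / p) with hd
  have hd0 : 0 < d := by
    have h1 : 0 ≤ γ * (q / p) := by positivity
    rw [hd]; linarith
  obtain ⟨Wβ, hWβ0, hWβ⟩ := exists_rpow_sub_le (γ := γ) hc hC hq hβa hγa.le
  obtain ⟨Wα, hWα0, hWα⟩ := exists_rpow_sub_le (γ := γ) hc hC hq hαa hγa.le
  -- The largest noise level compatible with the moment condition and the sup-norm bound.
  set K := min (min σ (L / 2)) √Binf with hKdef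
  have hK : 0 < K := lt_min (lt_min hσ (by linarith)) (Real.sqrt_pos.2 hBinf)
  have hKσ : K ≤ σ := (min_le_left _ _).trans (min_le_left _ _)
  have hKL : 2 * K ≤ L := by
    have : K ≤ L / 2 := (min_le_left _ _).trans (min_le_right _ _)
    linarith
  have hKB : K ^ 2 ≤ Binf := by
    rw [← Real.sq_sqrt hBinf.le]
    exact pow_le_pow_left₀ hK.le (min_le_right _ _) 2
  -- The three terms serve the source condition, the bound |f_ω| ≤ K and the information bound, in
  -- this order.
  set κ := min (min (B / Wβ) (K ^ 2 / (A ^ 2 * Wα))) (K ^ 2 / (17 * C ^ γ)) with hκdef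
  have hκ : 0 < κ := lt_min (lt_min (by positivity) (by positivity)) (by positivity)
  have hκ1 : κ * Wβ ≤ B := by
    rw [← le_div_iff₀ hWβ0]
    exact (min_le_left _ _).trans (min_le_left _ _)
  have hκ2 : κ * (A ^ 2 * Wα) ≤ K ^ 2 := by
    rw [← le_div_iff₀ (by positivity)]
    exact (min_le_left _ _).trans (min_le_right _ _)
  have hκ3 : κ * (17 * C ^ γ) ≤ K ^ 2 := by
    rw [← le_div_iff₀ (by positivity)]
    exact min_le_right _ _
  let m : ℕ → ℕ := fun n => ⌈(n : ℝ) ^ (q / d)⌉₊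
  have hmtop : Tendsto m atTop atTop :=
    tendsto_nat_ceil_atTop.comp
      ((tendsto_rpow_atTop (by positivity)).comp tendsto_natCast_atTop_atTop)
  set val : ℝ → ℕ → ℝ≥0∞ := fun τ n =>
    ⨅ fhat ∈ learningMethods H γ
        (jointClass H β B Binf L σ (marginalClassLB H α p q A C c)) n,
      ⨆ P ∈ jointClass H β B Binf L σ (marginalClassLB H α p q A C c),
        errorProb H γ fhat P (τ * (1 / (n : ℝ)) ^ ((a - γ) / d)) with hval
  -- The zero estimator is a learning method, so the infimum is not over an empty family, where it
  -- would be ∞.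
  have hle : ∀ τ n, val τ n ≤ 1 := by
    intro τ n
    refine (iInf₂_le (fun _ => ((0 : H) : X → ℝ)) ?_).trans (iSup₂_le fun P _ => prob_le_one)
    exact ⟨fun _ => rkhs_measurable (0 : H), fun P _ => measurable_const⟩
  have hlow : ∀ τ, 0 < τ → τ ≤ κ * 2 ^ (-((a - γ) / q)) / 32 → ∀ n : ℕ, 1 ≤ n →
      1 - ENNReal.ofReal ((17 / 18) ^ m n + (27 / 32) ^ m n) ≤ val τ n := by
    intro τ hτ hτ0 n hn
    have hn1 : (1 : ℝ) ≤ n := by exact_mod_cast hn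
    have hn0 : (0 : ℝ) < n := by linarith
    have hx1 : 1 ≤ (n : ℝ) ^ (q / d) := Real.one_le_rpow hn1 (by positivity)
    have hmx : (n : ℝ) ^ (q / d) ≤ m n := Nat.le_ceil _
    have hmx2 : (m n : ℝ) ≤ 2 * (n : ℝ) ^ (q / d) := by
      have := (Nat.ceil_lt_add_one (by positivity : 0 ≤ (n : ℝ) ^ (q / d))).le
      have h2 : (m n : ℝ) ≤ (n : ℝ) ^ (q / d) + 1 := this
      linarith
    have hm1 : (1 : ℝ) ≤ m n := hx1.trans hmx
    have hm0 : (0 : ℝ) < m n := by linarith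
    have hmnat : 1 ≤ m n := by exact_mod_cast hm1
    obtain ⟨F, hFcard, hF⟩ := exists_block hq hp hC hc hν hinf hmnat
    have hFC : ∀ i ∈ F, (spectralSystem H (ν : Measure X)).eig i ≤ C := fun i hi => by
      refine (hF i hi).2.trans (mul_le_of_le_one_right hC.le ?_)
      exact Real.rpow_le_one_of_one_le_of_nonpos hm1
        (div_nonpos_of_nonpos_of_nonneg (by norm_num) hp.le)
    set δ := √(κ * (m n : ℝ) ^ (-((a - γ) / q)) / m n) with hδdef
    have hδ0 : 0 < δ := Real.sqrt_pos.2 (by positivity)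
    have hδ2 : (m n : ℝ) * δ ^ 2 = κ * (m n : ℝ) ^ (-((a - γ) / q)) := by
      rw [hδdef, Real.sq_sqrt (by positivity)]
      field_simp
    have hcancel : (m n : ℝ) ^ (-((a - γ) / q)) * (m n : ℝ) ^ ((a - γ) / q) = 1 := by
      rw [← Real.rpow_add hm0]; simp
    have hsum : ∀ (s W : ℝ), (∀ i ∈ F, (spectralSystem H (ν : Measure X)).eig i ^ s ≤ W) →
        ∑ i ∈ F, δ ^ 2 * (spectralSystem H (ν : Measure X)).eig i ^ s ≤
          κ * (m n : ℝ) ^ (-((a - γ) / q)) * W := by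
      intro s W hW
      calc _ ≤ ∑ i ∈ F, δ ^ 2 * W := Finset.sum_le_sum fun i hi => by gcongr; exact hW i hi
        _ = _ := by rw [Finset.sum_const, hFcard, nsmul_eq_mul, ← mul_assoc, hδ2]
    rw [← hFcard]
    refine le_iInf₂ fun fhat hfhat => ?_
    refine le_iSup_errorProb hν hA hK hKσ hKL hKB hν.1.2.1 F n ?_ ?_ ?_ hδ0 ?_ hfhat
    · refine (hsum (γ - β) _ fun i hi => hWβ (m n) hmnat _ (hF i hi).1 (hFC i hi)).trans ?_
      calc _ = κ * Wβ * ((m n : ℝ) ^ (-((a - γ) / q)) * (m n : ℝ) ^ ((a - γ) / q)) := by ring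
        _ ≤ B := by rw [hcancel, mul_one]; exact hκ1
    · refine (mul_le_mul_of_nonneg_left
        (hsum (γ - α) _ fun i hi => hWα (m n) hmnat _ (hF i hi).1 (hFC i hi))
        (by positivity)).trans ?_
      calc _ = κ * (A ^ 2 * Wα) * ((m n : ℝ) ^ (-((a - γ) / q)) * (m n : ℝ) ^ ((a - γ) / q)) := by
            ring
        _ ≤ K ^ 2 := by rw [hcancel, mul_one]; exact hκ2
    · have h1 : ∀ i ∈ F, (spectralSystem H (ν : Measure X)).eig i ^ γ ≤
          C ^ γ * (m n : ℝ) ^ (-(γ / p)) := by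
        intro i hi
        refine (Real.rpow_le_rpow ((spectralSystem H (ν : Measure X)).eig_pos i).le (hF i hi).2
          hγ0).trans (le_of_eq ?_)
        rw [Real.mul_rpow hC.le (by positivity), ← Real.rpow_mul hm0.le]
        congr 2
        ring
      have h2 := hsum γ _ h1
      -- The exponent d is determined by d/q = 1 + (a-γ)/q + γ/p; the term γ/p comes from the upper
      -- eigenvalue bound in the L₂-norm of f_ω.
      have h3 : (n : ℝ) * ((m n : ℝ) ^ (-((a - γ) / q)) * (m n : ℝ) ^ (-(γ / p))) ≤ m n := by
        have h4 : (n : ℝ) ≤ (m n : ℝ) ^ (d / q) := by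
          calc (n : ℝ) = ((n : ℝ) ^ (q / d)) ^ (d / q) := by
                rw [← Real.rpow_mul hn0.le]
                have : q / d * (d / q) = 1 := by field_simp
                rw [this, Real.rpow_one]
            _ ≤ _ := Real.rpow_le_rpow (by positivity) hmx (by positivity)
        calc _ ≤ (m n : ℝ) ^ (d / q) * ((m n : ℝ) ^ (-((a - γ) / q)) * (m n : ℝ) ^ (-(γ / p))) := by
              gcongr
          _ = m n := by
              rw [← Real.rpow_add hm0, ← Real.rpow_add hm0]
              have : d / q + (-((a - γ) / q) + -(γ / p)) = 1 := by
                rw [hd]; field_simp; ring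
              rw [this, Real.rpow_one]
      rw [hFcard, div_le_iff₀ (by positivity)]
      calc _ ≤ (n : ℝ) * (κ * (m n : ℝ) ^ (-((a - γ) / q)) *
            (C ^ γ * (m n : ℝ) ^ (-(γ / p)))) := by gcongr
        _ = (n : ℝ) * ((m n : ℝ) ^ (-((a - γ) / q)) * (m n : ℝ) ^ (-(γ / p))) *
            (κ * (17 * C ^ γ)) / 17 := by ring
        _ ≤ m n * K ^ 2 / 17 := by gcongr
        _ = _ := by ring
    · rw [hFcard, mul_comm (δ ^ 2), hδ2]
      have h1 : (2 : ℝ) ^ (-((a - γ) / q)) * (1 / (n : ℝ)) ^ ((a - γ) / d) ≤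
          (m n : ℝ) ^ (-((a - γ) / q)) := by
        have h2 : (1 / (n : ℝ)) ^ ((a - γ) / d) = ((n : ℝ) ^ (q / d)) ^ (-((a - γ) / q)) := by
          rw [one_div, Real.inv_rpow hn0.le, ← Real.rpow_neg hn0.le, ← Real.rpow_mul hn0.le]
          congr 1
          field_simp
        rw [h2, ← Real.mul_rpow (by norm_num) (by positivity)]
        exact Real.rpow_le_rpow_of_nonpos hm0 hmx2
          (neg_nonpos.2 (div_nonneg (by linarith) hq.le))
      calc 32 * (τ * (1 / (n : ℝ)) ^ ((a - γ) / d))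
          ≤ 32 * (κ * 2 ^ (-((a - γ) / q)) / 32 * (1 / (n : ℝ)) ^ ((a - γ) / d)) := by gcongr
        _ = κ * ((2 : ℝ) ^ (-((a - γ) / q)) * (1 / (n : ℝ)) ^ ((a - γ) / d)) := by ring
        _ ≤ _ := by gcongr
  -- Below a positive threshold for τ, the lower limit is already equal to 1.
  refine tendsto_const_nhds.congr' ?_
  have hτ0 : 0 < κ * 2 ^ (-((a - γ) / q)) / 32 := by positivity
  filter_upwards [Ioc_mem_nhdsGT hτ0] with τ hτ
  have hlim : Tendsto (val τ) atTop (𝓝 1) := by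
    refine tendsto_of_tendsto_of_tendsto_of_le_of_le' (g := fun n =>
      1 - ENNReal.ofReal ((17 / 18) ^ m n + (27 / 32) ^ m n)) ?_ tendsto_const_nhds ?_
      (Eventually.of_forall (hle τ))
    · have h1 : Tendsto (fun k : ℕ => ((17 : ℝ) / 18) ^ k + (27 / 32) ^ k) atTop (𝓝 (0 + 0)) :=
        (tendsto_pow_atTop_nhds_zero_of_lt_one (by norm_num) (by norm_num)).add
          (tendsto_pow_atTop_nhds_zero_of_lt_one (by norm_num) (by norm_num))
      have h2 := ENNReal.tendsto_ofReal (h1.comp hmtop)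
      have h3 := ENNReal.Tendsto.sub (tendsto_const_nhds (x := (1 : ℝ≥0∞))) h2 (by simp)
      simpa using h3
    · filter_upwards [eventually_ge_atTop 1] with n hn using hlow τ hτ.1 hτ.2 n hn
  exact hlim.liminf_eq.symm

/-! ### Real inequalities for spectral filters -/

/-- Weighted arithmetic-geometric mean: μ^θ reg^(1-θ) ≤ μ + reg. -/
theorem mul_rpow_le_rpow_mul_add {μ reg θ : ℝ} (hμ : 0 < μ) (hreg : 0 < reg) (h0 : 0 ≤ θ)
    (h1 : θ ≤ 1) : reg * μ ^ θ ≤ reg ^ θ * (μ + reg) := by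
  have h := Real.geom_mean_le_arith_mean2_weighted h0 (sub_nonneg.2 h1) hμ.le hreg.le (by ring)
  have h2 : μ ^ θ * reg ^ (1 - θ) ≤ μ + reg := h.trans (by nlinarith)
  calc reg * μ ^ θ = reg ^ θ * (μ ^ θ * reg ^ (1 - θ)) := by
        rw [mul_comm (μ ^ θ), ← mul_assoc, ← Real.rpow_add hreg]
        simp
    _ ≤ _ := by gcongr

/-- The preceding inequality with μ and reg exchanged, divided by (μ reg)^θ. It converts the (μ +
reg)-weighted sum into a γ-norm at the price reg^(-γ). -/
theorem rpow_one_sub_le {μ reg θ : ℝ} (hμ : 0 < μ) (hreg : 0 < reg) (h0 : 0 ≤ θ)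
    (h1 : θ ≤ 1) : μ ^ (1 - θ) ≤ reg ^ (-θ) * (μ + reg) := by
  have h := mul_rpow_le_rpow_mul_add hreg hμ h0 h1
  have h2 : μ ^ (1 - θ) = μ * reg ^ θ * reg ^ (-θ) * μ ^ (-θ) := by
    rw [mul_assoc μ, ← Real.rpow_add hreg, sub_eq_add_neg, Real.rpow_add hμ]
    simp
  calc μ ^ (1 - θ) = μ * reg ^ θ * (reg ^ (-θ) * μ ^ (-θ)) := by rw [h2]; ring
    _ ≤ μ ^ θ * (reg + μ) * (reg ^ (-θ) * μ ^ (-θ)) := by gcongr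
    _ = (μ ^ θ * μ ^ (-θ)) * (reg ^ (-θ) * (μ + reg)) := by ring
    _ = _ := by rw [← Real.rpow_add hμ]; simp

/-- Square `mul_rpow_le_rpow_mul_add` at θ = s/2. The restriction s ≤ 2 is the saturation of
Tikhonov regularization. -/
theorem filter_sq_mul_rpow_le {μ reg s : ℝ} (hμ : 0 < μ) (hreg : 0 < reg) (h0 : 0 ≤ s)
    (h2 : s ≤ 2) : (reg / (μ + reg)) ^ 2 * μ ^ s ≤ reg ^ s := by
  have h := mul_rpow_le_rpow_mul_add hμ hreg (θ := s / 2) (by linarith) (by linarith)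
  have hsq : ∀ t : ℝ, 0 < t → (t ^ (s / 2)) ^ 2 = t ^ s := fun t ht => by
    rw [← Real.rpow_natCast, ← Real.rpow_mul ht.le]; simp
  rw [div_pow, div_mul_eq_mul_div, div_le_iff₀ (by positivity), ← hsq μ hμ, ← hsq reg hreg,
    ← mul_pow, ← mul_pow]
  exact pow_le_pow_left₀ (by positivity) h 2

/-- Each term is at most min(1, t (k+1)^(-1/p)) with t = C/reg. Split the indices into blocks of
length M ≈ t^p: in block 0 use the bound 1, and in block a ≥ 1 use t (aM)^(-1/p) ≤ a^(-1/p), which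
is summable as p < 1. The total is a multiple of M, and reg ≤ Λ absorbs the rounding of M into
reg^(-p). -/
theorem exists_tsum_filter_le {p C Λ : ℝ} (hp : 0 < p) (hp1 : p < 1) (hC : 0 < C) (hΛ : 0 < Λ) :
    ∃ D : ℝ, 0 < D ∧ ∀ reg, 0 < reg → reg ≤ Λ → ∀ (I : Set ℕ) (μ : I → ℝ), (∀ i, 0 < μ i) →
      (∀ i, μ i ≤ C * (((i : ℕ) : ℝ) + 1) ^ (-1 / p)) →
      ∑' i, ENNReal.ofReal (μ i / (μ i + reg)) ≤ ENNReal.ofReal (D * reg ^ (-p)) := by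
  set s := 1 / p with hs
  have hs1 : 1 < s := (one_lt_div hp).2 hp1
  let h : ℕ → ℝ := fun a => (if a = 0 then 1 else 0) + (a : ℝ) ^ (-s)
  have hh0 : ∀ a, 0 ≤ h a := fun a => add_nonneg (by split_ifs <;> norm_num) (by positivity)
  have hh : Summable h := by
    refine Summable.add ?_ (Real.summable_nat_rpow.2 (by linarith))
    exact summable_of_ne_finset_zero (s := {0}) fun b hb => by simpa using hb
  have hZ : 0 < ∑' a, h a := by
    refine hh.tsum_pos hh0 0 ?_
    have : (0 : ℝ) ≤ ((0 : ℕ) : ℝ) ^ (-s) := by positivity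
    simp only [h, if_true]
    linarith
  refine ⟨(C ^ p + 2 * Λ ^ p) * ∑' a, h a, by positivity, fun reg hreg hregΛ I μ hμ0 hμ => ?_⟩
  set t := C / reg with ht
  have ht0 : 0 < t := by positivity
  set M := ⌈t ^ p⌉₊ + 1 with hM
  have hMt : t ^ p ≤ M := by
    rw [hM]; push_cast
    exact (Nat.le_ceil _).trans (by linarith)
  have hM0 : (0 : ℝ) < M := by rw [hM]; positivity
  have hMs : t ≤ (M : ℝ) ^ s := by
    calc t = (t ^ p) ^ s := by
          rw [← Real.rpow_mul ht0.le, hs, mul_one_div_cancel hp.ne', Real.rpow_one]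
      _ ≤ _ := Real.rpow_le_rpow (by positivity) hMt (by linarith)
  let g : ℕ → ℝ≥0∞ := fun k => ENNReal.ofReal (min 1 (t * ((k : ℝ) + 1) ^ (-s)))
  have h1 : ∑' i, ENNReal.ofReal (μ i / (μ i + reg)) ≤ ∑' k, g k := by
    refine le_trans (ENNReal.tsum_le_tsum fun i => ?_)
      (ENNReal.tsum_comp_le_tsum_of_injective Subtype.val_injective g)
    refine ENNReal.ofReal_le_ofReal (le_min ?_ ?_)
    · exact (div_le_one (by have := hμ0 i; linarith)).2 (by linarith)
    · calc μ i / (μ i + reg) ≤ μ i / reg :=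
            div_le_div_of_nonneg_left (hμ0 i).le hreg (by have := hμ0 i; linarith)
        _ ≤ C * (((i : ℕ) : ℝ) + 1) ^ (-1 / p) / reg := by gcongr; exact hμ i
        _ = _ := by rw [ht, hs, neg_div]; ring
  have h2 : ∑' k, g k ≤ ∑' a : ℕ, (M : ℝ≥0∞) * ENNReal.ofReal (h a) := by
    have hne : NeZero M := ⟨by omega⟩
    rw [← (Nat.divModEquiv M).symm.tsum_eq g, ENNReal.tsum_prod']
    refine ENNReal.tsum_le_tsum fun a => ?_
    rw [tsum_fintype]
    calc _ ≤ ∑ _r : Fin M, ENNReal.ofReal (h a) := by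
          refine Finset.sum_le_sum fun r _ => ENNReal.ofReal_le_ofReal ?_
          rcases Nat.eq_zero_or_pos a with ha | ha
          · refine (min_le_left _ _).trans ?_
            have : (0 : ℝ) ≤ (a : ℝ) ^ (-s) := by positivity
            simp only [h, ha, if_true] at this ⊢
            linarith
          · refine (min_le_right _ _).trans ?_
            simp only [h, ha.ne', if_false, zero_add]
            have ha' : (0 : ℝ) < a := by exact_mod_cast ha
            have hle : (a : ℝ) * M ≤ (((Nat.divModEquiv M).symm (a, r) : ℕ) : ℝ) + 1 := by
              simp only [Nat.divModEquiv_symm_apply]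
              push_cast
              have : (0 : ℝ) ≤ ((r : ℕ) : ℝ) := by positivity
              linarith
            calc _ ≤ t * ((a : ℝ) * M) ^ (-s) :=
                  mul_le_mul_of_nonneg_left
                    (Real.rpow_le_rpow_of_nonpos (by positivity) hle (by linarith)) ht0.le
              _ = t * (M : ℝ) ^ (-s) * (a : ℝ) ^ (-s) := by
                  rw [Real.mul_rpow ha'.le hM0.le]; ring
              _ ≤ (M : ℝ) ^ s * (M : ℝ) ^ (-s) * (a : ℝ) ^ (-s) := by gcongr
              _ = _ := by rw [← Real.rpow_add hM0]; simp
      _ = _ := by simp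
  refine (h1.trans h2).trans ?_
  rw [ENNReal.tsum_mul_left, ← ENNReal.ofReal_tsum_of_nonneg hh0 hh, ← ENNReal.ofReal_natCast,
    ← ENNReal.ofReal_mul hM0.le]
  refine ENNReal.ofReal_le_ofReal ?_
  have h3 : (M : ℝ) ≤ t ^ p + 2 := by
    have := (Nat.ceil_lt_add_one (by positivity : 0 ≤ t ^ p)).le
    rw [hM]; push_cast; linarith
  have h4 : t ^ p + 2 ≤ (C ^ p + 2 * Λ ^ p) * reg ^ (-p) := by
    have h5 : t ^ p = C ^ p * reg ^ (-p) := by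
      rw [ht, Real.div_rpow hC.le hreg.le, Real.rpow_neg hreg.le, div_eq_mul_inv]
    have h6 : 1 ≤ Λ ^ p * reg ^ (-p) := by
      rw [Real.rpow_neg hreg.le, ← div_eq_mul_inv, one_le_div (by positivity)]
      exact Real.rpow_le_rpow hreg.le hregΛ hp.le
    rw [h5]; linarith
  calc _ ≤ (C ^ p + 2 * Λ ^ p) * reg ^ (-p) * ∑' a, h a := by gcongr; linarith
    _ = _ := by ring

/-! ### Almost sure properties of points -/

section Points

variable {X : Type*} {H : Type*} [NormedAddCommGroup H]
  [InnerProductSpace ℝ H] [CompleteSpace H] [RKHS ℝ H X ℝ] [MeasurableSpace X]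
  [MeasurableBoundedKernel H] (ν : Measure X) [IsFiniteMeasure ν]

/-- Separability reduces the uncountable kernel of the embedding to a countable dense subset, and
continuity of evaluation extends the vanishing to the rest. -/
theorem ae_forall_apply_eq_zero [TopologicalSpace.SeparableSpace H] :
    ∀ᵐ x ∂ν, ∀ u : H, rkhsEmbedding H ν u = 0 → u x = 0 := by
  let N : Set H := {u | rkhsEmbedding H ν u = 0}
  obtain ⟨s, hs, hd⟩ := TopologicalSpace.exists_countable_dense N
  have := hs.to_subtype
  have h1 : ∀ᵐ x ∂ν, ∀ u : s, (u : N).1 x = 0 := by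
    refine ae_all_iff.2 fun u => ?_
    have h2 : rkhsEmbedding H ν (u : N).1 = 0 := (u : N).2
    filter_upwards [rkhsEmbedding_coeFn (ν := ν) (u : N).1, Lp.coeFn_zero ℝ 2 ν] with x hx hx0
    rw [← hx, h2, hx0, Pi.zero_apply]
  filter_upwards [h1] with x hx u hu
  have hcl : IsClosed {v : N | v.1 x = 0} :=
    isClosed_eq ((RKHS.continuous_eval x).comp continuous_subtype_val) continuous_const
  have h3 : closure s ⊆ {v : N | v.1 x = 0} :=
    hcl.closure_subset_iff.2 fun v hv => hx ⟨v, hv⟩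
  exact h3 (hd ⟨u, hu⟩)

/-- Evaluate the expansion modulo the kernel of the embedding at points where this kernel vanishes.
The null set does not depend on u, which matters because u will depend on the sample. -/
theorem ae_hasSum_apply [TopologicalSpace.SeparableSpace H] :
    ∀ᵐ x ∂ν, ∀ u : H, HasSum (fun i => ⟪(spectralSystem H ν).basis i, u⟫_ℝ *
      (spectralSystem H ν).basis i x) (u x) := by
  filter_upwards [ae_forall_apply_eq_zero (H := H) ν] with x hx u
  obtain ⟨u₀, h0, hu⟩ := (spectralSystem H ν).exists_hasSum_basis u
  have h1 := hu.mapL (innerSL ℝ (RKHS.kerFun H x (1 : ℝ)))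
  simp only [innerSL_apply_apply, ← rkhs_apply_eq_inner, RKHS.coe_sub, Pi.sub_apply, hx u₀ h0,
    sub_zero, RKHS.coe_smul, Pi.smul_apply, smul_eq_mul] at h1
  exact h1

/-- For fixed coefficients a, the function ∑ a_i μ_i^(α/2) e_i has α-norm |a| and is therefore
bounded by A |a| almost everywhere. Finitely supported rational coefficients leave one common null
set; outside it, density admits real coefficients, and duality gives the sum of squares. -/
theorem ae_tsum_eig_rpow_le {α A : ℝ} (hA : 0 < A)
    (hemb : ∀ f ∈ powerSpace H ν α,
      eLpNorm f ∞ ν ≤ ENNReal.ofReal A * powerNorm H ν α f) :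
    ∀ᵐ x ∂ν, ∑' i, ENNReal.ofReal ((spectralSystem H ν).eig i ^ α *
      (spectralSystem H ν).fn i x ^ 2) ≤ ENNReal.ofReal (A ^ 2) := by
  classical
  have hpos := fun i => (spectralSystem H ν).eig_pos i
  let v : (spectralSystem H ν).idx → X → ℝ := fun i x =>
    (spectralSystem H ν).eig i ^ (α / 2) * (spectralSystem H ν).fn i x
  have hsq : ∀ i, ((spectralSystem H ν).eig i ^ (α / 2)) ^ 2 = (spectralSystem H ν).eig i ^ α :=
    fun i => by rw [← Real.rpow_natCast, ← Real.rpow_mul (hpos i).le]; simp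
  have key : ∀ (F : Finset (spectralSystem H ν).idx) (a : F → ℚ), ∀ᵐ x ∂ν,
      (∑ i, (a i : ℝ) * v i x) ^ 2 ≤ A ^ 2 * ∑ i, (a i : ℝ) ^ 2 := by
    intro F a
    let w : (spectralSystem H ν).idx → ℝ := fun i =>
      if h : i ∈ F then a ⟨i, h⟩ * (spectralSystem H ν).eig i ^ (α / 2) else 0
    have hwF : ∀ i : F, w i = a i * (spectralSystem H ν).eig i ^ (α / 2) := fun i => by
      simp [w]
    set f : H := ∑ i ∈ F, w i • (spectralSystem H ν).fn i with hf
    have hnorm : powerNorm H ν α f ^ 2 = ENNReal.ofReal (∑ i, (a i : ℝ) ^ 2) := by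
      rw [powerNorm_sum_fn_sq, ← Finset.sum_coe_sort]
      congr 1
      refine Finset.sum_congr rfl fun i _ => ?_
      rw [hwF, mul_pow, hsq, mul_assoc, ← Real.rpow_add (hpos i)]
      simp
    have hfin : powerNorm H ν α f ≠ ∞ := by
      intro h
      rw [h] at hnorm
      simp at hnorm
    have h1 := hemb _ (coe_rkhsEmbedding_mem_powerSpace hfin)
    rw [eLpNorm_congr_ae (rkhsEmbedding_coeFn f), powerNorm_congr (rkhsEmbedding_coeFn f)] at h1
    have h2 : eLpNorm f ∞ ν ^ 2 ≤ ENNReal.ofReal ((A * √(∑ i, (a i : ℝ) ^ 2)) ^ 2) := by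
      calc _ ≤ (ENNReal.ofReal A * powerNorm H ν α f) ^ 2 := by gcongr
        _ = _ := by
          rw [mul_pow, hnorm, ← ENNReal.ofReal_pow hA.le, ← ENNReal.ofReal_mul (by positivity),
            mul_pow, Real.sq_sqrt (Finset.sum_nonneg fun i _ => sq_nonneg _)]
    filter_upwards [ae_abs_le_of_eLpNorm_top_sq_le h2 (by positivity)] with x hx
    have hfx : f x = ∑ i, (a i : ℝ) * v i x := by
      rw [hf, rkhs_apply_eq_inner, inner_sum, ← Finset.sum_coe_sort]
      refine Finset.sum_congr rfl fun i _ => ?_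
      rw [real_inner_smul_right, ← rkhs_apply_eq_inner, hwF, mul_assoc]
    rw [← hfx, ← sq_abs]
    refine (pow_le_pow_left₀ (abs_nonneg _) hx 2).trans (le_of_eq ?_)
    rw [mul_pow, Real.sq_sqrt (Finset.sum_nonneg fun i _ => sq_nonneg _)]
  have key2 : ∀ᵐ x ∂ν, ∀ (F : Finset (spectralSystem H ν).idx) (a : F → ℚ),
      (∑ i, (a i : ℝ) * v i x) ^ 2 ≤ A ^ 2 * ∑ i, (a i : ℝ) ^ 2 :=
    ae_all_iff.2 fun F => ae_all_iff.2 fun a => key F a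
  filter_upwards [key2] with x hx
  rw [ENNReal.tsum_eq_iSup_sum]
  refine iSup_le fun F => ?_
  have hdense : DenseRange (Pi.map (fun (_ : F) (r : ℚ) => (r : ℝ))) :=
    DenseRange.piMap fun _ => Rat.denseRange_cast
  have hreal : ∀ a : F → ℝ, (∑ i, a i * v i x) ^ 2 ≤ A ^ 2 * ∑ i, a i ^ 2 := by
    intro a
    refine hdense.induction_on (p := fun a => (∑ i, a i * v i x) ^ 2 ≤ A ^ 2 * ∑ i, a i ^ 2) a
      (isClosed_le (by fun_prop) (by fun_prop)) fun a => hx F a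
  -- The coefficients now depend on x, so the null set had to be chosen before them.
  have h3 := hreal fun i => v i x
  have h4 : ∑ i : F, v i x ^ 2 ≤ A ^ 2 := by
    simp only [← sq] at h3
    rcases (Finset.sum_nonneg fun (i : F) _ => sq_nonneg (v i x)).eq_or_lt with h0 | h0
    · rw [← h0]; positivity
    · rw [sq (∑ i : F, v i x ^ 2)] at h3
      exact le_of_mul_le_mul_right h3 h0
  rw [← ENNReal.ofReal_sum_of_nonneg fun i _ =>
    mul_nonneg (Real.rpow_nonneg (hpos i).le _) (sq_nonneg _)]
  refine ENNReal.ofReal_le_ofReal (le_trans (le_of_eq ?_) h4)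
  rw [← Finset.sum_coe_sort]
  exact Finset.sum_congr rfl fun i _ => by rw [mul_pow, hsq]

theorem lintegral_basis_sq (i : (spectralSystem H ν).idx) :
    ∫⁻ x, ENNReal.ofReal ((spectralSystem H ν).basis i x ^ 2) ∂ν =
      ENNReal.ofReal ((spectralSystem H ν).eig i) := by
  classical
  rw [lintegral_ofReal_sq, ← real_inner_self_eq_norm_sq, SpectralSystem.inner_map_basis, if_pos rfl]

theorem basis_apply_sq (i : (spectralSystem H ν).idx) (x : X) :
    (spectralSystem H ν).basis i x ^ 2 =
      (spectralSystem H ν).eig i * (spectralSystem H ν).fn i x ^ 2 := by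
  rw [SpectralSystem.basis, RKHS.coe_smul, Pi.smul_apply, smul_eq_mul, mul_pow,
    Real.sq_sqrt ((spectralSystem H ν).eig_pos i).le]

/-- By `rpow_one_sub_le`, b_i² / (μ_i + reg) = μ_i e_i² / (μ_i + reg) ≤ reg^(-α) μ_i^α e_i². -/
theorem ae_tsum_basis_sq_le {α A : ℝ} (hA : 0 < A) (hα0 : 0 ≤ α) (hα : α ≤ 1)
    (hemb : ∀ f ∈ powerSpace H ν α,
      eLpNorm f ∞ ν ≤ ENNReal.ofReal A * powerNorm H ν α f) {reg : ℝ} (hreg : 0 < reg) :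
    ∀ᵐ x ∂ν, ∑' i, ENNReal.ofReal ((spectralSystem H ν).basis i x ^ 2 /
      ((spectralSystem H ν).eig i + reg)) ≤ ENNReal.ofReal (A ^ 2 * reg ^ (-α)) := by
  have hpos := fun i => (spectralSystem H ν).eig_pos i
  filter_upwards [ae_tsum_eig_rpow_le ν hA hemb] with x hx
  calc _ ≤ ∑' i, ENNReal.ofReal (reg ^ (-α)) * ENNReal.ofReal ((spectralSystem H ν).eig i ^ α *
        (spectralSystem H ν).fn i x ^ 2) := by
        refine ENNReal.tsum_le_tsum fun i => ?_
        rw [← ENNReal.ofReal_mul (by positivity)]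
        refine ENNReal.ofReal_le_ofReal ?_
        have hp := hpos i
        rw [basis_apply_sq, div_le_iff₀ (by positivity)]
        have h1 := rpow_one_sub_le hp hreg hα0 hα
        have h2 : (spectralSystem H ν).eig i = (spectralSystem H ν).eig i ^ (1 - α) *
            (spectralSystem H ν).eig i ^ α := by
          rw [← Real.rpow_add hp]; simp
        calc (spectralSystem H ν).eig i * (spectralSystem H ν).fn i x ^ 2
            = (spectralSystem H ν).eig i ^ (1 - α) * ((spectralSystem H ν).eig i ^ α *
                (spectralSystem H ν).fn i x ^ 2) := by rw [← mul_assoc, ← h2]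
          _ ≤ reg ^ (-α) * ((spectralSystem H ν).eig i + reg) * ((spectralSystem H ν).eig i ^ α *
                (spectralSystem H ν).fn i x ^ 2) := by gcongr
          _ = _ := by ring
    _ ≤ _ := by
        rw [ENNReal.tsum_mul_left, mul_comm (A ^ 2), ENNReal.ofReal_mul (by positivity)]
        gcongr

end Points

/-! ### The effective dimension, uniformly over the class of marginals -/

theorem exists_tsum_eig_filter_le {X : Type*} {H : Type*} [NormedAddCommGroup H]
    [InnerProductSpace ℝ H] [CompleteSpace H] [RKHS ℝ H X ℝ] [MeasurableSpace X]
    [MeasurableBoundedKernel H] {α p A C Λ : ℝ} (hp : 0 < p) (hpα : p ≤ α) (hα : α ≤ 1)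
    (hA : 0 < A) (hC : 0 < C) (hΛ : 0 < Λ) :
    ∃ D : ℝ, 0 < D ∧ ∀ reg, 0 < reg → reg ≤ Λ → ∀ ν ∈ marginalClass (X := X) H α p A C,
      ∑' i, ENNReal.ofReal ((spectralSystem H (ν : Measure X)).eig i /
        ((spectralSystem H (ν : Measure X)).eig i + reg)) ≤ ENNReal.ofReal (D * reg ^ (-p)) := by
  rcases (hpα.trans hα).eq_or_lt with rfl | hp1
  -- For p = 1 the eigenvalue bound alone would cost a logarithm. But p = 1 forces α = 1, and μ_i =
  -- ∫ b_i² dν turns the pointwise bound from the embedding into the required one.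
  · refine ⟨A ^ 2, by positivity, fun reg hreg _ ν hν => ?_⟩
    calc _ = ∑' i, ∫⁻ x, ENNReal.ofReal ((spectralSystem H (ν : Measure X)).basis i x ^ 2 /
          ((spectralSystem H (ν : Measure X)).eig i + reg)) ∂(ν : Measure X) := by
          refine tsum_congr fun i => ?_
          have hp := (spectralSystem H (ν : Measure X)).eig_pos i
          simp only [div_eq_inv_mul]
          have hc : 0 ≤ ((spectralSystem H (ν : Measure X)).eig i + reg)⁻¹ := by positivity
          simp only [ENNReal.ofReal_mul hc]
          rw [lintegral_const_mul, lintegral_basis_sq]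
          exact ((rkhs_measurable _).pow_const 2).ennreal_ofReal
      _ = ∫⁻ x, ∑' i, ENNReal.ofReal ((spectralSystem H (ν : Measure X)).basis i x ^ 2 /
          ((spectralSystem H (ν : Measure X)).eig i + reg)) ∂(ν : Measure X) := by
          rw [lintegral_tsum fun i =>
            (((rkhs_measurable _).pow_const 2).div_const _).ennreal_ofReal.aemeasurable]
      _ ≤ ∫⁻ _, ENNReal.ofReal (A ^ 2 * reg ^ (-(1 : ℝ))) ∂(ν : Measure X) := by
          have hα1 : α = 1 := le_antisymm hα hpα
          subst hα1
          exact lintegral_mono_ae (ae_tsum_basis_sq_le (ν : Measure X) hA zero_le_one le_rfl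
            hν.2.1 hreg)
      _ = _ := by simp
  · obtain ⟨D, hD, h⟩ := exists_tsum_filter_le hp hp1 hC hΛ
    exact ⟨D, hD, fun reg hreg hregΛ ν hν => h reg hreg hregΛ _ _
      (spectralSystem H (ν : Measure X)).eig_pos hν.2.2⟩

theorem measurable_matrix_det {Ω ι : Type*} [MeasurableSpace Ω] [Fintype ι] [DecidableEq ι]
    {M : Ω → Matrix ι ι ℝ} (hM : ∀ i j, Measurable fun ω => M ω i j) :
    Measurable fun ω => (M ω).det := by
  simp only [Matrix.det_apply]
  exact Finset.measurable_fun_sum _ fun σ _ =>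
    (Finset.measurable_fun_prod _ fun i _ => hM _ _).const_smul _

/-! ### Normal equations and measurability of the LS-SVM -/

section NormalEquations

variable {X : Type*} {H : Type*} [NormedAddCommGroup H]
  [InnerProductSpace ℝ H] [CompleteSpace H] [RKHS ℝ H X ℝ] {reg : ℝ} {n : ℕ}

/-- The objective along f + t u is a quadratic in t with minimum at t = 0, so its linear coefficient
2b vanishes. -/
theorem lsSVM_normal_equation (hreg : 0 < reg) (D : Fin n → X × ℝ) (u : H) :
    reg * ⟪lsSVM H reg D, u⟫_ℝ =
      1 / (n : ℝ) * ∑ j, ((D j).2 - lsSVM H reg D (D j).1) * u (D j).1 := by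
  set f := lsSVM H reg D with hf
  set b := reg * ⟪f, u⟫_ℝ - 1 / (n : ℝ) * ∑ j, ((D j).2 - f (D j).1) * u (D j).1 with hb
  set c := reg * ‖u‖ ^ 2 + 1 / (n : ℝ) * ∑ j, u (D j).1 ^ 2 with hc
  have hc0 : 0 ≤ c := add_nonneg (by positivity)
    (mul_nonneg (by positivity) (Finset.sum_nonneg fun i _ => sq_nonneg _))
  have hquad : ∀ t : ℝ, lsObjective H reg D (f + t • u) =
      lsObjective H reg D f + 2 * t * b + t ^ 2 * c := by
    intro t
    have h1 : ∑ j, ((D j).2 - (f + t • u) (D j).1) ^ 2 = ∑ j, ((D j).2 - f (D j).1) ^ 2 -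
        2 * t * ∑ j, ((D j).2 - f (D j).1) * u (D j).1 + t ^ 2 * ∑ j, u (D j).1 ^ 2 := by
      rw [Finset.mul_sum, Finset.mul_sum, ← Finset.sum_sub_distrib, ← Finset.sum_add_distrib]
      refine Finset.sum_congr rfl fun j _ => ?_
      rw [RKHS.coe_add, Pi.add_apply, RKHS.coe_smul, Pi.smul_apply, smul_eq_mul]
      ring
    rw [lsObjective, lsObjective, h1, norm_add_sq_real, real_inner_smul_right, norm_smul, mul_pow,
      Real.norm_eq_abs, sq_abs, hb, hc]
    ring
  have hmin : ∀ t : ℝ, 0 ≤ 2 * t * b + t ^ 2 * c := by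
    intro t
    have h1 := hquad t
    by_cases h : f + t • u = f
    · rw [h] at h1; linarith
    · have := lsSVM_spec H hreg D _ h
      linarith
  have hb0 : b = 0 := by
    -- Dividing by c + 1 instead of c avoids the degenerate case c = 0.
    have h1 := hmin (-b / (c + 1))
    have h2 : 2 * (-b / (c + 1)) * b + (-b / (c + 1)) ^ 2 * c =
        -(b ^ 2 * (c + 2)) / (c + 1) ^ 2 := by
      field_simp
      ring
    rw [h2, neg_div, neg_nonneg] at h1
    by_contra hne
    have : 0 < b ^ 2 * (c + 2) / (c + 1) ^ 2 := by
      have := sq_pos_of_ne_zero hne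
      positivity
    linarith
  linarith

/-- The regularized kernel matrix of a sample. -/
noncomputable def regKernelMatrix (H : Type*) [NormedAddCommGroup H]
    [InnerProductSpace ℝ H] [CompleteSpace H] [RKHS ℝ H X ℝ] (reg : ℝ) (D : Fin n → X × ℝ) :
    Matrix (Fin n) (Fin n) ℝ :=
  fun i j => rkhsKernel H (D i).1 (D j).1 + if i = j then n * reg else 0

theorem regKernelMatrix_mulVec (D : Fin n → X × ℝ) (v : Fin n → ℝ) (i : Fin n) :
    (regKernelMatrix H reg D).mulVec v i =
      ∑ j, rkhsKernel H (D i).1 (D j).1 * v j + n * reg * v i := by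
  simp [Matrix.mulVec, dotProduct, regKernelMatrix, add_mul, Finset.sum_add_distrib]

/-- The quadratic form of the matrix is ‖∑ v_j k(x_j, ·)‖² + n reg |v|², which is positive for v ≠
0. -/
theorem det_regKernelMatrix_ne_zero (hreg : 0 < reg) (hn : 1 ≤ n) (D : Fin n → X × ℝ) :
    (regKernelMatrix H reg D).det ≠ 0 := by
  have hn' : (0 : ℝ) < n := by exact_mod_cast hn
  intro h
  obtain ⟨v, hv, h0⟩ := Matrix.exists_mulVec_eq_zero_iff.2 h
  have h1 : ∑ i, v i * (regKernelMatrix H reg D).mulVec v i =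
      ‖∑ j, v j • RKHS.kerFun H (D j).1 (1 : ℝ)‖ ^ 2 + n * reg * ∑ i, v i ^ 2 := by
    rw [← real_inner_self_eq_norm_sq, sum_inner, Finset.mul_sum, ← Finset.sum_add_distrib]
    refine Finset.sum_congr rfl fun i _ => ?_
    rw [regKernelMatrix_mulVec, mul_add, Finset.mul_sum, inner_sum]
    congr 1
    · refine Finset.sum_congr rfl fun j _ => ?_
      rw [rkhsKernel_eq_inner, real_inner_smul_left, real_inner_smul_right, real_inner_comm]
      ring
    · ring
  rw [h0] at h1
  simp only [Pi.zero_apply, mul_zero, Finset.sum_const_zero] at h1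
  have h2 : 0 ≤ ∑ i, v i ^ 2 := Finset.sum_nonneg fun i _ => sq_nonneg _
  have h3 : ∑ i, v i ^ 2 = 0 := by
    by_contra hne
    have h4 : 0 < ∑ i, v i ^ 2 := lt_of_le_of_ne h2 (Ne.symm hne)
    have h5 : 0 < n * reg * ∑ i, v i ^ 2 := by positivity
    have h6 := sq_nonneg ‖∑ j, v j • RKHS.kerFun H (D j).1 (1 : ℝ)‖
    linarith
  rw [Finset.sum_eq_zero_iff_of_nonneg fun i _ => sq_nonneg _] at h3
  exact hv (funext fun i => by simpa using h3 i (Finset.mem_univ i))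

/-- Testing the normal equation against the kernel functions at the sample points gives n linear
equations for the residuals, with a matrix and right-hand side that are explicit in the sample. -/
theorem residual_eq (hreg : 0 < reg) (hn : 1 ≤ n) (D : Fin n → X × ℝ) :
    (fun j => (D j).2 - lsSVM H reg D (D j).1) =
      (regKernelMatrix H reg D)⁻¹.mulVec fun j => n * reg * (D j).2 := by
  have hn' : (0 : ℝ) < n := by exact_mod_cast hn
  set r := fun j => (D j).2 - lsSVM H reg D (D j).1 with hr
  have h1 : (regKernelMatrix H reg D).mulVec r = fun j => n * reg * (D j).2 := by
    ext i
    rw [regKernelMatrix_mulVec]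
    have h2 := lsSVM_normal_equation (H := H) hreg D (RKHS.kerFun H (D i).1 (1 : ℝ))
    rw [real_inner_comm, ← rkhs_apply_eq_inner] at h2
    have h3 : ∑ j, rkhsKernel H (D i).1 (D j).1 * r j = n * (reg * lsSVM H reg D (D i).1) := by
      rw [h2, ← mul_assoc, mul_one_div_cancel hn'.ne', one_mul]
      refine Finset.sum_congr rfl fun j _ => ?_
      rw [rkhs_apply_eq_inner (RKHS.kerFun H (D i).1 (1 : ℝ)), rkhsKernel_eq_inner, mul_comm]
    rw [h3, hr]
    ring
  rw [← h1, Matrix.mulVec_mulVec, Matrix.nonsing_inv_mul _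
    (det_regKernelMatrix_ne_zero hreg hn D).isUnit, Matrix.one_mulVec]

variable [MeasurableSpace X] [MeasurableBoundedKernel H]

/-- The minimizer is defined by choice, but its residuals are a rational expression in the kernel
matrix and the outputs (adjugate over determinant), and the normal equation recovers each
coefficient from the residuals. -/
theorem measurable_inner_lsSVM (hreg : 0 < reg) (hn : 1 ≤ n) (u : H) :
    Measurable fun D : Fin n → X × ℝ => ⟪lsSVM H reg D, u⟫_ℝ := by
  have hmat : ∀ i j, Measurable fun D : Fin n → X × ℝ => regKernelMatrix H reg D i j := by
    intro i j
    have h1 : Measurable fun D : Fin n → X × ℝ => ((D i).1, (D j).1) :=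
      (measurable_fst.comp (measurable_pi_apply i)).prodMk
        (measurable_fst.comp (measurable_pi_apply j))
    exact ((MeasurableBoundedKernel.measurable_kernel (H := H)).comp h1).add measurable_const
  have hinv : ∀ i j, Measurable fun D : Fin n → X × ℝ => (regKernelMatrix H reg D)⁻¹ i j := by
    intro i j
    have h2 : Measurable fun D : Fin n → X × ℝ => (regKernelMatrix H reg D).adjugate i j := by
      simp only [Matrix.adjugate_apply]
      refine measurable_matrix_det fun k l => ?_
      simp only [Matrix.updateRow_apply]
      split_ifs
      exacts [measurable_const, hmat k l]
    simp only [Matrix.inv_def, Ring.inverse_eq_inv', Matrix.smul_apply, smul_eq_mul]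
    exact (measurable_matrix_det hmat).inv.mul h2
  have hr : ∀ j, Measurable fun D : Fin n → X × ℝ => (D j).2 - lsSVM H reg D (D j).1 := by
    intro j
    have h1 : (fun D : Fin n → X × ℝ => (D j).2 - lsSVM H reg D (D j).1) = fun D =>
        ∑ k, (regKernelMatrix H reg D)⁻¹ j k * (n * reg * (D k).2) := by
      ext D
      exact congrFun (residual_eq (H := H) hreg hn D) j
    rw [h1]
    exact Finset.measurable_fun_sum _ fun k _ => (hinv j k).mul
      ((measurable_snd.comp (measurable_pi_apply k)).const_mul _)
  have h1 : (fun D : Fin n → X × ℝ => ⟪lsSVM H reg D, u⟫_ℝ) = fun D =>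
      reg⁻¹ * (1 / (n : ℝ) * ∑ j, ((D j).2 - lsSVM H reg D (D j).1) * u (D j).1) := by
    ext D
    rw [← lsSVM_normal_equation hreg D u, ← mul_assoc, inv_mul_cancel₀ hreg.ne', one_mul]
  rw [h1]
  refine ((Finset.measurable_fun_sum _ fun j _ => (hr j).mul ?_).const_mul _).const_mul _
  exact (rkhs_measurable u).comp (measurable_fst.comp (measurable_pi_apply j))

end NormalEquations

/-! ### A deterministic error bound -/

section Deterministic

/-- Replacing the Gram matrix by diag(μ_i) would give the full sum. The error is a quadratic form,
which Cauchy-Schwarz over F × F bounds by the Hilbert-Schmidt norm of the rescaled deviation, at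
most 1/2, times the same sum. -/
theorem half_sum_le_of_gram {ι : Type*} [DecidableEq ι] {n : ℕ} (F : Finset ι) (μ h : ι → ℝ)
    (b : ι → Fin n → ℝ) {reg : ℝ} (hμ : ∀ i, 0 < μ i) (hreg : 0 < reg)
    (hR : ∑ i ∈ F, ∑ k ∈ F, (1 / (n : ℝ) * ∑ j, b i j * b k j - if i = k then μ i else 0) ^ 2 /
      ((μ i + reg) * (μ k + reg)) ≤ 1 / 4) :
    1 / 2 * ∑ i ∈ F, (μ i + reg) * h i ^ 2 ≤
      reg * ∑ i ∈ F, h i ^ 2 + 1 / (n : ℝ) * ∑ j, (∑ i ∈ F, h i * b i j) ^ 2 := by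
  set G : ι → ι → ℝ := fun i k => 1 / (n : ℝ) * ∑ j, b i j * b k j - if i = k then μ i else 0
    with hG
  set N := ∑ i ∈ F, (μ i + reg) * h i ^ 2 with hN
  have hN0 : 0 ≤ N := Finset.sum_nonneg fun i _ => by have := hμ i; positivity
  have hexp : 1 / (n : ℝ) * ∑ j, (∑ i ∈ F, h i * b i j) ^ 2 =
      ∑ i ∈ F, μ i * h i ^ 2 + ∑ i ∈ F, ∑ k ∈ F, h i * h k * G i k := by
    have h1 : ∑ j, (∑ i ∈ F, h i * b i j) ^ 2 =
        ∑ i ∈ F, ∑ k ∈ F, h i * h k * ∑ j, b i j * b k j := by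
      simp only [sq, Finset.sum_mul_sum]
      rw [Finset.sum_comm]
      refine Finset.sum_congr rfl fun i _ => ?_
      rw [Finset.sum_comm]
      refine Finset.sum_congr rfl fun k _ => ?_
      rw [Finset.mul_sum]
      exact Finset.sum_congr rfl fun j _ => by ring
    have h2 : ∀ i ∈ F, ∑ k ∈ F, h i * h k * G i k =
        1 / (n : ℝ) * ∑ k ∈ F, h i * h k * ∑ j, b i j * b k j - μ i * h i ^ 2 := by
      intro i hi
      have h3 : ∀ k, h i * h k * G i k = 1 / (n : ℝ) * (h i * h k * ∑ j, b i j * b k j) -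
          if i = k then μ i * h i ^ 2 else 0 := by
        intro k
        by_cases hik : i = k
        · subst hik; simp only [hG, if_true]; ring
        · simp only [hG, hik, if_false]; ring
      simp only [h3, Finset.sum_sub_distrib, Finset.sum_ite_eq, hi, if_true, Finset.mul_sum]
    rw [Finset.sum_congr rfl h2, Finset.sum_sub_distrib, h1, Finset.mul_sum]
    ring
  have hcs : (∑ i ∈ F, ∑ k ∈ F, h i * h k * G i k) ^ 2 ≤ (N / 2) ^ 2 := by
    have hs : ∀ i, √(μ i + reg) ^ 2 = μ i + reg := fun i =>
      Real.sq_sqrt (by have := hμ i; positivity)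
    have hs0 : ∀ i, 0 < √(μ i + reg) := fun i => Real.sqrt_pos.2 (by have := hμ i; positivity)
    have h1 := Finset.sum_mul_sq_le_sq_mul_sq (F ×ˢ F)
      (fun z => (√(μ z.1 + reg) * h z.1) * (√(μ z.2 + reg) * h z.2))
      (fun z => G z.1 z.2 / (√(μ z.1 + reg) * √(μ z.2 + reg)))
    have h2 : ∀ z : ι × ι, (√(μ z.1 + reg) * h z.1) * (√(μ z.2 + reg) * h z.2) *
        (G z.1 z.2 / (√(μ z.1 + reg) * √(μ z.2 + reg))) = h z.1 * h z.2 * G z.1 z.2 := by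
      intro z
      have h3 := hs0 z.1
      have h4 := hs0 z.2
      field_simp
    simp only [h2, mul_pow, div_pow, hs, Finset.sum_product] at h1
    rw [← Finset.sum_mul_sum] at h1
    refine h1.trans ?_
    calc N * N * _ ≤ N * N * (1 / 4) := by gcongr
      _ = _ := by ring
  have h3 := (abs_le.1 (abs_le_of_sq_le_sq hcs (by positivity))).1
  have h4 : N = ∑ i ∈ F, μ i * h i ^ 2 + reg * ∑ i ∈ F, h i ^ 2 := by
    rw [hN, Finset.mul_sum, ← Finset.sum_add_distrib]
    exact Finset.sum_congr rfl fun i _ => by ring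
  rw [hexp]
  linarith

variable {X : Type*} {H : Type*} [NormedAddCommGroup H]
  [InnerProductSpace ℝ H] [CompleteSpace H] [RKHS ℝ H X ℝ] {E : Type*} [NormedAddCommGroup E]
  [InnerProductSpace ℝ E] [CompleteSpace E] {J : H →L[ℝ] E}

/-- Apply the normal equation to h = f_D - g itself. The Gram hypothesis bounds the quadratic side
below, Young's inequality bounds the linear side above. Both are first compared on finite sets of
indices and then taken to the limit. -/
theorem sum_inner_sq_le_of_good_sample (S : SpectralSystem J) [DecidableEq S.idx] {reg S2 : ℝ}
    (hreg : 0 < reg) {n : ℕ} (D : Fin n → X × ℝ)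
    (hx : ∀ j, ∀ u : H, HasSum (fun i => ⟪S.basis i, u⟫_ℝ * S.basis i (D j).1) (u (D j).1))
    (g : H) (hg : HasSum (fun i => ⟪S.basis i, g⟫_ℝ • S.basis i) g)
    (hS : ∀ F : Finset S.idx, ∑ i ∈ F, (1 / (n : ℝ) * ∑ j, ((D j).2 - g (D j).1) *
      S.basis i (D j).1 - reg * ⟪S.basis i, g⟫_ℝ) ^ 2 / (S.eig i + reg) ≤ S2)
    (hR : ∀ F : Finset S.idx, ∑ i ∈ F, ∑ k ∈ F, (1 / (n : ℝ) * ∑ j, S.basis i (D j).1 *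
      S.basis k (D j).1 - if i = k then S.eig i else 0) ^ 2 /
      ((S.eig i + reg) * (S.eig k + reg)) ≤ 1 / 4) (F : Finset S.idx) :
    ∑ i ∈ F, (S.eig i + reg) * ⟪S.basis i, lsSVM H reg D - g⟫_ℝ ^ 2 ≤ 4 * S2 := by
  set h := lsSVM H reg D - g with hh
  set c : S.idx → ℝ := fun i => ⟪S.basis i, h⟫_ℝ with hc
  set ell : S.idx → ℝ := fun i => 1 / (n : ℝ) * ∑ j, ((D j).2 - g (D j).1) *
      S.basis i (D j).1 - reg * ⟪S.basis i, g⟫_ℝ with hell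
  -- The full norm of h is kept here: h may have a component outside the span of the b_i, and
  -- Bessel's inequality later discards it.
  let r : Finset S.idx → ℝ := fun F => reg * ‖h‖ ^ 2 +
    1 / (n : ℝ) * ∑ j, (∑ i ∈ F, c i * S.basis i (D j).1) ^ 2
  let l : Finset S.idx → ℝ := fun F => ∑ i ∈ F, c i * ell i
  have hxlim : ∀ j, Tendsto (fun F : Finset S.idx => ∑ i ∈ F, c i * S.basis i (D j).1) atTop
      (𝓝 (h (D j).1)) := fun j => hx j h
  have hrlim : Tendsto r atTop (𝓝 (reg * ‖h‖ ^ 2 + 1 / (n : ℝ) * ∑ j, h (D j).1 ^ 2)) :=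
    tendsto_const_nhds.add ((tendsto_finsetSum _ fun j _ => (hxlim j).pow 2).const_mul _)
  have hglim : Tendsto (fun F : Finset S.idx => ∑ i ∈ F, c i * ⟪S.basis i, g⟫_ℝ) atTop
      (𝓝 ⟪g, h⟫_ℝ) := by
    have h1 := hg.mapL (innerSL ℝ h)
    have h2 : HasSum (fun i => c i * ⟪S.basis i, g⟫_ℝ) ⟪g, h⟫_ℝ := by
      rw [real_inner_comm]
      refine h1.congr_fun fun i => ?_
      rw [innerSL_apply_apply, real_inner_smul_right, real_inner_comm (S.basis i) h]
      exact mul_comm _ _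
    exact h2
  have hllim : Tendsto l atTop (𝓝 (1 / (n : ℝ) * ∑ j, ((D j).2 - g (D j).1) * h (D j).1 -
      reg * ⟪g, h⟫_ℝ)) := by
    have h1 : l = fun F => 1 / (n : ℝ) * ∑ j, ((D j).2 - g (D j).1) *
        (∑ i ∈ F, c i * S.basis i (D j).1) - reg * ∑ i ∈ F, c i * ⟪S.basis i, g⟫_ℝ := by
      ext F
      simp only [l, hell, mul_sub, Finset.sum_sub_distrib, Finset.mul_sum]
      congr 1
      · rw [Finset.sum_comm]
        exact Finset.sum_congr rfl fun j _ => Finset.sum_congr rfl fun i _ => by ring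
      · exact Finset.sum_congr rfl fun i _ => by ring
    rw [h1]
    exact ((tendsto_finsetSum _ fun j _ => (hxlim j).const_mul _).const_mul _).sub
      (hglim.const_mul _)
  have heq : reg * ‖h‖ ^ 2 + 1 / (n : ℝ) * ∑ j, h (D j).1 ^ 2 =
      1 / (n : ℝ) * ∑ j, ((D j).2 - g (D j).1) * h (D j).1 - reg * ⟪g, h⟫_ℝ := by
    have h1 := lsSVM_normal_equation (H := H) hreg D h
    have h2 : lsSVM H reg D = h + g := by rw [hh]; abel
    rw [h2, inner_add_left, real_inner_self_eq_norm_sq] at h1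
    have h3 : ∑ j, ((D j).2 - (h + g) (D j).1) * h (D j).1 =
        ∑ j, ((D j).2 - g (D j).1) * h (D j).1 - ∑ j, h (D j).1 ^ 2 := by
      rw [← Finset.sum_sub_distrib]
      refine Finset.sum_congr rfl fun j _ => ?_
      rw [RKHS.coe_add, Pi.add_apply]
      ring
    rw [h3] at h1
    linarith
  -- The normal equation says that r F - l F tends to 0, so it suffices to prove the finite
  -- inequality with this defect added.
  have hlim : Tendsto (fun F => 4 * S2 + 4 * (r F - l F)) atTop (𝓝 (4 * S2 + 4 * 0)) := by
    refine tendsto_const_nhds.add (Tendsto.const_mul _ ?_)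
    rw [heq] at hrlim
    simpa using hrlim.sub hllim
  rw [mul_zero, add_zero] at hlim
  refine ge_of_tendsto hlim ?_
  filter_upwards [eventually_ge_atTop F] with F' hF'
  have h1 : ∑ i ∈ F, (S.eig i + reg) * c i ^ 2 ≤ ∑ i ∈ F', (S.eig i + reg) * c i ^ 2 :=
    Finset.sum_le_sum_of_subset_of_nonneg hF' fun i _ _ => by have := S.eig_pos i; positivity
  have h2 := half_sum_le_of_gram F' S.eig c (fun i j => S.basis i (D j).1) S.eig_pos hreg (hR F')
  have h3 : ∑ i ∈ F', c i ^ 2 ≤ ‖h‖ ^ 2 := by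
    simpa using S.orthonormal_basis.sum_inner_products_le h (s := F')
  have h4 : l F' ≤ 1 / 4 * ∑ i ∈ F', (S.eig i + reg) * c i ^ 2 +
      ∑ i ∈ F', ell i ^ 2 / (S.eig i + reg) := by
    rw [Finset.mul_sum, ← Finset.sum_add_distrib]
    refine Finset.sum_le_sum fun i _ => ?_
    have hp : 0 < S.eig i + reg := by have := S.eig_pos i; positivity
    -- Young's inequality with weight 1/4, half of the 1/2 left by the Gram estimate; the remaining
    -- 1/4 accounts for the factor 4 in the conclusion.
    have h5 : 0 ≤ (1 / 2 * ((S.eig i + reg) * c i) - ell i) ^ 2 / (S.eig i + reg) := by positivity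
    have h6 : (1 / 2 * ((S.eig i + reg) * c i) - ell i) ^ 2 / (S.eig i + reg) =
        1 / 4 * ((S.eig i + reg) * c i ^ 2) + ell i ^ 2 / (S.eig i + reg) - c i * ell i := by
      field_simp
      ring
    linarith
  have h5 := hS F'
  have h6 : reg * ∑ i ∈ F', c i ^ 2 ≤ reg * ‖h‖ ^ 2 := by gcongr
  have h7 : 1 / 2 * ∑ i ∈ F', (S.eig i + reg) * c i ^ 2 ≤ r F' := by
    simp only [r]
    linarith
  linarith

end Deterministic

/-! ### Second moments of sample means -/

/-- The left side is the variance of a mean of n independent copies, and the variance of φ is at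
most its second moment. An infinite second moment makes the bound trivial. -/
theorem lintegral_sq_sampleMean_sub_le {Ω : Type*} [MeasurableSpace Ω] (P : Measure Ω)
    [IsProbabilityMeasure P] {n : ℕ} (hn : 1 ≤ n) {φ : Ω → ℝ} (hφ : Measurable φ) {e : ℝ}
    (he : ∫ z, φ z ∂P = e) :
    ∫⁻ D, ENNReal.ofReal ((1 / (n : ℝ) * ∑ j, φ (D j) - e) ^ 2) ∂Measure.pi
      (fun _ : Fin n => P) ≤ (∫⁻ z, ENNReal.ofReal (φ z ^ 2) ∂P) / n := by
  have hn' : (0 : ℝ) < n := by exact_mod_cast hn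
  by_cases htop : ∫⁻ z, ENNReal.ofReal (φ z ^ 2) ∂P = ∞
  · rw [htop, ENNReal.top_div_of_ne_top (ENNReal.natCast_ne_top n)]
    exact le_top
  have hsq : Integrable (fun z => φ z ^ 2) P := by
    refine ⟨(hφ.pow_const 2).aestronglyMeasurable, ?_⟩
    rw [hasFiniteIntegral_iff_ofReal (Eventually.of_forall fun z => sq_nonneg _)]
    exact lt_top_iff_ne_top.2 htop
  have hL2 : MemLp φ 2 P := (memLp_two_iff_integrable_sq hφ.aestronglyMeasurable).2 hsq
  have hL2' : ∀ j : Fin n, MemLp (fun D : Fin n → Ω => φ (D j)) 2 (Measure.pi fun _ => P) :=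
    fun j => hL2.comp_measurePreserving (measurePreserving_eval _ j)
  have hY : MemLp (fun D : Fin n → Ω => 1 / (n : ℝ) * ∑ j, φ (D j)) 2 (Measure.pi fun _ => P) :=
    (memLp_finsetSum _ fun j _ => hL2' j).const_mul _
  have hmean : ∫ D, 1 / (n : ℝ) * ∑ j, φ (D j) ∂Measure.pi (fun _ : Fin n => P) = e := by
    rw [integral_const_mul, integral_finsetSum _ fun j _ => (hL2' j).integrable one_le_two]
    simp only [integral_comp_eval (μ := fun _ : Fin n => P) hφ.aestronglyMeasurable, he]
    rw [Finset.sum_const, Finset.card_univ, Fintype.card_fin, nsmul_eq_mul]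
    field_simp
  have hvar := ProbabilityTheory.variance_sum_pi (μ := fun _ : Fin n => P) (X := fun _ => φ)
    fun _ => hL2
  have hfun : (∑ i : Fin n, fun D : Fin n → Ω => φ (D i)) = fun D => ∑ i, φ (D i) := by
    ext D; simp
  rw [hfun, Finset.sum_const, Finset.card_univ, Fintype.card_fin, nsmul_eq_mul] at hvar
  have h1 : ∫⁻ D, ENNReal.ofReal ((1 / (n : ℝ) * ∑ j, φ (D j) - e) ^ 2) ∂Measure.pi
      (fun _ : Fin n => P) = ENNReal.ofReal (ProbabilityTheory.variance
        (fun D : Fin n → Ω => 1 / (n : ℝ) * ∑ j, φ (D j)) (Measure.pi fun _ => P)) := by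
    rw [ProbabilityTheory.ofReal_variance hY, ProbabilityTheory.evariance, hmean]
    refine lintegral_congr fun D => ?_
    rw [← ofReal_norm, ← ENNReal.ofReal_pow (norm_nonneg _), Real.norm_eq_abs, sq_abs]
  rw [h1, ProbabilityTheory.variance_const_mul, hvar,
    ← ofReal_integral_eq_lintegral_ofReal hsq (Eventually.of_forall fun z => sq_nonneg _),
    ← ENNReal.ofReal_natCast, ← ENNReal.ofReal_div_of_pos hn']
  refine ENNReal.ofReal_le_ofReal ?_
  have h2 := ProbabilityTheory.variance_le_expectation_sq (μ := P) hφ.aestronglyMeasurable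
  calc (1 / (n : ℝ)) ^ 2 * (n * ProbabilityTheory.variance φ P)
      = ProbabilityTheory.variance φ P / n := by field_simp
    _ ≤ _ := by gcongr; exact h2

/-! ### The regularized population solution -/

section Population

variable {X : Type*} {H : Type*} [NormedAddCommGroup H]
  [InnerProductSpace ℝ H] [CompleteSpace H] [RKHS ℝ H X ℝ] [MeasurableSpace X]
  [MeasurableBoundedKernel H]

/-- For f with power coefficients a this is (J*J + reg)⁻¹ J* f. The second property says that g has
no component in the kernel of J. -/
theorem SpectralSystem.exists_regularized {E : Type*} [NormedAddCommGroup E]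
    [InnerProductSpace ℝ E] [CompleteSpace E] {J : H →L[ℝ] E} (S : SpectralSystem J)
    (a : lp (fun _ : S.idx => ℝ) 2) {β reg : ℝ} (hβ : 0 ≤ β) (hreg : 0 < reg) :
    ∃ g : H, (∀ i, ⟪S.basis i, g⟫_ℝ = √(S.eig i) * S.eig i ^ (β / 2) / (S.eig i + reg) * a i) ∧
      HasSum (fun i => ⟪S.basis i, g⟫_ℝ • S.basis i) g := by
  obtain ⟨M, hM0, hM⟩ := S.exists_eig_le
  set v : S.idx → ℝ := fun i => √(S.eig i) * S.eig i ^ (β / 2) / (S.eig i + reg) * a i with hv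
  have ha : Summable fun i => a i ^ 2 := by
    have := (lp.memℓp a).summable (p := 2) (by simp)
    simpa using this
  have hsum : Summable fun i => v i ^ 2 := by
    refine Summable.of_nonneg_of_le (fun i => sq_nonneg _) (fun i => ?_)
      (ha.mul_left ((√M * M ^ (β / 2) / reg) ^ 2))
    have hp := S.eig_pos i
    rw [hv, mul_pow]
    have h1 := hM i
    gcongr
    linarith
  obtain ⟨g, hg⟩ := S.orthonormal_basis.summable_smul hsum
  have hin : ∀ i, ⟪S.basis i, g⟫_ℝ = v i := fun i =>
    S.orthonormal_basis.inner_eq_of_hasSum hg i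
  exact ⟨g, hin, by simpa only [hin] using hg⟩

theorem regularized_coeff {μ reg a b : ℝ} (hμ : 0 < μ) (hreg : 0 < reg) :
    √μ * (√μ * b / (μ + reg) * a) - a * b = -(reg / (μ + reg)) * (a * b) := by
  have h := Real.mul_self_sqrt hμ.le
  field_simp
  linear_combination (a * b) * h

variable {ν : Measure X} [IsFiniteMeasure ν] {β reg : ℝ}
  {a : lp (fun _ : (spectralSystem H ν).idx => ℝ) 2}

theorem hasSum_sub_powerCoeff {f : Lp ℝ 2 ν} (ha : IsPowerCoeff H ν β a f) (u : H) :
    HasSum (fun i => (√((spectralSystem H ν).eig i) * ⟪(spectralSystem H ν).basis i, u⟫_ℝ -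
      a i * (spectralSystem H ν).eig i ^ (β / 2)) •
      rkhsEmbedding H ν ((spectralSystem H ν).fn i)) (rkhsEmbedding H ν u - f) := by
  refine (((spectralSystem H ν).hasSum_map u).sub ha).congr_fun fun i => ?_
  rw [sub_smul]

theorem coe_sub_ae_eq {f : Lp ℝ 2 ν} {fs : X → ℝ} (hf : fs =ᵐ[ν] f) (u : H) :
    (fun x => u x - fs x) =ᵐ[ν] (rkhsEmbedding H ν u - f : Lp ℝ 2 ν) := by
  filter_upwards [hf, rkhsEmbedding_coeFn (ν := ν) u, Lp.coeFn_sub (rkhsEmbedding H ν u) f]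
    with x h1 h2 h3
  rw [h3, Pi.sub_apply, h2, h1]

/-- The i-th coefficient of g - f is -(reg / (μ_i + reg)) a_i μ_i^(β/2), so the filter inequality
with exponent β - s applies term by term. -/
theorem tsum_bias_le {g : H} (hreg : 0 < reg) (hg : ∀ i, ⟪(spectralSystem H ν).basis i, g⟫_ℝ =
      √((spectralSystem H ν).eig i) * (spectralSystem H ν).eig i ^ (β / 2) /
        ((spectralSystem H ν).eig i + reg) * a i)
    {s : ℝ} (h0 : 0 ≤ β - s) (h2 : β - s ≤ 2) :
    ∑' i, ENNReal.ofReal ((√((spectralSystem H ν).eig i) * ⟪(spectralSystem H ν).basis i, g⟫_ℝ -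
      a i * (spectralSystem H ν).eig i ^ (β / 2)) ^ 2 * (spectralSystem H ν).eig i ^ (-s)) ≤
      ENNReal.ofReal (reg ^ (β - s)) * ‖a‖ₑ ^ 2 := by
  rw [enorm_lp_sq, ← ENNReal.tsum_mul_left]
  refine ENNReal.tsum_le_tsum fun i => ?_
  have hp := (spectralSystem H ν).eig_pos i
  rw [← ENNReal.ofReal_mul (by positivity)]
  refine ENNReal.ofReal_le_ofReal ?_
  rw [hg, regularized_coeff hp hreg]
  have h1 : ((spectralSystem H ν).eig i ^ (β / 2)) ^ 2 * (spectralSystem H ν).eig i ^ (-s) =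
      (spectralSystem H ν).eig i ^ (β - s) := by
    rw [← Real.rpow_natCast, ← Real.rpow_mul hp.le, ← Real.rpow_add hp]
    congr 1; push_cast; ring
  calc _ = (reg / ((spectralSystem H ν).eig i + reg)) ^ 2 *
        (((spectralSystem H ν).eig i ^ (β / 2)) ^ 2 * (spectralSystem H ν).eig i ^ (-s)) *
          a i ^ 2 := by ring
    _ ≤ _ := by
      rw [h1]
      gcongr
      exact filter_sq_mul_rpow_le hp hreg h0 h2

/-- The bias estimate at s = α, carried to the sup norm by the embedding. -/
theorem ae_sq_sub_le_of_embedding {α A B : ℝ} (hA : 0 < A) (hB : 0 ≤ B)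
    (hemb : ∀ f ∈ powerSpace H ν α,
      eLpNorm f ∞ ν ≤ ENNReal.ofReal A * powerNorm H ν α f)
    {f : Lp ℝ 2 ν} {fs : X → ℝ} (hf : fs =ᵐ[ν] f) (ha : IsPowerCoeff H ν β a f)
    (haB : ‖a‖ₑ ^ 2 ≤ ENNReal.ofReal B) {g : H} (hreg : 0 < reg)
    (hg : ∀ i, ⟪(spectralSystem H ν).basis i, g⟫_ℝ =
      √((spectralSystem H ν).eig i) * (spectralSystem H ν).eig i ^ (β / 2) /
        ((spectralSystem H ν).eig i + reg) * a i) (h0 : 0 ≤ β - α) (h2 : β - α ≤ 2) :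
    ∀ᵐ x ∂ν, (g x - fs x) ^ 2 ≤ A ^ 2 * (reg ^ (β - α) * B) := by
  have hae := coe_sub_ae_eq (H := H) hf g
  have hnorm : powerNorm H ν α (rkhsEmbedding H ν g - f : Lp ℝ 2 ν) ^ 2 ≤
      ENNReal.ofReal (reg ^ (β - α) * B) := by
    rw [powerNorm_sq (EventuallyEq.refl _ _) (hasSum_sub_powerCoeff ha g)]
    refine (tsum_bias_le hreg hg h0 h2).trans ?_
    rw [ENNReal.ofReal_mul (by positivity)]
    gcongr
  have hmem : (rkhsEmbedding H ν g - f : Lp ℝ 2 ν) ∈ powerSpace H ν α := by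
    have hfin : powerNorm H ν α (rkhsEmbedding H ν g - f : Lp ℝ 2 ν) ≠ ∞ := by
      intro h
      rw [h] at hnorm
      simp at hnorm
    obtain ⟨a', f', hf', ha', -⟩ := exists_isPowerCoeff_of_powerNorm_ne_top hfin
    exact Lp.ext hf' ▸ ⟨a', ha'⟩
  have h1 := hemb _ hmem
  have h3 : eLpNorm (rkhsEmbedding H ν g - f : Lp ℝ 2 ν) ∞ ν ^ 2 ≤
      ENNReal.ofReal ((√(A ^ 2 * (reg ^ (β - α) * B))) ^ 2) := by
    rw [Real.sq_sqrt (by positivity), ENNReal.ofReal_mul (by positivity), ENNReal.ofReal_pow hA.le]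
    calc _ ≤ (ENNReal.ofReal A *
          powerNorm H ν α (rkhsEmbedding H ν g - f : Lp ℝ 2 ν)) ^ 2 := by gcongr
      _ ≤ _ := by rw [mul_pow]; gcongr
  filter_upwards [ae_abs_le_of_eLpNorm_top_sq_le h3 (Real.sqrt_nonneg _), hae] with x hx hx'
  rw [hx', ← sq_abs, ← Real.sq_sqrt (show 0 ≤ A ^ 2 * (reg ^ (β - α) * B) by positivity)]
  exact pow_le_pow_left₀ (abs_nonneg _) hx 2

end Population

/-! ### Moments under the joint distribution -/

section Joint

open ProbabilityTheory

variable {X : Type*} [MeasurableSpace X] (P : ProbabilityMeasure (X × ℝ))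

theorem marginal_compProd_condKernel :
    (marginal P : Measure X) ⊗ₘ (P : Measure (X × ℝ)).condKernel = (P : Measure (X × ℝ)) :=
  (P : Measure (X × ℝ)).disintegrate _

theorem lintegral_fst_eq {φ : X → ℝ≥0∞} (hφ : Measurable φ) :
    ∫⁻ z, φ z.1 ∂(P : Measure (X × ℝ)) = ∫⁻ x, φ x ∂(marginal P : Measure X) := by
  change _ = ∫⁻ x, φ x ∂(P : Measure (X × ℝ)).fst
  rw [Measure.fst, lintegral_map hφ measurable_fst]

theorem integral_fst_eq {φ : X → ℝ} (hφ : Measurable φ) :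
    ∫ z, φ z.1 ∂(P : Measure (X × ℝ)) = ∫ x, φ x ∂(marginal P : Measure X) := by
  change _ = ∫ x, φ x ∂(P : Measure (X × ℝ)).fst
  rw [Measure.fst, integral_map measurable_fst.aemeasurable hφ.aestronglyMeasurable]

theorem ae_fst {p : X → Prop} (h : ∀ᵐ x ∂(marginal P : Measure X), p x) :
    ∀ᵐ z ∂(P : Measure (X × ℝ)), p z.1 := by
  have h' : ∀ᵐ x ∂(P : Measure (X × ℝ)).map Prod.fst, p x := h
  exact ae_of_ae_map measurable_fst.aemeasurable h'

theorem integral_snd_mul_fst {w : X → ℝ} (hy : Integrable (fun z : X × ℝ => z.2)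
    (P : Measure (X × ℝ))) (hw : Measurable w) {c : ℝ} (hc : ∀ x, ‖w x‖ ≤ c) :
    Integrable (fun z : X × ℝ => z.2 * w z.1) (P : Measure (X × ℝ)) ∧
    ∫ z, z.2 * w z.1 ∂(P : Measure (X × ℝ)) =
      ∫ x, condMean P x * w x ∂(marginal P : Measure X) := by
  have hint : Integrable (fun z : X × ℝ => z.2 * w z.1) (P : Measure (X × ℝ)) :=
    hy.mul_bdd (c := c) (hw.comp measurable_fst).aestronglyMeasurable
      (Eventually.of_forall fun z => hc _)
  refine ⟨hint, ?_⟩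
  rw [← marginal_compProd_condKernel] at hint ⊢
  rw [Measure.integral_compProd hint]
  simp only [integral_mul_const]
  rfl

/-- Split the residual at the conditional mean by (u + v)² ≤ 2u² + 2v²; given x, the two parts are
noise and bias, each bounded uniformly in x. -/
theorem lintegral_residual_sq_le {g w : X → ℝ} (hg : Measurable g) (hw : Measurable w)
    {s2 G : ℝ} (hs2 : 0 ≤ s2)
    (hs : ∀ᵐ x ∂(marginal P : Measure X), ∫⁻ y, ENNReal.ofReal ((y - condMean P x) ^ 2)
      ∂((P : Measure (X × ℝ)).condKernel x) ≤ ENNReal.ofReal s2)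
    (hG : ∀ᵐ x ∂(marginal P : Measure X), (g x - condMean P x) ^ 2 ≤ G) (hG0 : 0 ≤ G) :
    ∫⁻ z, ENNReal.ofReal (((z.2 - g z.1) * w z.1) ^ 2) ∂(P : Measure (X × ℝ)) ≤
      ENNReal.ofReal (2 * s2 + 2 * G) *
        ∫⁻ x, ENNReal.ofReal (w x ^ 2) ∂(marginal P : Measure X) := by
  have hm : Measurable fun z : X × ℝ => ENNReal.ofReal (((z.2 - g z.1) * w z.1) ^ 2) := by
    fun_prop
  conv_lhs => rw [← marginal_compProd_condKernel P, Measure.lintegral_compProd hm]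
  rw [← lintegral_const_mul _ (by fun_prop)]
  refine lintegral_mono_ae ?_
  filter_upwards [hs, hG] with x hx hx'
  calc ∫⁻ y, ENNReal.ofReal (((y - g x) * w x) ^ 2) ∂((P : Measure (X × ℝ)).condKernel x)
      ≤ ∫⁻ y, ENNReal.ofReal (w x ^ 2) * (ENNReal.ofReal 2 * ENNReal.ofReal
          ((y - condMean P x) ^ 2) + ENNReal.ofReal (2 * G))
          ∂((P : Measure (X × ℝ)).condKernel x) := by
        refine lintegral_mono fun y => ?_
        rw [← ENNReal.ofReal_mul (by norm_num), ← ENNReal.ofReal_add (by positivity)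
          (by positivity), ← ENNReal.ofReal_mul (by positivity)]
        refine ENNReal.ofReal_le_ofReal ?_
        rw [mul_pow, mul_comm]
        gcongr
        nlinarith [sq_nonneg ((y - condMean P x) + (g x - condMean P x))]
    _ = ENNReal.ofReal (w x ^ 2) * (ENNReal.ofReal 2 * ∫⁻ y, ENNReal.ofReal
          ((y - condMean P x) ^ 2) ∂((P : Measure (X × ℝ)).condKernel x) +
            ENNReal.ofReal (2 * G)) := by
        rw [lintegral_const_mul _ (by fun_prop), lintegral_add_right _ measurable_const,
          lintegral_const_mul _ (by fun_prop)]
        simp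
    _ ≤ ENNReal.ofReal (w x ^ 2) * (ENNReal.ofReal 2 * ENNReal.ofReal s2 +
          ENNReal.ofReal (2 * G)) := by gcongr
    _ = _ := by
        rw [← ENNReal.ofReal_mul (by norm_num), ← ENNReal.ofReal_add (by positivity)
          (by positivity), mul_comm]

end Joint

/-! ### Weighted sums of squared deviations of sample means -/

theorem lintegral_tsum_sampleMean_le {Ω ι : Type*} [MeasurableSpace Ω] [Countable ι]
    (P : Measure Ω) [IsProbabilityMeasure P] {n : ℕ} (hn : 1 ≤ n) {φ : ι → Ω → ℝ}
    (hφ : ∀ i, Measurable (φ i)) {e w : ι → ℝ} (he : ∀ i, ∫ z, φ i z ∂P = e i)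
    (hw : ∀ i, 0 < w i) :
    ∫⁻ D, ∑' i, ENNReal.ofReal ((1 / (n : ℝ) * ∑ j, φ i (D j) - e i) ^ 2 / w i)
      ∂Measure.pi (fun _ : Fin n => P) ≤
      (∑' i, ∫⁻ z, ENNReal.ofReal (φ i z ^ 2 / w i) ∂P) / n := by
  have hm : ∀ i, Measurable fun D : Fin n → Ω => 1 / (n : ℝ) * ∑ j, φ i (D j) - e i := fun i =>
    ((Finset.measurable_fun_sum _ fun j _ => (hφ i).comp (measurable_pi_apply j)).const_mul
      _).sub_const _
  rw [lintegral_tsum fun i => (((hm i).pow_const 2).div_const _).ennreal_ofReal.aemeasurable,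
    ENNReal.div_eq_inv_mul, ← ENNReal.tsum_mul_left]
  refine ENNReal.tsum_le_tsum fun i => ?_
  have hc : 0 ≤ (w i)⁻¹ := inv_nonneg.2 (hw i).le
  simp only [div_eq_inv_mul (_ ^ 2) (w i), ENNReal.ofReal_mul hc]
  rw [lintegral_const_mul _ ((hm i).pow_const 2).ennreal_ofReal,
    lintegral_const_mul _ ((hφ i).pow_const 2).ennreal_ofReal, mul_left_comm,
    ← ENNReal.div_eq_inv_mul]
  gcongr
  exact lintegral_sq_sampleMean_sub_le P hn (hφ i) (he i)

theorem sum_le_of_tsum_ofReal_le {ι : Type*} {f : ι → ℝ} (hf : ∀ i, 0 ≤ f i) {s : ℝ} (hs : 0 ≤ s)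
    (h : ∑' i, ENNReal.ofReal (f i) ≤ ENNReal.ofReal s) (F : Finset ι) : ∑ i ∈ F, f i ≤ s := by
  have h1 := (ENNReal.sum_le_tsum F).trans h
  rwa [← ENNReal.ofReal_sum_of_nonneg fun i _ => hf i, ENNReal.ofReal_le_ofReal_iff hs] at h1

/-! ### Stochastic bounds and the upper rate for the LS-SVM -/

section Upper

variable {X : Type*} {H : Type*} [NormedAddCommGroup H]
  [InnerProductSpace ℝ H] [CompleteSpace H] [RKHS ℝ H X ℝ] [MeasurableSpace X]
  [MeasurableBoundedKernel H]

/-- The double series is the square of ∑ b_i² / (μ_i + reg). One factor is bounded almost everywhere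
by A² reg^(-α); the other integrates to the effective dimension. -/
theorem tsum_lintegral_gram_le (ν : Measure X) [IsFiniteMeasure ν] {α A reg N : ℝ}
    (hA : 0 < A) (hα0 : 0 ≤ α) (hα : α ≤ 1) (hreg : 0 < reg)
    (hemb : ∀ f ∈ powerSpace H ν α,
      eLpNorm f ∞ ν ≤ ENNReal.ofReal A * powerNorm H ν α f)
    (hN : ∑' i, ENNReal.ofReal ((spectralSystem H ν).eig i / ((spectralSystem H ν).eig i + reg)) ≤
      ENNReal.ofReal N) :
    ∑' z : (spectralSystem H ν).idx × (spectralSystem H ν).idx,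
      ∫⁻ x, ENNReal.ofReal (((spectralSystem H ν).basis z.1 x * (spectralSystem H ν).basis z.2 x) ^ 2
        / (((spectralSystem H ν).eig z.1 + reg) * ((spectralSystem H ν).eig z.2 + reg))) ∂ν ≤
      ENNReal.ofReal (A ^ 2 * reg ^ (-α) * N) := by
  have hpos := fun i => (spectralSystem H ν).eig_pos i
  have hm : ∀ i, Measurable fun x => ENNReal.ofReal ((spectralSystem H ν).basis i x ^ 2 /
      ((spectralSystem H ν).eig i + reg)) := fun i =>
    (((rkhs_measurable _).pow_const 2).div_const _).ennreal_ofReal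
  have hm2 : ∀ z : (spectralSystem H ν).idx × (spectralSystem H ν).idx, Measurable fun x =>
      ENNReal.ofReal (((spectralSystem H ν).basis z.1 x * (spectralSystem H ν).basis z.2 x) ^ 2 /
        (((spectralSystem H ν).eig z.1 + reg) * ((spectralSystem H ν).eig z.2 + reg))) := fun z =>
    ((((rkhs_measurable _).mul (rkhs_measurable _)).pow_const 2).div_const _).ennreal_ofReal
  rw [← lintegral_tsum fun z => (hm2 z).aemeasurable]
  calc _ = ∫⁻ x, (∑' i, ENNReal.ofReal ((spectralSystem H ν).basis i x ^ 2 /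
          ((spectralSystem H ν).eig i + reg))) * (∑' i, ENNReal.ofReal
          ((spectralSystem H ν).basis i x ^ 2 / ((spectralSystem H ν).eig i + reg))) ∂ν := by
        refine lintegral_congr fun x => ?_
        rw [ENNReal.tsum_prod', ← ENNReal.tsum_mul_right]
        refine tsum_congr fun i => ?_
        rw [← ENNReal.tsum_mul_left]
        refine tsum_congr fun k => ?_
        have h1 := hpos i
        have h2 := hpos k
        rw [← ENNReal.ofReal_mul (by positivity), mul_pow, div_mul_div_comm]
    _ ≤ ∫⁻ x, ENNReal.ofReal (A ^ 2 * reg ^ (-α)) * (∑' i, ENNReal.ofReal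
          ((spectralSystem H ν).basis i x ^ 2 / ((spectralSystem H ν).eig i + reg))) ∂ν := by
        refine lintegral_mono_ae ?_
        filter_upwards [ae_tsum_basis_sq_le ν hA hα0 hα hemb hreg] with x hx
        gcongr
    _ = ENNReal.ofReal (A ^ 2 * reg ^ (-α)) * ∑' i, ENNReal.ofReal
          ((spectralSystem H ν).eig i / ((spectralSystem H ν).eig i + reg)) := by
        rw [lintegral_const_mul _ (Measurable.tsum hm),
          lintegral_tsum fun i => (hm i).aemeasurable]
        congr 1
        refine tsum_congr fun i => ?_
        have h1 := hpos i
        have hc : 0 ≤ ((spectralSystem H ν).eig i + reg)⁻¹ := by positivity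
        simp only [div_eq_inv_mul, ENNReal.ofReal_mul hc]
        rw [lintegral_const_mul _ ((rkhs_measurable _).pow_const 2).ennreal_ofReal,
          lintegral_basis_sq]
    _ ≤ _ := by
        rw [ENNReal.ofReal_mul (p := A ^ 2 * reg ^ (-α)) (q := N) (by positivity)]
        gcongr

theorem integral_mul_eq_inner {ν : Measure X} [IsFiniteMeasure ν] {f : Lp ℝ 2 ν} {fs : X → ℝ}
    (hf : fs =ᵐ[ν] f) (u : H) : ∫ x, fs x * u x ∂ν = ⟪rkhsEmbedding H ν u, f⟫_ℝ := by
  rw [L2.inner_def]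
  refine integral_congr_ae ?_
  filter_upwards [hf, rkhsEmbedding_coeFn (ν := ν) u] with x h1 h2
  rw [h1, h2]
  simp

/-- These are the population normal equations for g: they identify the mean that makes the linear
terms of the error identity centred. -/
theorem integral_residual_mul_basis {P : ProbabilityMeasure (X × ℝ)}
    (hy : Integrable (fun z : X × ℝ => z.2) (P : Measure (X × ℝ))) {β reg : ℝ} (hreg : 0 < reg)
    {a : lp (fun _ : (spectralSystem H (marginal P : Measure X)).idx => ℝ) 2}
    {f : Lp ℝ 2 (marginal P : Measure X)} (hf : condMean P =ᵐ[(marginal P : Measure X)] f)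
    (ha : IsPowerCoeff H (marginal P : Measure X) β a f) {g : H}
    (hg : ∀ i, ⟪(spectralSystem H (marginal P : Measure X)).basis i, g⟫_ℝ =
      √((spectralSystem H (marginal P : Measure X)).eig i) *
        (spectralSystem H (marginal P : Measure X)).eig i ^ (β / 2) /
        ((spectralSystem H (marginal P : Measure X)).eig i + reg) * a i)
    (i : (spectralSystem H (marginal P : Measure X)).idx) :
    ∫ z, (z.2 - g z.1) * (spectralSystem H (marginal P : Measure X)).basis i z.1
      ∂(P : Measure (X × ℝ)) =
      reg * ⟪(spectralSystem H (marginal P : Measure X)).basis i, g⟫_ℝ := by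
  obtain ⟨κ, -, hκ⟩ := exists_rkhs_bound H
  obtain ⟨h1, h2⟩ := integral_snd_mul_fst P hy
    (rkhs_measurable ((spectralSystem H (marginal P : Measure X)).basis i)) (hκ _)
  have hgb : Measurable fun x => g x * (spectralSystem H (marginal P : Measure X)).basis i x :=
    (rkhs_measurable g).mul (rkhs_measurable _)
  have h3 : Integrable (fun z : X × ℝ => g z.1 *
      (spectralSystem H (marginal P : Measure X)).basis i z.1) (P : Measure (X × ℝ)) := by
    refine Integrable.of_bound (hgb.comp measurable_fst).aestronglyMeasurable
      (κ * ‖g‖ * (κ * ‖(spectralSystem H (marginal P : Measure X)).basis i‖))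
      (Eventually.of_forall fun z => ?_)
    rw [norm_mul]
    exact mul_le_mul (hκ _ _) (hκ _ _) (norm_nonneg _) ((norm_nonneg _).trans (hκ g z.1))
  have h4 := integral_fst_eq P hgb
  simp only [sub_mul]
  rw [integral_sub h1 h3, h2, h4, integral_mul_eq_inner hf,
    integral_mul_eq_inner (rkhsEmbedding_coeFn g).symm, SpectralSystem.map_basis,
    real_inner_smul_left, real_inner_smul_left, ha.inner_eq, SpectralSystem.inner_map_fn, ← mul_sub]
  have hp := (spectralSystem H (marginal P : Measure X)).eig_pos i
  have h5 := regularized_coeff (a := a i)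
    (b := (spectralSystem H (marginal P : Measure X)).eig i ^ (β / 2)) hp hreg
  rw [hg]
  rw [show ∀ u v : ℝ, u - v = -(v - u) from fun u v => by ring, h5]
  ring

/-- Split u - f* at g. The stochastic part uses μ^(1-γ) ≤ reg^(-γ) (μ + reg), giving 2 · 4 = 8; the
other part is the bias. -/
theorem powerNorm_lsSVM_sub_sq_le {ν : Measure X} [IsFiniteMeasure ν] {γ β reg S2 B : ℝ}
    (hreg : 0 < reg) (hγ0 : 0 ≤ γ) (hγ1 : γ ≤ 1) (hγβ : γ ≤ β) (hβ : β ≤ 2) (hB : 0 ≤ B)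
    (hS2 : 0 ≤ S2)
    {a : lp (fun _ : (spectralSystem H ν).idx => ℝ) 2} {f : Lp ℝ 2 ν} {fs : X → ℝ}
    (hf : fs =ᵐ[ν] f) (ha : IsPowerCoeff H ν β a f) (haB : ‖a‖ₑ ^ 2 ≤ ENNReal.ofReal B) {g : H}
    (hg : ∀ i, ⟪(spectralSystem H ν).basis i, g⟫_ℝ =
      √((spectralSystem H ν).eig i) * (spectralSystem H ν).eig i ^ (β / 2) /
        ((spectralSystem H ν).eig i + reg) * a i) (u : H)
    (hu : ∀ F : Finset (spectralSystem H ν).idx, ∑ i ∈ F, ((spectralSystem H ν).eig i + reg) *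
      ⟪(spectralSystem H ν).basis i, u - g⟫_ℝ ^ 2 ≤ 4 * S2) :
    powerNorm H ν γ (fun x => u x - fs x) ^ 2 ≤
      ENNReal.ofReal (8 * reg ^ (-γ) * S2 + 2 * reg ^ (β - γ) * B) := by
  have hpos := fun i => (spectralSystem H ν).eig_pos i
  rw [powerNorm_sq (coe_sub_ae_eq hf u) (hasSum_sub_powerCoeff ha u)]
  have h1 := tsum_bias_le hreg hg (s := γ) (by linarith) (by linarith)
  have h2 : ∑' i, ENNReal.ofReal (((spectralSystem H ν).eig i + reg) *
      ⟪(spectralSystem H ν).basis i, u - g⟫_ℝ ^ 2) ≤ ENNReal.ofReal (4 * S2) := by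
    rw [ENNReal.tsum_eq_iSup_sum]
    refine iSup_le fun F => ?_
    rw [← ENNReal.ofReal_sum_of_nonneg fun i _ => by have := hpos i; positivity]
    exact ENNReal.ofReal_le_ofReal (hu F)
  calc _ ≤ ∑' i, (ENNReal.ofReal (2 * reg ^ (-γ)) * ENNReal.ofReal
          (((spectralSystem H ν).eig i + reg) * ⟪(spectralSystem H ν).basis i, u - g⟫_ℝ ^ 2) +
        ENNReal.ofReal 2 * ENNReal.ofReal ((√((spectralSystem H ν).eig i) *
          ⟪(spectralSystem H ν).basis i, g⟫_ℝ - a i * (spectralSystem H ν).eig i ^ (β / 2)) ^ 2 *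
            (spectralSystem H ν).eig i ^ (-γ))) := by
        refine ENNReal.tsum_le_tsum fun i => ?_
        have hp := hpos i
        rw [← ENNReal.ofReal_mul (by positivity), ← ENNReal.ofReal_mul (by norm_num),
          ← ENNReal.ofReal_add (by positivity) (by positivity)]
        refine ENNReal.ofReal_le_ofReal ?_
        set h := ⟪(spectralSystem H ν).basis i, u - g⟫_ℝ with hh
        set bias := √((spectralSystem H ν).eig i) *
          ⟪(spectralSystem H ν).basis i, g⟫_ℝ - a i * (spectralSystem H ν).eig i ^ (β / 2)
        have h3 : √((spectralSystem H ν).eig i) * ⟪(spectralSystem H ν).basis i, u⟫_ℝ -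
            a i * (spectralSystem H ν).eig i ^ (β / 2) =
            √((spectralSystem H ν).eig i) * h + bias := by
          rw [hh, inner_sub_right]; ring
        have h4 := rpow_one_sub_le hp hreg hγ0 hγ1
        have h5 : (√((spectralSystem H ν).eig i) * h) ^ 2 *
            (spectralSystem H ν).eig i ^ (-γ) = (spectralSystem H ν).eig i ^ (1 - γ) * h ^ 2 := by
          rw [mul_pow, Real.sq_sqrt hp.le, sub_eq_add_neg, Real.rpow_add hp, Real.rpow_one]
          ring
        rw [h3]
        calc _ ≤ (2 * (√((spectralSystem H ν).eig i) * h) ^ 2 + 2 * bias ^ 2) *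
              (spectralSystem H ν).eig i ^ (-γ) := by
              gcongr
              nlinarith [sq_nonneg (√((spectralSystem H ν).eig i) * h - bias)]
          _ = 2 * ((spectralSystem H ν).eig i ^ (1 - γ) * h ^ 2) +
              2 * (bias ^ 2 * (spectralSystem H ν).eig i ^ (-γ)) := by rw [← h5]; ring
          _ ≤ 2 * (reg ^ (-γ) * ((spectralSystem H ν).eig i + reg) * h ^ 2) +
              2 * (bias ^ 2 * (spectralSystem H ν).eig i ^ (-γ)) := by gcongr
          _ = _ := by ring
    _ ≤ ENNReal.ofReal (2 * reg ^ (-γ)) * ENNReal.ofReal (4 * S2) +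
        ENNReal.ofReal 2 * (ENNReal.ofReal (reg ^ (β - γ)) * ENNReal.ofReal B) := by
        rw [ENNReal.tsum_add, ENNReal.tsum_mul_left, ENNReal.tsum_mul_left]
        gcongr
        exact h1.trans (by gcongr)
    _ = _ := by
        rw [← ENNReal.ofReal_mul (by positivity), ← ENNReal.ofReal_mul (by positivity),
          ← ENNReal.ofReal_mul (by positivity), ← ENNReal.ofReal_add (by positivity)
            (by positivity)]
        congr 1
        ring

theorem exists_powerCoeff_of_mem_jointClass {β B Binf L σ : ℝ} {𝔛 : Set (ProbabilityMeasure X)}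
    {P : ProbabilityMeasure (X × ℝ)} (hP : P ∈ jointClass H β B Binf L σ 𝔛) :
    ∃ (a : lp (fun _ : (spectralSystem H (marginal P : Measure X)).idx => ℝ) 2)
      (f : Lp ℝ 2 (marginal P : Measure X)), condMean P =ᵐ[(marginal P : Measure X)] f ∧
      IsPowerCoeff H (marginal P : Measure X) β a f ∧ ‖a‖ₑ ^ 2 ≤ ENNReal.ofReal B := by
  have h := hP.2.2.2.1
  have hfin : powerNorm H (marginal P : Measure X) β (condMean P) ≠ ∞ := by
    intro h'
    rw [h'] at h
    simp at h
  obtain ⟨a, f, hf, ha, e⟩ := exists_isPowerCoeff_of_powerNorm_ne_top hfin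
  exact ⟨a, f, hf, ha, e ▸ h⟩

/-- Markov's inequality for the two random series: the weighted noise sum must stay below S2 and the
squared Gram deviation below 1/4. The two terms of the bound are the respective failure
probabilities. -/
theorem errorProb_lsSVM_le [TopologicalSpace.SeparableSpace H]
    {α β γ p A C B Binf L σ reg N S2 t : ℝ} (hα0 : 0 ≤ α) (hα : α ≤ 1) (hαβ : α ≤ β)
    (hγ0 : 0 ≤ γ) (hγ1 : γ ≤ 1) (hγβ : γ ≤ β) (hβ : β ≤ 2) (hA : 0 < A) (hB : 0 ≤ B)
    {P : ProbabilityMeasure (X × ℝ)} (hP : P ∈ jointClass H β B Binf L σ (marginalClass H α p A C))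
    (hreg : 0 < reg) {n : ℕ} (hn : 1 ≤ n) (hS2 : 0 < S2) (hN0 : 0 ≤ N)
    (hN : ∑' i, ENNReal.ofReal ((spectralSystem H (marginal P : Measure X)).eig i /
      ((spectralSystem H (marginal P : Measure X)).eig i + reg)) ≤ ENNReal.ofReal N)
    (ht : 8 * reg ^ (-γ) * S2 + 2 * reg ^ (β - γ) * B ≤ t) :
    errorProb H γ (fun D : Fin n → X × ℝ => ⇑(lsSVM H reg D)) P t ≤
      ENNReal.ofReal ((2 * σ ^ 2 + 2 * (A ^ 2 * (reg ^ (β - α) * B))) * N / n / S2 +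
        4 * (A ^ 2 * reg ^ (-α) * N / n)) := by
  classical
  have hn' : (0 : ℝ) < n := by exact_mod_cast hn
  have hpos := fun i => (spectralSystem H (marginal P : Measure X)).eig_pos i
  have hemb := hP.1.2.1
  obtain ⟨a, f, hf, ha, haB⟩ := exists_powerCoeff_of_mem_jointClass hP
  obtain ⟨g, hg, hgsum⟩ := (spectralSystem H (marginal P : Measure X)).exists_regularized a
    (hγ0.trans hγβ) hreg
  have hy : Integrable (fun z : X × ℝ => z.2) (P : Measure (X × ℝ)) :=
    ((memLp_two_iff_integrable_sq measurable_snd.aestronglyMeasurable).2 hP.2.1).integrable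
      one_le_two
  set V := 2 * σ ^ 2 + 2 * (A ^ 2 * (reg ^ (β - α) * B)) with hV
  have hV0 : 0 ≤ V := by positivity
  have hbias := ae_sq_sub_le_of_embedding hA hB hemb hf ha haB hreg hg (by linarith) (by linarith)
  have hnoise : ∀ᵐ x ∂(marginal P : Measure X), ∫⁻ y, ENNReal.ofReal ((y - condMean P x) ^ 2)
      ∂((P : Measure (X × ℝ)).condKernel x) ≤ ENNReal.ofReal (σ ^ 2) := by
    filter_upwards [hP.2.2.2.2] with x hx
    have := hx 2 le_rfl
    simpa using this
  let φ : (spectralSystem H (marginal P : Measure X)).idx → X × ℝ → ℝ := fun i z =>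
    (z.2 - g z.1) * (spectralSystem H (marginal P : Measure X)).basis i z.1
  let ψ : (spectralSystem H (marginal P : Measure X)).idx ×
      (spectralSystem H (marginal P : Measure X)).idx → X × ℝ → ℝ := fun k z =>
    (spectralSystem H (marginal P : Measure X)).basis k.1 z.1 *
      (spectralSystem H (marginal P : Measure X)).basis k.2 z.1
  have hφm : ∀ i, Measurable (φ i) := fun i =>
    (measurable_snd.sub ((rkhs_measurable g).comp measurable_fst)).mul
      ((rkhs_measurable _).comp measurable_fst)
  have hψm : ∀ k, Measurable (ψ k) := fun k =>
    ((rkhs_measurable _).comp measurable_fst).mul ((rkhs_measurable _).comp measurable_fst)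
  let St : (Fin n → X × ℝ) → ℝ≥0∞ := fun D => ∑' i, ENNReal.ofReal
    ((1 / (n : ℝ) * ∑ j, φ i (D j) -
      reg * ⟪(spectralSystem H (marginal P : Measure X)).basis i, g⟫_ℝ) ^ 2 /
      ((spectralSystem H (marginal P : Measure X)).eig i + reg))
  let Rt : (Fin n → X × ℝ) → ℝ≥0∞ := fun D => ∑' k, ENNReal.ofReal
    ((1 / (n : ℝ) * ∑ j, ψ k (D j) -
      if k.1 = k.2 then (spectralSystem H (marginal P : Measure X)).eig k.1 else 0) ^ 2 /
      (((spectralSystem H (marginal P : Measure X)).eig k.1 + reg) *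
        ((spectralSystem H (marginal P : Measure X)).eig k.2 + reg)))
  have hStm : Measurable St := Measurable.tsum fun i =>
    (((((Finset.measurable_fun_sum _ fun j _ =>
      (hφm i).comp (measurable_pi_apply j)).const_mul _).sub_const _).pow_const 2).div_const
        _).ennreal_ofReal
  have hRtm : Measurable Rt := Measurable.tsum fun k =>
    (((((Finset.measurable_fun_sum _ fun j _ =>
      (hψm k).comp (measurable_pi_apply j)).const_mul _).sub_const _).pow_const 2).div_const
        _).ennreal_ofReal
  have hSt : ∫⁻ D, St D ∂Measure.pi (fun _ : Fin n => (P : Measure (X × ℝ))) ≤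
      ENNReal.ofReal (V * N / n) := by
    refine (lintegral_tsum_sampleMean_le (P : Measure (X × ℝ)) hn hφm
      (fun i => integral_residual_mul_basis hy hreg hf ha hg i)
      (fun i => by have := hpos i; positivity)).trans ?_
    rw [ENNReal.ofReal_div_of_pos hn', ENNReal.ofReal_natCast]
    gcongr
    rw [ENNReal.ofReal_mul hV0]
    refine le_trans ?_ (mul_le_mul_right hN _)
    rw [← ENNReal.tsum_mul_left]
    refine ENNReal.tsum_le_tsum fun i => ?_
    have hp := hpos i
    have hc : 0 ≤ ((spectralSystem H (marginal P : Measure X)).eig i + reg)⁻¹ := by positivity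
    simp only [div_eq_inv_mul, ENNReal.ofReal_mul hc]
    rw [lintegral_const_mul _ ((hφm i).pow_const 2).ennreal_ofReal, mul_left_comm]
    gcongr
    rw [← lintegral_basis_sq]
    exact lintegral_residual_sq_le P (rkhs_measurable g) (rkhs_measurable _) (sq_nonneg σ) hnoise
      hbias (by positivity)
  have hRt : ∫⁻ D, Rt D ∂Measure.pi (fun _ : Fin n => (P : Measure (X × ℝ))) ≤
      ENNReal.ofReal (A ^ 2 * reg ^ (-α) * N / n) := by
    refine (lintegral_tsum_sampleMean_le (P : Measure (X × ℝ)) hn hψm (fun k => ?_)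
      (fun k => by have := hpos k.1; have := hpos k.2; positivity)).trans ?_
    · have hmeas : Measurable fun x =>
          (spectralSystem H (marginal P : Measure X)).basis k.1 x *
            (spectralSystem H (marginal P : Measure X)).basis k.2 x :=
        (rkhs_measurable _).mul (rkhs_measurable _)
      refine (integral_fst_eq P hmeas).trans ?_
      rw [integral_mul_eq_inner (rkhsEmbedding_coeFn _).symm, SpectralSystem.inner_map_basis]
      by_cases hk : k.1 = k.2
      · simp [hk]
      · simp [hk, Ne.symm hk]
    rw [ENNReal.ofReal_div_of_pos hn', ENNReal.ofReal_natCast]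
    gcongr
    refine le_trans (le_of_eq (tsum_congr fun k => ?_))
      (tsum_lintegral_gram_le (marginal P : Measure X) hA hα0 hα hreg hemb hN)
    exact lintegral_fst_eq P
      ((((rkhs_measurable _).mul (rkhs_measurable _)).pow_const 2).div_const _).ennreal_ofReal
  have hgood : ∀ᵐ D ∂Measure.pi (fun _ : Fin n => (P : Measure (X × ℝ))), ∀ j, ∀ u : H,
      HasSum (fun i => ⟪(spectralSystem H (marginal P : Measure X)).basis i, u⟫_ℝ *
        (spectralSystem H (marginal P : Measure X)).basis i (D j).1) (u (D j).1) := by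
    refine ae_all_iff.2 fun j => ?_
    exact (Measure.quasiMeasurePreserving_eval (fun _ : Fin n => (P : Measure (X × ℝ))) j).ae
      (ae_fst P (ae_hasSum_apply (H := H) (marginal P : Measure X)))
  -- Outside a null set of samples, a large error forces one of the two series to be large. Only the
  -- measurability of these series is then needed.
  have hsub : ∀ᵐ D ∂Measure.pi (fun _ : Fin n => (P : Measure (X × ℝ))),
      D ∈ {D : Fin n → X × ℝ | ENNReal.ofReal t < powerNorm H (marginal P : Measure X) γ
        (fun x => lsSVM H reg D x - condMean P x) ^ 2} →
      D ∈ {D | ENNReal.ofReal S2 ≤ St D} ∪ {D | ENNReal.ofReal (1 / 4) ≤ Rt D} := by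
    filter_upwards [hgood] with D hD
    contrapose!
    intro hnot
    rw [Set.mem_union, not_or] at hnot
    obtain ⟨h1, h2⟩ := hnot
    have h1' : St D ≤ ENNReal.ofReal S2 := (not_le.1 h1).le
    have h2' : Rt D ≤ ENNReal.ofReal (1 / 4) := (not_le.1 h2).le
    refine (powerNorm_lsSVM_sub_sq_le hreg hγ0 hγ1 hγβ hβ hB hS2.le hf ha haB hg _ fun F => ?_).trans
      (ENNReal.ofReal_le_ofReal ht)
    refine sum_inner_sq_le_of_good_sample (spectralSystem H (marginal P : Measure X)) hreg D hD g
      hgsum (fun F => ?_) (fun F => ?_) F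
    · exact sum_le_of_tsum_ofReal_le (fun i => by have := hpos i; positivity) hS2.le h1' F
    · rw [← Finset.sum_product']
      exact sum_le_of_tsum_ofReal_le
        (fun k => by have := hpos k.1; have := hpos k.2; positivity) (by norm_num) h2' (F ×ˢ F)
  rw [errorProb]
  refine (measure_mono_ae hsub).trans ((measure_union_le _ _).trans ?_)
  rw [ENNReal.ofReal_add (by positivity) (by positivity)]
  refine add_le_add ?_ ?_
  · refine (meas_ge_le_lintegral_div hStm.aemeasurable
      (by simpa using hS2) ENNReal.ofReal_ne_top).trans ?_
    rw [ENNReal.ofReal_div_of_pos hS2]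
    gcongr
  · refine (meas_ge_le_lintegral_div hRtm.aemeasurable
      (by simp) ENNReal.ofReal_ne_top).trans ?_
    calc _ ≤ ENNReal.ofReal (A ^ 2 * reg ^ (-α) * N / n) / ENNReal.ofReal (1 / 4) := by gcongr
      _ = _ := by
        rw [← ENNReal.ofReal_div_of_pos (by norm_num)]
        congr 1
        ring

/-- In coordinates the squared error is a countable sum of measurable functions of ⟨b_i, f_D⟩. It is
therefore measurable for the product σ-algebra itself, which the universal completion contains. -/
theorem lsSVM_mem_learningMethods {β γ B Binf L σ reg : ℝ} {𝔛 : Set (ProbabilityMeasure X)}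
    (hreg : 0 < reg) {n : ℕ} (hn : 1 ≤ n) :
    (fun D => ⇑(lsSVM H reg D)) ∈ learningMethods H γ (jointClass H β B Binf L σ 𝔛) n := by
  refine ⟨fun D => rkhs_measurable _, fun P hP => ?_⟩
  obtain ⟨a, f, hf, ha, -⟩ := exists_powerCoeff_of_mem_jointClass hP
  have hsq : Measurable fun D : Fin n → X × ℝ => powerNorm H (marginal P : Measure X) γ
      (fun x => lsSVM H reg D x - condMean P x) ^ 2 := by
    have h1 : ∀ D : Fin n → X × ℝ, _ := fun D => powerNorm_sq (γ := γ)
      (coe_sub_ae_eq hf (lsSVM H reg D)) (hasSum_sub_powerCoeff ha (lsSVM H reg D))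
    simp only [h1]
    refine Measurable.tsum fun i => ?_
    have h2 := measurable_inner_lsSVM (H := H) hreg hn
      ((spectralSystem H (marginal P : Measure X)).basis i)
    simp only [real_inner_comm ((spectralSystem H (marginal P : Measure X)).basis i)] at h2 ⊢
    exact ((((h2.const_mul _).sub_const _).pow_const 2).mul_const _).ennreal_ofReal
  have hm : Measurable fun D : Fin n → X × ℝ => powerNorm H (marginal P : Measure X) γ
      (fun x => lsSVM H reg D x - condMean P x) := by
    have h1 : ∀ r : ℝ≥0∞, r = (r ^ 2) ^ (1 / 2 : ℝ) := fun r => by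
      rw [← ENNReal.rpow_natCast, ← ENNReal.rpow_mul]
      simp
    have h2 := hsq.pow_const (1 / 2 : ℝ)
    simpa only [← h1] using h2
  exact hm.mono (fun s hs μ hμ => hs.nullMeasurableSet) le_rfl

/-- With ρ = n^(-1/(β+p)) one has n = ρ^(-(β+p)), so every power of n and of reg becomes a power of
ρ. The noise failure probability is K₁/τ uniformly in n, and the Gram failure probability is of
order ρ^(β-α). -/
theorem lsSVM_upper_rate [TopologicalSpace.SeparableSpace H]
    {α β γ p A C B Binf L σ : ℝ} (hp : 0 < p) (hpα : p ≤ α) (hα : α ≤ 1) (hαβ : α < β)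
    (hγ0 : 0 ≤ γ) (hγ1 : γ ≤ 1) (hγβ : γ < β) (hβ : β ≤ 2) (hA : 0 < A) (hC : 0 < C) (hB : 0 < B)
    (hσ : 0 < σ) (reg : ℕ → ℝ) (hreg : ∀ n, 1 ≤ n → 0 < reg n)
    (hΘ : reg =Θ[atTop] (fun n : ℕ => (1 / (n : ℝ)) ^ (1 / (β + p)))) :
    Tendsto (fun τ : ℝ => limsup (fun n : ℕ =>
        ⨆ P ∈ jointClass H β B Binf L σ (marginalClass (X := X) H α p A C),
          errorProb H γ (fun D : Fin n → X × ℝ => ⇑(lsSVM H (reg n) D)) P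
            (τ * (1 / (n : ℝ)) ^ ((β - γ) / (β + p)))) atTop)
      atTop (𝓝 0) := by
  have hβp : 0 < β + p := by linarith
  obtain ⟨c₂, hc₂, hup⟩ := hΘ.1.exists_pos
  obtain ⟨c₁', hc₁', hlo⟩ := hΘ.2.exists_pos
  set ρ : ℕ → ℝ := fun n => (1 / (n : ℝ)) ^ (1 / (β + p)) with hρ
  set c₁ := c₁'⁻¹ with hc₁def
  have hc₁ : 0 < c₁ := inv_pos.2 hc₁'
  obtain ⟨N, hN, hNle⟩ := exists_tsum_eig_filter_le (X := X) (H := H) hp hpα hα hA hC hc₂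
  set V := 2 * σ ^ 2 + 2 * (A ^ 2 * (c₂ ^ (β - α) * B)) with hV
  have hV0 : 0 < V := by positivity
  set K₁ := 16 * V * N * c₁ ^ (-(p + γ)) with hK₁
  set K₂ := 4 * A ^ 2 * N * c₁ ^ (-(α + p)) with hK₂
  have hev : ∀ᶠ n : ℕ in atTop, ∀ τ : ℝ, 0 < τ → 4 * B * c₂ ^ (β - γ) ≤ τ →
      ⨆ P ∈ jointClass H β B Binf L σ (marginalClass (X := X) H α p A C),
          errorProb H γ (fun D : Fin n → X × ℝ => ⇑(lsSVM H (reg n) D)) P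
            (τ * (1 / (n : ℝ)) ^ ((β - γ) / (β + p))) ≤
        ENNReal.ofReal (K₁ / τ + K₂ * ρ n ^ (β - α)) := by
    filter_upwards [hup.bound, hlo.bound, eventually_ge_atTop 1] with n h1 h2 hn τ hτ hτ'
    have hn1 : (1 : ℝ) ≤ n := by exact_mod_cast hn
    have hn0 : (0 : ℝ) < n := by linarith
    have hr := hreg n hn
    have hρ0 : 0 < ρ n := by simp only [hρ]; positivity
    have hρ1 : ρ n ≤ 1 := Real.rpow_le_one (by positivity)
      ((div_le_one hn0).2 hn1) (by positivity)
    rw [Real.norm_of_nonneg hr.le, Real.norm_of_nonneg hρ0.le] at h1 h2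
    have hup' : reg n ≤ c₂ * ρ n := h1
    have hlo' : c₁ * ρ n ≤ reg n := by
      rw [hc₁def, inv_mul_le_iff₀ hc₁']; exact h2
    have hregΛ : reg n ≤ c₂ := hup'.trans (mul_le_of_le_one_right hc₂.le hρ1)
    have hρpow : ∀ s : ℝ, ρ n ^ s = (1 / (n : ℝ)) ^ (s / (β + p)) := fun s => by
      simp only [hρ]
      rw [← Real.rpow_mul (by positivity)]
      congr 1; ring
    have hρn : ρ n ^ (-(β + p)) = n := by
      rw [hρpow, neg_div, div_self hβp.ne', Real.rpow_neg (by positivity), Real.rpow_one]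
      simp
    have hregneg : ∀ s : ℝ, 0 ≤ s → reg n ^ (-s) ≤ c₁ ^ (-s) * ρ n ^ (-s) := fun s hs => by
      rw [← Real.mul_rpow hc₁.le hρ0.le]
      exact Real.rpow_le_rpow_of_nonpos (by positivity) hlo' (by linarith)
    rw [← hρpow]
    -- This makes 8 reg^(-γ) S2 half of the target error; the other half pays for the bias as soon
    -- as τ ≥ 4 B c₂^(β-γ).
    set S2 := τ * ρ n ^ (β - γ) * reg n ^ γ / 16 with hS2
    have hS20 : 0 < S2 := by positivity
    refine iSup₂_le fun P hP => ?_
    refine (errorProb_lsSVM_le (S2 := S2) (N := N * reg n ^ (-p)) (hp.le.trans hpα) hα hαβ.le hγ0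
      hγ1 hγβ.le hβ hA hB.le hP hr hn hS20 (by positivity) (hNle _ hr hregΛ _ hP.1) ?_).trans
      (ENNReal.ofReal_le_ofReal ?_)
    · have e1 : 8 * reg n ^ (-γ) * S2 = τ * ρ n ^ (β - γ) / 2 := by
        have : reg n ^ (-γ) * reg n ^ γ = 1 := by rw [← Real.rpow_add hr]; simp
        rw [hS2]
        linear_combination (τ * ρ n ^ (β - γ) / 2) * this
      have e2 : reg n ^ (β - γ) ≤ c₂ ^ (β - γ) * ρ n ^ (β - γ) := by
        rw [← Real.mul_rpow hc₂.le hρ0.le]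
        exact Real.rpow_le_rpow hr.le hup' (by linarith)
      rw [e1]
      calc _ ≤ τ * ρ n ^ (β - γ) / 2 + 2 * (c₂ ^ (β - γ) * ρ n ^ (β - γ)) * B := by gcongr
        _ = τ * ρ n ^ (β - γ) / 2 + (4 * B * c₂ ^ (β - γ)) * ρ n ^ (β - γ) / 2 := by ring
        _ ≤ τ * ρ n ^ (β - γ) / 2 + τ * ρ n ^ (β - γ) / 2 := by gcongr
        _ = _ := by ring
    · have e3 : 2 * σ ^ 2 + 2 * (A ^ 2 * (reg n ^ (β - α) * B)) ≤ V := by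
        rw [hV]
        have := Real.rpow_le_rpow hr.le hregΛ (show 0 ≤ β - α by linarith)
        gcongr
      have e4 : V * (N * reg n ^ (-p)) / n / S2 ≤ K₁ / τ := by
        have h5 : reg n ^ (-p) * reg n ^ (-γ) ≤ c₁ ^ (-(p + γ)) * ρ n ^ (-(p + γ)) := by
          rw [← Real.rpow_add hr, ← neg_add]
          exact hregneg _ (by linarith)
        have h6 : V * (N * reg n ^ (-p)) / n / S2 =
            16 * V * N * (reg n ^ (-p) * reg n ^ (-γ)) * ρ n ^ (-(β - γ)) / n / τ := by
          rw [hS2, Real.rpow_neg hr.le γ, Real.rpow_neg hρ0.le (β - γ)]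
          field_simp
        have h7 : ρ n ^ (-(p + γ)) * ρ n ^ (-(β - γ)) = n := by
          rw [← Real.rpow_add hρ0, ← hρn]
          congr 1; ring
        rw [h6]
        calc _ ≤ 16 * V * N * (c₁ ^ (-(p + γ)) * ρ n ^ (-(p + γ))) * ρ n ^ (-(β - γ)) / n / τ := by
              gcongr
          _ = K₁ * (ρ n ^ (-(p + γ)) * ρ n ^ (-(β - γ))) / n / τ := by rw [hK₁]; ring
          _ = K₁ / τ := by rw [h7, mul_div_cancel_right₀ _ hn0.ne']
      have e5 : 4 * (A ^ 2 * reg n ^ (-α) * (N * reg n ^ (-p)) / n) ≤ K₂ * ρ n ^ (β - α) := by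
        have h5 : reg n ^ (-α) * reg n ^ (-p) ≤ c₁ ^ (-(α + p)) * ρ n ^ (-(α + p)) := by
          rw [← Real.rpow_add hr, ← neg_add]
          exact hregneg _ (by linarith)
        -- The Gram deviation is of order ρ^(-(α+p)) / n, and the strict inequality α < β makes the
        -- resulting exponent positive.
        have h6 : ρ n ^ (-(α + p)) / n = ρ n ^ (β - α) := by
          rw [div_eq_iff hn0.ne', ← hρn, ← Real.rpow_add hρ0]
          congr 1; ring
        calc _ = 4 * A ^ 2 * N * (reg n ^ (-α) * reg n ^ (-p)) / n := by ring
          _ ≤ 4 * A ^ 2 * N * (c₁ ^ (-(α + p)) * ρ n ^ (-(α + p))) / n := by gcongr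
          _ = K₂ * (ρ n ^ (-(α + p)) / n) := by rw [hK₂]; ring
          _ = _ := by rw [h6]
      calc _ ≤ V * (N * reg n ^ (-p)) / n / S2 +
            4 * (A ^ 2 * reg n ^ (-α) * (N * reg n ^ (-p)) / n) := by gcongr
        _ ≤ _ := add_le_add e4 e5
  have hρlim : Tendsto (fun n => ρ n ^ (β - α)) atTop (𝓝 0) := by
    have h1 : Tendsto (fun n : ℕ => 1 / (n : ℝ)) atTop (𝓝 0) := tendsto_one_div_atTop_nhds_zero_nat
    have h2 := (h1.rpow_const (p := 1 / (β + p)) (Or.inr (by positivity))).rpow_const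
      (p := β - α) (Or.inr (by linarith))
    rw [Real.zero_rpow (by positivity), Real.zero_rpow (by linarith)] at h2
    exact h2
  have hlim : Tendsto (fun τ : ℝ => ENNReal.ofReal (K₁ / τ)) atTop (𝓝 0) := by
    have := ENNReal.tendsto_ofReal (tendsto_const_nhds (x := K₁).div_atTop tendsto_id)
    simpa using this
  refine tendsto_of_tendsto_of_tendsto_of_le_of_le' tendsto_const_nhds hlim
    (Eventually.of_forall fun _ => zero_le) ?_
  filter_upwards [eventually_gt_atTop 0, eventually_ge_atTop (4 * B * c₂ ^ (β - γ))] with τ h1 h2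
  have h3 : Tendsto (fun n => ENNReal.ofReal (K₁ / τ + K₂ * ρ n ^ (β - α))) atTop
      (𝓝 (ENNReal.ofReal (K₁ / τ))) := by
    have h4 : Tendsto (fun n => K₁ / τ + K₂ * ρ n ^ (β - α)) atTop (𝓝 (K₁ / τ + K₂ * 0)) :=
      tendsto_const_nhds.add (hρlim.const_mul _)
    rw [mul_zero, add_zero] at h4
    exact ENNReal.tendsto_ofReal h4
  rw [← h3.limsup_eq]
  refine limsup_le_limsup ?_
  filter_upwards [hev] with n hn using hn τ h1 h2

end Upper

end KernelRegression

/-! ### The lower rate and its attainment -/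

theorem mainTheorem3 {X : Type*} [MeasurableSpace X] (H : Type*) [NormedAddCommGroup H]
    [InnerProductSpace ℝ H] [CompleteSpace H] [TopologicalSpace.SeparableSpace H] [RKHS ℝ H X ℝ]
    [MeasurableBoundedKernel H]
    (α β γ p q A C c B Binf L σ : ℝ)
    (hq : 0 < q) (hqp : q ≤ p) (hpα : p ≤ α) (hα : α ≤ 1)
    (hγ0 : 0 ≤ γ) (hγ1 : γ ≤ 1) (hγβ : γ < β) (hβ : β ≤ 2)
    (hA : 0 < A) (hC : 0 < C) (hc : 0 < c) (hB : 0 < B) (hBinf : 0 < Binf)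
    (hL : 0 < L) (hσ : 0 < σ)
    (hne : ∃ ν ∈ marginalClassLB H α p q A C c,
      (spectralSystem H (ν : Measure X)).idx.Infinite) :
    -- the minimax lower rate
    Tendsto (fun τ : ℝ => liminf (fun n : ℕ =>
        ⨅ fhat ∈ learningMethods H γ
            (jointClass H β B Binf L σ (marginalClassLB H α p q A C c)) n,
          ⨆ P ∈ jointClass H β B Binf L σ (marginalClassLB H α p q A C c),
            errorProb H γ fhat P
              (τ * (1 / (n : ℝ)) ^ ((max α β - γ) / (max α β + q - γ * (1 - q / p))))) atTop)
      (𝓝[>] 0) (𝓝 1) ∧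
    -- for `q = p` and `α < β` the LS-SVM attains this rate
    (q = p → α < β →
      (max α β - γ) / (max α β + q - γ * (1 - q / p)) = (β - γ) / (β + p) ∧
      ∀ reg : ℕ → ℝ, (∀ n, 1 ≤ n → 0 < reg n) →
        reg =Θ[atTop] (fun n : ℕ => (1 / (n : ℝ)) ^ (1 / (β + p))) →
        (∀ n, 1 ≤ n → (fun D => ⇑(lsSVM H (reg n) D)) ∈ learningMethods H γ
          (jointClass H β B Binf L σ (marginalClass H α p A C)) n) ∧
        Tendsto (fun τ : ℝ => limsup (fun n : ℕ =>
            ⨆ P ∈ jointClass H β B Binf L σ (marginalClass H α p A C),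
              errorProb H γ (fun D : Fin n → X × ℝ => ⇑(lsSVM H (reg n) D)) P
                (τ * (1 / (n : ℝ)) ^ ((β - γ) / (β + p)))) atTop)
          atTop (𝓝 0)) := by
  refine ⟨minimax_lower_rate H α β γ p q A C c B Binf L σ hq hqp hγ0 hγβ hA hC hc hB
    hBinf hL hσ hne, ?_⟩
  rintro rfl hαβ
  refine ⟨by rw [max_eq_right hαβ.le, div_self hq.ne']; simp, fun reg hreg hΘ =>
    ⟨fun n hn => lsSVM_mem_learningMethods (hreg n hn) hn,
      lsSVM_upper_rate hq hpα hα hαβ hγ0 hγ1 hγβ hβ hA hC hB hσ reg hreg hΘ⟩⟩
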